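/- \textbf{Notions.} Let $k$ be a commutative ring and $S$ a set. A \emph{$k$-quiver} on $S$ is a family $Q=(Q(a,b))_{a,b\in S}$ of $k$-modules; morphisms are families of $k$-linear maps. Quivers on $S$ form a monoidal category $k\mathrm{Quiv}_S$ with $$(P\otimes_S Q)(a,b)=\bigoplus_{c\in S}P(a,c)\otimes_k Q(c,b),$$ and unit $I_S$, where $I_S(a,b)=k$ if $a=b$ and $0$ otherwise. Let $\mathbf{fint}$ be the category with objects $[n]=\{0<\dots<n\}$, $n\ge 0$, and with morphisms $f:[m]\to[n]$ the order preserving maps with $f(0)=0$, $f(m)=n$; it is strict monoidal with $[m]+[n]=[m+n]$. A \emph{templicial $k$-module} with vertex set $S$ is a colax monoidal functor $X:\mathbf{fint}^{op}\to k\mathrm{Quiv}_S$, $[n]\mapsto X_n$, whose counit $X_0\to I_S$ is an isomorphism. The templicial $k$-modules with vertex set $S$ form a category, with monoidal natural transformations as morphisms. $X$ is \emph{levelwise flat} if $X_n(a,b)$ is a flat $k$-module for all $n\ge0$, $a,b\in S$. For a ring homomorphism $R\to k$ and a templicial $R$-module $\bar X$, the \emph{base change} $k\otimes_R\bar X$ is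 the composition of $\bar X$ with the strong monoidal functor $k\otimes_R-$, so that $(k\otimes_R\bar X)_n(a,b)=k\otimes_R\bar X_n(a,b)$. The category $\mathcal{N}ec$ of necklaces has as objects the pairs $(T,p)$ with $p\ge 0$ and $\{0,p\}\subseteq T\subseteq[p]$, and as morphisms $(T,p)\to(U,q)$ the morphisms $f:[p]\to[q]$ of $\mathbf{fint}$ with $U\subseteq f(T)$. For a templicial $k$-module $X$ and $T=\{0=t_0<\dots<t_r=p\}$ let $X_T=X_{t_1}\otimes_S X_{t_2-t_1}\otimes_S\dots\otimes_S X_{p-t_{r-1}}$ (and $X_{\{0\}}=I_S$). This extends to a functor on $\mathcal{N}ec^{op}$, where the maps $f$ with $f(T)=U$ act through the functoriality of $X$ on $\mathbf{fint}^{op}$ (and the counit), and the maps with $f=\mathrm{id}$ act through the comultiplications. Evaluating at $a,b\in S$ gives $X_\bullet(a,b):\mathcal{N}ec^{op}\to\mathrm{Mod}(k)$. For a simplicial set $K$, let $\tilde F(K)$ be the templicial $k$-module with vertex set $K_0$, where $\tilde F(K)_n(a,b)$ is the free $k$-module on the $n$-simplices of $K$ with first vertex $a$ and last vertex $b$, inner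 faces and degeneracies come from $K$, and the comultiplication $\tilde F(K)_{m+n}\to \tilde F(K)_m\otimes\tilde F(K)_n$ sends a simplex to (its front $m$-face) $\otimes$ (its back $n$-face). A functor $Y:\mathcal{N}ec^{op}\to\mathrm{Mod}(k)$ is \emph{weak Kan} if, for all $0<j<n$, every morphism $\tilde F(\Lambda^n_j)_\bullet(0,n)\to Y$ of functors extends along the map $\tilde F(\Lambda^n_j)_\bullet(0,n)\to\tilde F(\Delta^n)_\bullet(0,n)$ induced by the inclusion of the horn $\Lambda^n_j\subseteq\Delta^n$ to a morphism $\tilde F(\Delta^n)_\bullet(0,n)\to Y$. A templicial $k$-module $X$ with vertex set $S$ is a \emph{quasi-category in $k$-modules} if $X_\bullet(a,b)$ is weak Kan for all $a,b\in S$. \textbf{Theorem.} Let $\theta:R\to k$ be a surjective homomorphism of commutative rings whose kernel is a nilpotent ideal, let $S$ be a set, let $\bar X$ be a levelwise flat templicial $R$-module with vertex set $S$, and let $X$ be a templicial $k$-module with vertex set $S$ which is isomorphic to $k\otimes_R\bar X$ (for instance $X=k\otimes_R\bar X$). If $X$ is a quasi-category in $k$-modules, then $\bar X$ is a quasi-category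 in $R$-modules. -/

import Mathlib

open CategoryTheory MonoidalCategory Opposite
open scoped TensorProduct DirectSum

universe u

set_option linter.unusedSimpArgs false
set_option linter.unusedSectionVars false

/-- Objects of the finite interval category: `⟨n⟩` stands for the ordinal `[n] = {0 < ... < n}`. -/
structure FInt : Type where
  len : ℕ

namespace FInt

/-- Order preserving maps `[m] → [n]` which preserve both endpoints. -/
@[ext]
structure Hom (m n : ℕ) : Type where
  toOrderHom : Fin (m + 1) →o Fin (n + 1)
  map_zero : toOrderHom 0 = 0
  map_last : toOrderHom (Fin.last m) = Fin.last n

namespace Hom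

/-- `f` as a function of natural numbers (constant from `m` on). -/
def app {m n : ℕ} (f : Hom m n) (i : ℕ) : ℕ :=
  f.toOrderHom ⟨min i m, by omega⟩

lemma app_zero {m n : ℕ} (f : Hom m n) : f.app 0 = 0 := by
  have := f.map_zero
  simp only [app, Nat.zero_min]
  exact congrArg Fin.val this

lemma app_of_le {m n : ℕ} (f : Hom m n) {i : ℕ} (h : m ≤ i) : f.app i = n := by
  have : (⟨min i m, by omega⟩ : Fin (m + 1)) = Fin.last m := by
    ext; simp [h]
  simp only [app, this, f.map_last, Fin.val_last]

lemma app_mono {m n : ℕ} (f : Hom m n) {i j : ℕ} (h : i ≤ j) : f.app i ≤ f.app j :=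
  f.toOrderHom.monotone (by simp only [Fin.mk_le_mk]; omega)

lemma app_le {m n : ℕ} (f : Hom m n) (i : ℕ) : f.app i ≤ n := by
  have := (f.toOrderHom ⟨min i m, by omega⟩).isLt
  unfold app; omega

lemma toOrderHom_apply {m n : ℕ} (f : Hom m n) (i : Fin (m + 1)) :
    (f.toOrderHom i : ℕ) = f.app i := by
  have : (⟨min (i : ℕ) m, by omega⟩ : Fin (m + 1)) = i := by
    ext; simp; omega
  simp only [app, this]

lemma ext_app {m n : ℕ} {f g : Hom m n} (h : ∀ i, i ≤ m → f.app i = g.app i) : f = g := by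
  ext i
  rw [toOrderHom_apply, toOrderHom_apply]
  exact h _ (by omega)

/-- Constructor from a function of natural numbers. -/
def mk' {m n : ℕ} (φ : ℕ → ℕ) (h0 : φ 0 = 0) (hm : φ m = n)
    (hφ : ∀ i j, i ≤ j → j ≤ m → φ i ≤ φ j) : Hom m n where
  toOrderHom :=
    { toFun := fun i => ⟨φ i, by have := hφ i m (by omega) le_rfl; omega⟩
      monotone' := fun i j h => by
        simp only [Fin.mk_le_mk]
        exact hφ _ _ h (by omega) }
  map_zero := Fin.ext h0
  map_last := Fin.ext hm

lemma mk'_app {m n : ℕ} (φ : ℕ → ℕ) (h0 : φ 0 = 0) (hm : φ m = n)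
    (hφ : ∀ i j, i ≤ j → j ≤ m → φ i ≤ φ j) (i : ℕ) :
    (mk' φ h0 hm hφ).app i = φ (min i m) := rfl

/-- The identity. -/
def id (n : ℕ) : Hom n n := ⟨OrderHom.id, rfl, rfl⟩

/-- Composition (in diagrammatic order). -/
def comp {l m n : ℕ} (f : Hom l m) (g : Hom m n) : Hom l n :=
  ⟨g.toOrderHom.comp f.toOrderHom, by simp [f.map_zero, g.map_zero],
    by simp [f.map_last, g.map_last]⟩

lemma id_app (n i : ℕ) : (id n).app i = min i n := rfl

lemma comp_app {l m n : ℕ} (f : Hom l m) (g : Hom m n) (i : ℕ) :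
    (f.comp g).app i = g.app (f.app i) := by
  rw [← toOrderHom_apply (f := g) (i := ⟨f.app i, by have := f.app_le i; omega⟩)]
  rfl

/-- The sum `f + g : [m + m'] → [n + n']` of two maps: `f` on `[0, m]`, and `g`, shifted, on
`[m, m + m']`. -/
def add {m n m' n' : ℕ} (f : Hom m n) (g : Hom m' n') : Hom (m + m') (n + n') :=
  mk' (fun i => if i ≤ m then f.app i else n + g.app (i - m))
    (by simp [app_zero])
    (by
      split_ifs with h
      · obtain rfl : m' = 0 := by omega
        have := g.app_zero
        have h2 := g.app_of_le le_rfl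
        rw [f.app_of_le (by omega)]; omega
      · rw [g.app_of_le (by omega)])
    (fun i j h _ => by
      split_ifs
      · exact f.app_mono h
      · have := f.app_le i; omega
      · omega
      · have := g.app_mono (show i - m ≤ j - m by omega); omega)

lemma add_app {m n m' n' : ℕ} (f : Hom m n) (g : Hom m' n') (i : ℕ) :
    (f.add g).app i = if i ≤ m then f.app i else n + g.app (i - m) := by
  have h1 := g.app_of_le (i := min i (m + m') - m)
  have h2 := g.app_of_le (i := i - m)
  have h3 := f.app_of_le (i := i)
  have h4 := f.app_of_le (i := min i (m + m'))
  have h5 := g.app_zero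
  by_cases h : i ≤ m + m'
  · simp only [add, mk'_app, min_eq_left h]
  · simp only [add, mk'_app]
    rw [min_eq_right (by omega)] at *
    split_ifs <;> grind

/-- The identity `[m] → [n]` for `m = n`. -/
def cast {m n : ℕ} (h : m = n) : Hom m n :=
  mk' (fun i => i) rfl h (fun _ _ h _ => h)

lemma cast_app {m n : ℕ} (h : m = n) (i : ℕ) : (cast h).app i = min i m := rfl

end Hom

instance : Category FInt where
  Hom a b := Hom a.len b.len
  id a := Hom.id a.len
  comp f g := f.comp g
  id_comp _ := rfl
  comp_id _ := rfl
  assoc _ _ _ := rfl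

lemma id_app (a : FInt) (i : ℕ) : Hom.app (𝟙 a) i = min i a.len := rfl
lemma comp_app {a b c : FInt} (f : a ⟶ b) (g : b ⟶ c) (i : ℕ) :
    Hom.app (f ≫ g) i = Hom.app g (Hom.app f i) := Hom.comp_app f g i
lemma hom_ext {a b : FInt} {f g : a ⟶ b} (h : ∀ i, i ≤ a.len → Hom.app f i = Hom.app g i) :
    f = g := Hom.ext_app h

/-- The isomorphism `[m] ≅ [n]` for `m = n`. -/
def castIso {a b : FInt} (h : a.len = b.len) : a ≅ b where
  hom := Hom.cast h
  inv := Hom.cast h.symm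
  hom_inv_id := hom_ext fun i hi => by
    simp only [comp_app, id_app, Hom.cast_app]; omega
  inv_hom_id := hom_ext fun i hi => by
    simp only [comp_app, id_app, Hom.cast_app]; omega

lemma castIso_hom_app {a b : FInt} (h : a.len = b.len) (i : ℕ) :
    Hom.app (castIso h).hom i = min i a.len := rfl
lemma castIso_inv_app {a b : FInt} (h : a.len = b.len) (i : ℕ) :
    Hom.app (castIso h).inv i = min i b.len := rfl

instance : MonoidalCategoryStruct FInt where
  tensorObj a b := ⟨a.len + b.len⟩
  tensorUnit := ⟨0⟩
  tensorHom f g := Hom.add f g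
  whiskerLeft a _ _ g := Hom.add (Hom.id a.len) g
  whiskerRight f b := Hom.add f (Hom.id b.len)
  associator _ _ _ := castIso (Nat.add_assoc _ _ _)
  leftUnitor _ := castIso (Nat.zero_add _)
  rightUnitor _ := castIso (Nat.add_zero _)

lemma tensor_len (a b : FInt) : (a ⊗ b).len = a.len + b.len := rfl
lemma unit_len : (𝟙_ FInt).len = 0 := rfl

lemma tensorHom_app {a b c d : FInt} (f : a ⟶ b) (g : c ⟶ d) (i : ℕ) :
    Hom.app (f ⊗ₘ g : a ⊗ c ⟶ b ⊗ d) i =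
      if i ≤ a.len then Hom.app f i else b.len + Hom.app g (i - a.len) :=
  Hom.add_app f g i

lemma whiskerLeft_app (a : FInt) {c d : FInt} (g : c ⟶ d) (i : ℕ) :
    Hom.app (a ◁ g : a ⊗ c ⟶ a ⊗ d) i =
      if i ≤ a.len then i else a.len + Hom.app g (i - a.len) := by
  refine (Hom.add_app (Hom.id a.len) g i).trans ?_
  rw [Hom.id_app]
  split_ifs with h
  · omega
  · rfl

lemma whiskerRight_app {a b : FInt} (f : a ⟶ b) (c : FInt) (i : ℕ) :
    Hom.app (f ▷ c : a ⊗ c ⟶ b ⊗ c) i =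
      if i ≤ a.len then Hom.app f i else b.len + min (i - a.len) c.len :=
  Hom.add_app f (Hom.id c.len) i

lemma assoc_hom_app (a b c : FInt) (i : ℕ) :
    Hom.app (α_ a b c).hom i = min i (a.len + b.len + c.len) := rfl
lemma assoc_inv_app (a b c : FInt) (i : ℕ) :
    Hom.app (α_ a b c).inv i = min i (a.len + (b.len + c.len)) := rfl
lemma leftUnitor_hom_app (a : FInt) (i : ℕ) :
    Hom.app (λ_ a).hom i = min i (0 + a.len) := rfl
lemma leftUnitor_inv_app (a : FInt) (i : ℕ) :
    Hom.app (λ_ a).inv i = min i a.len := rfl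
lemma rightUnitor_hom_app (a : FInt) (i : ℕ) :
    Hom.app (ρ_ a).hom i = min i (a.len + 0) := rfl
lemma rightUnitor_inv_app (a : FInt) (i : ℕ) :
    Hom.app (ρ_ a).inv i = min i a.len := rfl

lemma app_le {a b : FInt} (f : a ⟶ b) (i : ℕ) : Hom.app f i ≤ b.len := Hom.app_le f i
lemma app_of_le {a b : FInt} (f : a ⟶ b) {i : ℕ} (h : a.len ≤ i) : Hom.app f i = b.len :=
  Hom.app_of_le f h
lemma app_zero {a b : FInt} (f : a ⟶ b) : Hom.app f 0 = 0 := Hom.app_zero f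

instance : MonoidalCategory FInt where
  tensorHom_def f g := hom_ext fun i hi => by
    simp only [comp_app, tensorHom_app, whiskerLeft_app, whiskerRight_app, tensor_len] at *
    have h1 := app_le f i
    have h2 := app_of_le f le_rfl
    have h3 := app_zero g
    grind
  id_tensorHom_id a b := hom_ext fun i hi => by
    simp only [id_app, tensorHom_app, tensor_len] at *
    grind
  tensorHom_comp_tensorHom {a₁ b₁ c₁ a₂ b₂ c₂} f₁ f₂ g₁ g₂ := hom_ext fun i hi => by
    simp only [comp_app, tensorHom_app, tensor_len] at *
    have h1 := app_le f₁ i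
    have h2 := app_of_le f₁ le_rfl
    have h3 := app_of_le g₁ le_rfl
    have h4 := app_zero g₂
    grind
  whiskerLeft_id a b := hom_ext fun i hi => by
    simp only [id_app, whiskerLeft_app, tensor_len] at *
    grind
  id_whiskerRight a b := hom_ext fun i hi => by
    simp only [id_app, whiskerRight_app, tensor_len] at *
    grind
  associator_naturality {a₁ a₂ a₃ b₁ b₂ b₃} f g h := hom_ext fun i hi => by
    simp only [comp_app, tensorHom_app, tensor_len, assoc_hom_app] at *
    have h1 := app_le f i
    have h2 := app_le g (i - a₁.len)
    have h3 := app_le h (i - (a₁.len + a₂.len))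
    have h4 : i - a₁.len - a₂.len = i - (a₁.len + a₂.len) := by omega
    grind
  leftUnitor_naturality {a b} f := hom_ext fun i hi => by
    simp only [comp_app, whiskerLeft_app, tensor_len, leftUnitor_hom_app, unit_len] at *
    have h1 := app_le f i
    have h2 := app_zero f
    grind
  rightUnitor_naturality {a b} f := hom_ext fun i hi => by
    simp only [comp_app, whiskerRight_app, tensor_len, rightUnitor_hom_app, unit_len] at *
    have h1 := app_le f i
    grind
  pentagon a b c d := hom_ext fun i hi => by
    simp only [comp_app, whiskerLeft_app, whiskerRight_app, tensor_len, assoc_hom_app] at *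
    grind
  triangle a b := hom_ext fun i hi => by
    simp only [comp_app, whiskerLeft_app, whiskerRight_app, tensor_len, assoc_hom_app,
      leftUnitor_hom_app, rightUnitor_hom_app, unit_len] at *
    grind

end FInt

/-- A `k`-quiver with vertex set `S`: a family of `k`-modules `Q(a, b)`, for `a, b ∈ S`. -/
structure ModQuiver (k : Type u) [CommRing k] (S : Type u) : Type (u + 1) where
  hom : S → S → ModuleCat.{u} k

namespace ModQuiver

variable {k : Type u} [CommRing k] {S : Type u}

/-- A quiver morphism (fixing the vertices) is a family of `k`-linear maps. -/
@[ext]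
structure Hom (P Q : ModQuiver k S) : Type u where
  app : ∀ a b, P.hom a b →ₗ[k] Q.hom a b

instance : Category (ModQuiver k S) where
  Hom := Hom
  id _ := ⟨fun _ _ => LinearMap.id⟩
  comp f g := ⟨fun a b => g.app a b ∘ₗ f.app a b⟩

@[ext]
lemma hom_ext {P Q : ModQuiver k S} {f g : P ⟶ Q} (h : ∀ a b x, f.app a b x = g.app a b x) : f = g :=
  Hom.ext (funext fun a => funext fun b => LinearMap.ext (h a b))

@[simp] lemma id_app (P : ModQuiver k S) (a b : S) (x : P.hom a b) : Hom.app (𝟙 P) a b x = x := rfl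
@[simp] lemma comp_app {P Q R : ModQuiver k S} (f : P ⟶ Q) (g : Q ⟶ R) (a b : S) (x : P.hom a b) :
    Hom.app (f ≫ g) a b x = g.app a b (f.app a b x) := rfl

/-- The tensor product of quivers: `(P ⊗ Q)(a, b) = ⨁ c, P(a, c) ⊗ Q(c, b)`. -/
def tensor (P Q : ModQuiver k S) : ModQuiver k S :=
  ⟨fun a b => ModuleCat.of k (⨁ c : S, P.hom a c ⊗[k] Q.hom c b)⟩

/-- The unit quiver: `I(a, b)` is the free module on the proposition `a = b`, that is, `k` for
`a = b` and `0` otherwise. -/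
noncomputable def unit (k : Type u) [CommRing k] (S : Type u) : ModQuiver k S :=
  ⟨fun a b => ModuleCat.of k (PLift (a = b) →₀ k)⟩

open Classical in
/-- The pure tensor `p ⊗ q` in the summand of `c`. -/
noncomputable def pure {P Q : ModQuiver k S} {a b : S} (c : S) (p : P.hom a c) (q : Q.hom c b) :
    (tensor P Q).hom a b :=
  DirectSum.lof k S (fun c : S => P.hom a c ⊗[k] Q.hom c b) c (p ⊗ₜ[k] q)

open Classical in
/-- Linear maps out of `(P ⊗ Q)(a, b)`, from bilinear maps. -/
noncomputable def lift {P Q : ModQuiver k S} {a b : S} {M : Type u} [AddCommGroup M] [Module k M]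
    (φ : ∀ c, P.hom a c →ₗ[k] Q.hom c b →ₗ[k] M) : (tensor P Q).hom a b →ₗ[k] M :=
  DirectSum.toModule k S M (fun c => TensorProduct.lift (φ c))

@[simp]
lemma lift_pure {P Q : ModQuiver k S} {a b : S} {M : Type u} [AddCommGroup M] [Module k M]
    (φ : ∀ c, P.hom a c →ₗ[k] Q.hom c b →ₗ[k] M) (c : S) (p : P.hom a c) (q : Q.hom c b) :
    lift φ (pure c p q) = φ c p q := by
  classical
  unfold lift pure
  refine (DirectSum.toModule_lof k c _).trans ?_
  simp

lemma tensor_ext {P Q : ModQuiver k S} {a b : S} {M : Type u} [AddCommGroup M] [Module k M]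
    {f g : (tensor P Q).hom a b →ₗ[k] M}
    (h : ∀ c (p : P.hom a c) (q : Q.hom c b), f (pure c p q) = g (pure c p q)) : f = g := by
  classical
  refine DirectSum.linearMap_ext k fun c => TensorProduct.ext' fun p q => ?_
  exact h c p q

/-- `pure` as a bilinear map. -/
noncomputable def pureₗ {P Q : ModQuiver k S} {a b : S} (c : S) :
    P.hom a c →ₗ[k] Q.hom c b →ₗ[k] (tensor P Q).hom a b :=
  LinearMap.mk₂ k (pure c)
    (fun _ _ _ => by simp [pure, TensorProduct.add_tmul]; rfl)
    (fun r p q => (congrArg _ (TensorProduct.smul_tmul' r p q).symm).trans (map_smul _ _ _))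
    (fun _ _ _ => by simp [pure, TensorProduct.tmul_add]; rfl)
    (fun _ _ _ => by simp [pure]; rfl)

lemma pure_add {P Q : ModQuiver k S} {a b : S} (c : S) (p : P.hom a c) (q q' : Q.hom c b) :
    pure c p (q + q') = pure c p q + pure c p q' := (pureₗ c p).map_add q q'
lemma add_pure {P Q : ModQuiver k S} {a b : S} (c : S) (p p' : P.hom a c) (q : Q.hom c b) :
    pure c (p + p') q = pure c p q + pure c p' q := ((pureₗ c).flip q).map_add p p'
lemma pure_smul {P Q : ModQuiver k S} {a b : S} (c : S) (r : k) (p : P.hom a c) (q : Q.hom c b) :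
    pure c p (r • q) = r • pure c p q := (pureₗ c p).map_smul r q
lemma smul_pure {P Q : ModQuiver k S} {a b : S} (c : S) (r : k) (p : P.hom a c) (q : Q.hom c b) :
    pure c (r • p) q = r • pure c p q := ((pureₗ c).flip q).map_smul r p

@[simp] lemma pureₗ_apply {P Q : ModQuiver k S} {a b : S} (c : S) (p : P.hom a c) (q : Q.hom c b) :
    pureₗ c p q = pure c p q := rfl

/-- The tensor product of quiver morphisms. -/
noncomputable def map {P P' Q Q' : ModQuiver k S} (f : P ⟶ P') (g : Q ⟶ Q') :
    tensor P Q ⟶ tensor P' Q' :=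
  ⟨fun a b => lift fun c => (pureₗ c).compl₁₂ (f.app a c) (g.app c b)⟩

@[simp]
lemma map_pure {P P' Q Q' : ModQuiver k S} (f : P ⟶ P') (g : Q ⟶ Q') {a b : S} (c : S)
    (p : P.hom a c) (q : Q.hom c b) :
    (map f g).app a b (pure c p q) = pure c (f.app a c p) (g.app c b q) := by
  simp [map]

lemma map_ext {P Q R : ModQuiver k S} {f g : tensor P Q ⟶ R}
    (h : ∀ a b c (p : P.hom a c) (q : Q.hom c b),
      f.app a b (pure c p q) = g.app a b (pure c p q)) : f = g :=
  Hom.ext (funext fun a => funext fun b => tensor_ext (h a b))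

lemma map_ext₃ {P Q R T : ModQuiver k S} {f g : tensor (tensor P Q) R ⟶ T}
    (h : ∀ a b c d (p : P.hom a c) (q : Q.hom c d) (r : R.hom d b),
      f.app a b (pure d (pure c p q) r) = g.app a b (pure d (pure c p q) r)) : f = g :=
  map_ext fun a b d x r => by
    refine LinearMap.congr_fun (f := f.app a b ∘ₗ (pureₗ d).flip r)
      (g := g.app a b ∘ₗ (pureₗ d).flip r) (tensor_ext fun c p q => ?_) x
    exact h a b c d p q r

lemma map_ext₃' {P Q R T : ModQuiver k S} {f g : tensor P (tensor Q R) ⟶ T}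
    (h : ∀ a b c d (p : P.hom a c) (q : Q.hom c d) (r : R.hom d b),
      f.app a b (pure c p (pure d q r)) = g.app a b (pure c p (pure d q r))) : f = g :=
  map_ext fun a b c p x => by
    refine LinearMap.congr_fun (f := f.app a b ∘ₗ pureₗ c p)
      (g := g.app a b ∘ₗ pureₗ c p) (tensor_ext fun d q r => ?_) x
    exact h a b c d p q r

lemma map_ext₄ {P Q R T W : ModQuiver k S} {f g : tensor (tensor (tensor P Q) R) T ⟶ W}
    (h : ∀ a b c d e (p : P.hom a c) (q : Q.hom c d) (r : R.hom d e) (t : T.hom e b),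
      f.app a b (pure e (pure d (pure c p q) r) t) =
        g.app a b (pure e (pure d (pure c p q) r) t)) : f = g :=
  map_ext₃ fun a b d e x r t => by
    refine LinearMap.congr_fun
      (f := f.app a b ∘ₗ (pureₗ e).flip t ∘ₗ (pureₗ d).flip r)
      (g := g.app a b ∘ₗ (pureₗ e).flip t ∘ₗ (pureₗ d).flip r) (tensor_ext fun c p q => ?_) x
    exact h a b c d e p q r t

/-- The associator `(P ⊗ Q) ⊗ R ≅ P ⊗ (Q ⊗ R)`. -/
noncomputable def assoc (P Q R : ModQuiver k S) :
    tensor (tensor P Q) R ≅ tensor P (tensor Q R) where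
  hom := ⟨fun a b => lift fun d => lift fun c =>
    LinearMap.mk₂ k (fun p q => (pureₗ c p) ∘ₗ (pureₗ d q))
      (fun _ _ _ => by ext; simp [pure_add, add_pure])
      (fun _ _ _ => by ext; simp [pure_smul, smul_pure])
      (fun _ _ _ => by ext; simp [pure_add, add_pure])
      (fun _ _ _ => by ext; simp [pure_smul, smul_pure])⟩
  inv := ⟨fun a b => lift fun c => LinearMap.flip <| lift fun d =>
    LinearMap.mk₂ k (fun q r => (pureₗ d).flip r ∘ₗ (pureₗ c).flip q)
      (fun _ _ _ => by ext; simp [pure_add, add_pure])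
      (fun _ _ _ => by ext; simp [pure_smul, smul_pure])
      (fun _ _ _ => by ext; simp [pure_add, add_pure])
      (fun _ _ _ => by ext; simp [pure_smul, smul_pure])⟩
  hom_inv_id := map_ext₃ fun a b c d p q r => by simp
  inv_hom_id := map_ext₃' fun a b c d p q r => by simp

@[simp] lemma assoc_hom_pure (P Q R : ModQuiver k S) {a b : S} (c d : S) (p : P.hom a c)
    (q : Q.hom c d) (r : R.hom d b) :
    (assoc P Q R).hom.app a b (pure d (pure c p q) r) = pure c p (pure d q r) := by
  simp [assoc]

@[simp] lemma assoc_inv_pure (P Q R : ModQuiver k S) {a b : S} (c d : S) (p : P.hom a c)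
    (q : Q.hom c d) (r : R.hom d b) :
    (assoc P Q R).inv.app a b (pure c p (pure d q r)) = pure d (pure c p q) r := by
  simp [assoc]

/-- The generator of `I(a, a)`. -/
noncomputable def one (a : S) : (unit k S).hom a a := Finsupp.single ⟨rfl⟩ 1

lemma unit_ext {a b : S} {M : Type u} [AddCommGroup M] [Module k M]
    {f g : (unit k S).hom a b →ₗ[k] M}
    (h : ∀ e : a = b, f (e ▸ one a) = g (e ▸ one a)) : f = g := by
  refine Finsupp.lhom_ext' fun ⟨e⟩ => LinearMap.ext_ring ?_
  subst e
  exact h rfl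

/-- Linear maps out of `I(a, b)`. -/
noncomputable def unitLift {a b : S} {M : Type u} [AddCommGroup M] [Module k M]
    (φ : a = b → M) : (unit k S).hom a b →ₗ[k] M :=
  Finsupp.lift M k (PLift (a = b)) fun e => φ e.down

@[simp] lemma unitLift_one {a : S} {M : Type u} [AddCommGroup M] [Module k M]
    (φ : a = a → M) : unitLift (k := k) φ (one a) = φ rfl := by
  simp only [unitLift, one]
  refine (Finsupp.lift_apply _ _ _ _ _).trans ?_
  simp

lemma map_ext_left {Q R : ModQuiver k S} {f g : tensor (unit k S) Q ⟶ R}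
    (h : ∀ a b (q : Q.hom a b), f.app a b (pure a (one a) q) = g.app a b (pure a (one a) q)) :
    f = g :=
  map_ext fun a b c p q => by
    refine LinearMap.congr_fun (f := f.app a b ∘ₗ (pureₗ c).flip q)
      (g := g.app a b ∘ₗ (pureₗ c).flip q) (unit_ext fun e => ?_) p
    subst e
    exact h a b q

lemma map_ext_right {P R : ModQuiver k S} {f g : tensor P (unit k S) ⟶ R}
    (h : ∀ a b (p : P.hom a b), f.app a b (pure b p (one b)) = g.app a b (pure b p (one b))) :
    f = g :=
  map_ext fun a b c p q => by
    refine LinearMap.congr_fun (f := f.app a b ∘ₗ pureₗ c p)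
      (g := g.app a b ∘ₗ pureₗ c p) (unit_ext fun e => ?_) q
    subst e
    exact h a c p

/-- The left unitor `I ⊗ Q ≅ Q`. -/
noncomputable def leftUnitor (Q : ModQuiver k S) : tensor (unit k S) Q ≅ Q where
  hom := ⟨fun a b => lift fun c => unitLift fun e => e ▸ LinearMap.id⟩
  inv := ⟨fun a b => pureₗ a (one a)⟩
  hom_inv_id := map_ext_left fun a b q => by simp
  inv_hom_id := by ext; simp

/-- The right unitor `P ⊗ I ≅ P`. -/
noncomputable def rightUnitor (P : ModQuiver k S) : tensor P (unit k S) ≅ P where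
  hom := ⟨fun a b => lift fun c => LinearMap.flip <| unitLift fun e => e ▸ LinearMap.id⟩
  inv := ⟨fun a b => (pureₗ b).flip (one b)⟩
  hom_inv_id := map_ext_right fun a b q => by simp
  inv_hom_id := by ext; simp

@[simp] lemma leftUnitor_hom_pure (Q : ModQuiver k S) {a b : S} (q : Q.hom a b) :
    (leftUnitor Q).hom.app a b (pure a (one a) q) = q := by
  simp [leftUnitor]

@[simp] lemma leftUnitor_inv_app (Q : ModQuiver k S) {a b : S} (q : Q.hom a b) :
    (leftUnitor Q).inv.app a b q = pure a (one a) q := by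
  simp [leftUnitor]

@[simp] lemma rightUnitor_hom_pure (P : ModQuiver k S) {a b : S} (p : P.hom a b) :
    (rightUnitor P).hom.app a b (pure b p (one b)) = p := by
  simp [rightUnitor]

@[simp] lemma rightUnitor_inv_app (P : ModQuiver k S) {a b : S} (p : P.hom a b) :
    (rightUnitor P).inv.app a b p = pure b p (one b) := by
  simp [rightUnitor]

noncomputable instance : MonoidalCategoryStruct (ModQuiver k S) where
  tensorObj := tensor
  tensorUnit := unit k S
  tensorHom := map
  whiskerLeft P _ _ g := map (𝟙 P) g
  whiskerRight f Q := map f (𝟙 Q)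
  associator := assoc
  leftUnitor := leftUnitor
  rightUnitor := rightUnitor

noncomputable instance : MonoidalCategory (ModQuiver k S) where
  tensorHom_def {P P' Q Q'} f g :=
    show map f g = map f (𝟙 Q) ≫ map (𝟙 P') g from map_ext fun a b c p q => by simp
  id_tensorHom_id P Q :=
    show map (𝟙 P) (𝟙 Q) = 𝟙 (tensor P Q) from map_ext fun a b c p q => by simp
  tensorHom_comp_tensorHom f₁ f₂ g₁ g₂ :=
    show map f₁ f₂ ≫ map g₁ g₂ = map (f₁ ≫ g₁) (f₂ ≫ g₂) from
      map_ext fun a b c p q => by simp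
  whiskerLeft_id P Q :=
    show map (𝟙 P) (𝟙 Q) = 𝟙 (tensor P Q) from map_ext fun a b c p q => by simp
  id_whiskerRight P Q :=
    show map (𝟙 P) (𝟙 Q) = 𝟙 (tensor P Q) from map_ext fun a b c p q => by simp
  associator_naturality {P Q R P' Q' R'} f g h :=
    show map (map f g) h ≫ (assoc P' Q' R').hom = (assoc P Q R).hom ≫ map f (map g h) from
      map_ext₃ fun a b c d p q r => by simp
  leftUnitor_naturality {P Q} f :=
    show map (𝟙 (unit k S)) f ≫ (leftUnitor Q).hom = (leftUnitor P).hom ≫ f from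
      map_ext_left fun a b q => by simp
  rightUnitor_naturality {P Q} f :=
    show map f (𝟙 (unit k S)) ≫ (rightUnitor Q).hom = (rightUnitor P).hom ≫ f from
      map_ext_right fun a b q => by simp
  pentagon P Q R T :=
    show map (assoc P Q R).hom (𝟙 T) ≫ (assoc P (tensor Q R) T).hom ≫
        map (𝟙 P) (assoc Q R T).hom =
        (assoc (tensor P Q) R T).hom ≫ (assoc P Q (tensor R T)).hom from
      map_ext₄ fun a b c d e p q r t => by simp
  triangle P Q :=
    show (assoc P (unit k S) Q).hom ≫ map (𝟙 P) (leftUnitor Q).hom =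
        map (rightUnitor P).hom (𝟙 Q) from
      map_ext₃ fun a b c d p i q => by
        refine LinearMap.congr_fun
          (f := Hom.app ((assoc P (unit k S) Q).hom ≫ map (𝟙 P) (leftUnitor Q).hom) a b ∘ₗ
            (pureₗ d).flip q ∘ₗ pureₗ c p)
          (g := Hom.app (map (rightUnitor P).hom (𝟙 Q)) a b ∘ₗ
            (pureₗ d).flip q ∘ₗ pureₗ c p)
          (unit_ext fun e => ?_) i
        subst e
        simp

/-! The monoidal structure in terms of pure tensors. -/

/-- The pure tensor `p ⊗ q` in the summand of `c` of `(P ⊗ Q)(a, b)`, as a bilinear map. -/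
noncomputable def tmul (P Q : ModQuiver k S) {a b : S} (c : S) :
    P.hom a c →ₗ[k] Q.hom c b →ₗ[k] (P ⊗ Q).hom a b := pureₗ c

/-- The generator of `I(a, a)`. -/
noncomputable def unitElt (k : Type u) [CommRing k] {S : Type u} (a : S) :
    (𝟙_ (ModQuiver k S)).hom a a := one a

@[simp] lemma tensorHom_tmul {P P' Q Q' : ModQuiver k S} (f : P ⟶ P') (g : Q ⟶ Q') {a b : S}
    (c : S) (p : P.hom a c) (q : Q.hom c b) :
    Hom.app (f ⊗ₘ g) a b (tmul P Q c p q) = tmul P' Q' c (f.app a c p) (g.app c b q) :=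
  map_pure f g c p q
@[simp] lemma whiskerLeft_tmul (P : ModQuiver k S) {Q Q' : ModQuiver k S} (g : Q ⟶ Q') {a b : S}
    (c : S) (p : P.hom a c) (q : Q.hom c b) :
    Hom.app (P ◁ g) a b (tmul P Q c p q) = tmul P Q' c p (g.app c b q) :=
  map_pure (𝟙 P) g c p q
@[simp] lemma whiskerRight_tmul {P P' : ModQuiver k S} (f : P ⟶ P') (Q : ModQuiver k S) {a b : S}
    (c : S) (p : P.hom a c) (q : Q.hom c b) :
    Hom.app (f ▷ Q) a b (tmul P Q c p q) = tmul P' Q c (f.app a c p) q :=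
  map_pure f (𝟙 Q) c p q
@[simp] lemma associator_hom_tmul (P Q R : ModQuiver k S) {a b : S} (c d : S) (p : P.hom a c)
    (q : Q.hom c d) (r : R.hom d b) :
    Hom.app (α_ P Q R).hom a b (tmul (P ⊗ Q) R d (tmul P Q c p q) r) =
      tmul P (Q ⊗ R) c p (tmul Q R d q r) :=
  assoc_hom_pure P Q R c d p q r
@[simp] lemma associator_inv_tmul (P Q R : ModQuiver k S) {a b : S} (c d : S) (p : P.hom a c)
    (q : Q.hom c d) (r : R.hom d b) :
    Hom.app (α_ P Q R).inv a b (tmul P (Q ⊗ R) c p (tmul Q R d q r)) =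
      tmul (P ⊗ Q) R d (tmul P Q c p q) r :=
  assoc_inv_pure P Q R c d p q r
@[simp] lemma leftUnitor_hom_tmul (Q : ModQuiver k S) {a b : S} (q : Q.hom a b) :
    Hom.app (λ_ Q).hom a b (tmul (𝟙_ _) Q a (unitElt k a) q) = q :=
  leftUnitor_hom_pure Q q
@[simp] lemma rightUnitor_hom_tmul (P : ModQuiver k S) {a b : S} (p : P.hom a b) :
    Hom.app (ρ_ P).hom a b (tmul P (𝟙_ _) b p (unitElt k b)) = p :=
  rightUnitor_hom_pure P p
@[simp] lemma leftUnitor_inv_apply (Q : ModQuiver k S) {a b : S} (q : Q.hom a b) :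
    Hom.app (λ_ Q).inv a b q = tmul (𝟙_ _) Q a (unitElt k a) q :=
  leftUnitor_inv_app Q q
@[simp] lemma rightUnitor_inv_apply (P : ModQuiver k S) {a b : S} (p : P.hom a b) :
    Hom.app (ρ_ P).inv a b p = tmul P (𝟙_ _) b p (unitElt k b) :=
  rightUnitor_inv_app P p

/-- Linear maps out of `(P ⊗ Q)(a, b)`, from families of bilinear maps. -/
noncomputable def tensorLift {P Q : ModQuiver k S} {a b : S} {M : Type u} [AddCommGroup M]
    [Module k M] (φ : ∀ c, P.hom a c →ₗ[k] Q.hom c b →ₗ[k] M) : (P ⊗ Q).hom a b →ₗ[k] M :=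
  lift φ

@[simp]
lemma tensorLift_tmul {P Q : ModQuiver k S} {a b : S} {M : Type u} [AddCommGroup M] [Module k M]
    (φ : ∀ c, P.hom a c →ₗ[k] Q.hom c b →ₗ[k] M) (c : S) (p : P.hom a c) (q : Q.hom c b) :
    tensorLift φ (tmul P Q c p q) = φ c p q :=
  lift_pure φ c p q

/-- Linear maps out of `I(a, b)`. -/
noncomputable def unitElim {a b : S} {M : Type u} [AddCommGroup M] [Module k M]
    (φ : a = b → M) : (𝟙_ (ModQuiver k S)).hom a b →ₗ[k] M := unitLift φ

@[simp] lemma unitElim_unitElt {a : S} {M : Type u} [AddCommGroup M] [Module k M]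
    (φ : a = a → M) : unitElim φ (unitElt k a) = φ rfl := unitLift_one φ

lemma tensor_linearMap_ext {P Q : ModQuiver k S} {a b : S} {M : Type u} [AddCommGroup M]
    [Module k M] {f g : (P ⊗ Q).hom a b →ₗ[k] M}
    (h : ∀ c (p : P.hom a c) (q : Q.hom c b), f (tmul P Q c p q) = g (tmul P Q c p q)) : f = g :=
  tensor_ext h

lemma unit_linearMap_ext {a b : S} {M : Type u} [AddCommGroup M] [Module k M]
    {f g : (𝟙_ (ModQuiver k S)).hom a b →ₗ[k] M}
    (h : ∀ e : a = b, f (e ▸ unitElt k a) = g (e ▸ unitElt k a)) : f = g :=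
  unit_ext h

end ModQuiver

namespace FInt.Hom

/-- The restriction `[t] → [y]` of `f : [m] → [n]` to `[0, t]`, where `y = f t`. -/
def left {m n : ℕ} (f : Hom m n) (t : ℕ) {y : ℕ} (hy : f.app t = y) : Hom t y :=
  mk' f.app f.app_zero hy (fun _ _ h _ => f.app_mono h)

/-- The restriction `[m'] → [n']` of `f : [m] → [n]` to `[t, m]`, where `m = t + m'`, `y = f t` and
`n = y + n'`. -/
def right {m n : ℕ} (f : Hom m n) (t : ℕ) {m' y n' : ℕ} (hy : f.app t = y) (hm : m = t + m')
    (hn : n = y + n') : Hom m' n' :=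
  mk' (fun i => f.app (t + i) - y) (by simp [hy]) (by rw [f.app_of_le (by omega)]; omega)
    (fun _ _ h _ => Nat.sub_le_sub_right (f.app_mono (by omega)) _)

lemma left_app {m n : ℕ} (f : Hom m n) (t : ℕ) {y : ℕ} (hy : f.app t = y) {i : ℕ} (hi : i ≤ t) :
    (f.left t hy).app i = f.app i := by
  simp only [left, mk'_app, min_eq_left hi]

lemma right_app {m n : ℕ} (f : Hom m n) (t : ℕ) {m' y n' : ℕ} (hy : f.app t = y)
    (hm : m = t + m') (hn : n = y + n') {i : ℕ} (hi : i ≤ m') :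
    (f.right t hy hm hn).app i = f.app (t + i) - y := by
  simp only [right, mk'_app, min_eq_left hi]

end FInt.Hom

/-- The joints of the necklace with the given list of beads: the set
`{0, n₁, n₁ + n₂, ..., n₁ + ... + nₖ}` for the list `[n₁, ..., nₖ]`. -/
def joints : List ℕ → Set ℕ
  | [] => {0}
  | n :: l => insert 0 ((fun i => n + i) '' joints l)

/-- A necklace `Δ^{n₁} ∨ ... ∨ Δ^{nₖ}`, given by the list of the dimensions `nᵢ > 0` of its beads.
It corresponds to the pair `(T, p)` with `p = n₁ + ... + nₖ`, and `T ⊆ [p]` the set of joints. -/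
structure Nec : Type where
  beads : List ℕ
  pos : ∀ n ∈ beads, 0 < n

namespace Nec

/-- A map of necklaces `(T, p) → (U, q)`: a map `f : [p] → [q]` of intervals with `U ⊆ f(T)`. -/
@[ext]
structure Hom (T U : Nec) : Type where
  map : FInt.Hom T.beads.sum U.beads.sum
  joints_subset : joints U.beads ⊆ map.app '' joints T.beads

end Nec

lemma zero_mem_joints (l : List ℕ) : 0 ∈ joints l := by
  cases l <;> simp [joints]

lemma joints_le_sum (l : List ℕ) {i : ℕ} (hi : i ∈ joints l) : i ≤ l.sum := by
  induction l generalizing i with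
  | nil => simp_all [joints]
  | cons n l ih =>
    simp only [joints, Set.mem_insert_iff, Set.mem_image] at hi
    rw [List.sum_cons]
    rcases hi with rfl | ⟨j, hj, rfl⟩
    · omega
    · have := ih hj; omega

namespace Nec

instance : Category Nec where
  Hom := Hom
  id T := ⟨FInt.Hom.id _, fun i hi => ⟨i, hi, by
    rw [FInt.Hom.id_app, min_eq_left (joints_le_sum _ hi)]⟩⟩
  comp f g := ⟨f.map.comp g.map, fun i hi => by
    obtain ⟨j, hj, rfl⟩ := g.joints_subset hi
    obtain ⟨l, hl, rfl⟩ := f.joints_subset hj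
    exact ⟨l, hl, f.map.comp_app g.map l⟩⟩
  id_comp _ := rfl
  comp_id _ := rfl
  assoc _ _ _ := rfl

end Nec

/-- Add a bead of dimension `b` at the front if `b > 0`. -/
@[reducible] def consBead : ℕ → List ℕ → List ℕ
  | 0, U => U
  | b + 1, U => (b + 1) :: U

/-- Remove from the first bead its initial part of length `y`. -/
@[reducible] def cutBead : ℕ → List ℕ → List ℕ
  | _, [] => []
  | y, u :: U => consBead (u - y) U

lemma consBead_sum (b : ℕ) (U : List ℕ) : (consBead b U).sum = b + U.sum := by
  cases b <;> simp [consBead]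

lemma consBead_pos (b : ℕ) {U : List ℕ} (hU : ∀ n ∈ U, 0 < n) : ∀ n ∈ consBead b U, 0 < n := by
  cases b with
  | zero => exact hU
  | succ b => simpa [consBead] using hU

lemma mem_joints_consBead {b : ℕ} {U : List ℕ} {i : ℕ} :
    i ∈ joints (consBead b U) ↔ i = 0 ∨ ∃ j ∈ joints U, i = b + j := by
  cases b with
  | zero =>
    simp only [consBead, zero_add, exists_eq_right']
    refine ⟨Or.inr, ?_⟩
    rintro (rfl | h)
    · exact zero_mem_joints U
    · exact h
  | succ b =>
    simp only [consBead, joints, Set.mem_insert_iff, Set.mem_image]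
    simp only [eq_comm]

lemma cutBead_sum {y : ℕ} {U : List ℕ} (h : y ≤ U.headD 0) : U.sum = y + (cutBead y U).sum := by
  cases U with
  | nil => simp_all [cutBead]
  | cons u U =>
    simp only [List.headD_cons] at h
    simp only [cutBead, consBead_sum, List.sum_cons]; omega

lemma cutBead_pos (y : ℕ) {U : List ℕ} (hU : ∀ n ∈ U, 0 < n) : ∀ n ∈ cutBead y U, 0 < n := by
  cases U with
  | nil => exact hU
  | cons u U => exact consBead_pos _ fun n hn => hU n (List.mem_cons_of_mem _ hn)

lemma add_mem_joints {y : ℕ} {U : List ℕ} (h : y ≤ U.headD 0) {i : ℕ}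
    (hi : i ∈ joints (cutBead y U)) : i = 0 ∨ y + i ∈ joints U := by
  cases U with
  | nil => simp_all [cutBead, joints]
  | cons u U =>
    simp only [List.headD_cons] at h
    rw [cutBead, mem_joints_consBead] at hi
    refine hi.imp_right ?_
    rintro ⟨j, hj, rfl⟩
    exact Or.inr ⟨j, hj, by dsimp only; omega⟩

lemma app_le_headD {t : ℕ} {T U : List ℕ} (hU : ∀ n ∈ U, 0 < n)
    (f : FInt.Hom (t :: T).sum U.sum) (hf : joints U ⊆ f.app '' joints (t :: T)) :
    f.app t ≤ U.headD 0 := by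
  cases U with
  | nil => exact f.app_le t
  | cons u U =>
    by_contra! hlt
    simp only [List.headD_cons] at hlt
    have hu := hU u (by simp)
    obtain ⟨s, hs, hsu⟩ := hf (show u ∈ joints (u :: U) from Or.inr ⟨0, zero_mem_joints U, rfl⟩)
    rcases hs with rfl | ⟨s, -, rfl⟩
    · rw [f.app_zero] at hsu; omega
    · have := f.app_mono (show t ≤ t + s by omega)
      dsimp only at hsu
      omega

lemma joints_right {t : ℕ} {T U : List ℕ} (hU : ∀ n ∈ U, 0 < n)
    (f : FInt.Hom (t :: T).sum U.sum) (hf : joints U ⊆ f.app '' joints (t :: T)) :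
    joints (cutBead (f.app t) U) ⊆
      (f.right t rfl List.sum_cons (cutBead_sum (app_le_headD hU f hf))).app '' joints T := by
  intro i hi
  rcases add_mem_joints (app_le_headD hU f hf) hi with rfl | h
  · exact ⟨0, zero_mem_joints T, FInt.Hom.app_zero _⟩
  · obtain ⟨s, hs, hsi⟩ := hf h
    rcases hs with rfl | ⟨s, hs, rfl⟩
    · rw [f.app_zero] at hsi
      obtain rfl : i = 0 := by omega
      exact ⟨0, zero_mem_joints T, FInt.Hom.app_zero _⟩
    · refine ⟨s, hs, ?_⟩
      rw [FInt.Hom.right_app _ _ _ _ _ (joints_le_sum _ hs)]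
      dsimp only at hsi
      omega

lemma false_of_nil_cons {u : ℕ} {U : List ℕ} (hU : ∀ n ∈ u :: U, 0 < n)
    (f : FInt.Hom ([] : List ℕ).sum (u :: U).sum) : False := by
  have h1 := f.app_zero
  have h2 := f.app_of_le (i := 0) le_rfl
  have h3 := hU u (by simp)
  have h4 : (u :: U).sum = u + U.sum := List.sum_cons
  omega

section Necklicial

open Functor.OplaxMonoidal

universe v w

variable {C : Type w} [Category.{v} C] [MonoidalCategory C] (F : FIntᵒᵖ ⥤ C)

/-- The object `X_n`. -/
abbrev level (n : ℕ) : C := F.obj (op ⟨n⟩)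

/-- The morphism `X_n → X_m` induced by `[m] → [n]`. -/
abbrev levelMap {m n : ℕ} (f : FInt.Hom m n) : level F n ⟶ level F m :=
  F.map (Quiver.Hom.op (X := (⟨m⟩ : FInt)) (Y := ⟨n⟩) f)

/-- The object `X_{n₁} ⊗ ... ⊗ X_{nₖ}` for a list `[n₁, ..., nₖ]`. -/
@[reducible] def beadObj : List ℕ → C
  | [] => 𝟙_ C
  | n :: l => level F n ⊗ beadObj l

/-- The identification for equal lists. -/
def beadCast {U V : List ℕ} (h : U = V) : beadObj F U ⟶ beadObj F V := eqToHom (by rw [h])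

@[simp] lemma beadCast_rfl {U : List ℕ} (h : U = U) : beadCast F h = 𝟙 _ := rfl

@[simp] lemma beadCast_comp {U V W : List ℕ} (h : U = V) (h' : V = W) :
    beadCast F h ≫ beadCast F h' = beadCast F (h.trans h') := by
  subst h h'; simp

variable [F.OplaxMonoidal]

/-- The comultiplication `X_u → X_y ⊗ X_b` for `u = y + b`. -/
def comul {u y b : ℕ} (h : u = y + b) : level F u ⟶ level F y ⊗ level F b :=
  levelMap F (FInt.Hom.cast h.symm) ≫ δ F (op ⟨y⟩) (op ⟨b⟩)

/-- The counit `X_0 → I`. -/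
def counit : level F 0 ⟶ 𝟙_ C := η F

/-- Adding a bead `X_b` at the front, using the counit if `b = 0`. -/
def prependBead : ∀ (b : ℕ) (U : List ℕ), level F b ⊗ beadObj F U ⟶ beadObj F (consBead b U)
  | 0, U => counit F ▷ beadObj F U ≫ (λ_ (beadObj F U)).hom
  | b + 1, U => 𝟙 (level F (b + 1) ⊗ beadObj F U)

variable [IsIso (η F)]

instance : IsIso (counit F) := inferInstanceAs (IsIso (η F))

/-- The comultiplication which cuts the first bead `X_u` of a necklace into `X_y ⊗ X_{u - y}`. -/
noncomputable def splitBead : ∀ (y : ℕ) (U : List ℕ) (_ : y ≤ U.headD 0),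
    beadObj F U ⟶ level F y ⊗ beadObj F (cutBead y U)
  | _, [], h => (λ_ (𝟙_ C)).inv ≫ (inv (counit F) ≫ levelMap F (FInt.Hom.cast (Nat.le_zero.1 h))) ▷ 𝟙_ C
  | y, u :: U, h => comul F (show u = y + (u - y) from (Nat.add_sub_of_le h).symm) ▷ beadObj F U ≫
      (α_ _ _ _).hom ≫ level F y ◁ prependBead F (u - y) U

/-- The morphism `X_U → X_T` induced by a map of necklaces `f : T → U`: it is built bead by bead
along `T`. For the first bead `[0, t]` of `T`, no joint of `U` lies strictly between `0` and
`f t`, and we comultiply `X_U → X_{f t} ⊗ X_{U'}` with `U'` the part of `U` from `f t` on, we apply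
`X_{f t} → X_t`, and continue with the restriction `T' → U'` of `f` to the rest of `T`. -/
noncomputable def beadMap : ∀ (T U : List ℕ) (_ : ∀ n ∈ U, 0 < n) (f : FInt.Hom T.sum U.sum)
    (_ : joints U ⊆ f.app '' joints T), beadObj F U ⟶ beadObj F T
  | [], [], _, _, _ => 𝟙 _
  | [], _ :: _, hU, f, _ => (false_of_nil_cons hU f).elim
  | t :: T, U, hU, f, hf =>
      splitBead F (f.app t) U (app_le_headD hU f hf) ≫
        (levelMap F (f.left t rfl) ⊗ₘ
          beadMap T (cutBead (f.app t) U) (cutBead_pos _ hU)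
            (f.right t rfl List.sum_cons (cutBead_sum (app_le_headD hU f hf)))
            (joints_right hU f hf))

end Necklicial

lemma sub_mem_joints {y : ℕ} {U : List ℕ} (h : y ≤ U.headD 0) {u : ℕ} (hu : u ∈ joints U)
    (hyu : y ≤ u) : u - y ∈ joints (cutBead y U) := by
  cases U with
  | nil => simp_all [joints]
  | cons v U =>
    simp only [List.headD_cons] at h
    rw [cutBead, mem_joints_consBead]
    rcases hu with rfl | ⟨j, hj, rfl⟩
    · exact Or.inl (by omega)
    · exact Or.inr ⟨j, hj, by dsimp only; omega⟩

lemma eq_zero_of_mem_joints {U : List ℕ} {u : ℕ} (hu : u ∈ joints U) (h : u < U.headD 0) :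
    u = 0 := by
  cases U with
  | nil => simp at h
  | cons v U =>
    simp only [List.headD_cons] at h
    rcases hu with rfl | ⟨j, hj, rfl⟩
    · rfl
    · dsimp only at h; omega

lemma cutBead_zero {U : List ℕ} (hU : ∀ n ∈ U, 0 < n) : cutBead 0 U = U := by
  cases U with
  | nil => rfl
  | cons u U =>
    have := hU u (by simp)
    obtain ⟨b, rfl⟩ : ∃ b, u = b + 1 := ⟨u - 1, by omega⟩
    rfl

lemma cutBead_cutBead {z d : ℕ} {V : List ℕ} (hV : ∀ n ∈ V, 0 < n) (h : z + d ≤ V.headD 0) :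
    cutBead d (cutBead z V) = cutBead (z + d) V ∧ d ≤ (cutBead z V).headD 0 := by
  cases V with
  | nil => simp at h ⊢; omega
  | cons v V =>
    obtain ⟨c, rfl⟩ : ∃ c, v = z + c := ⟨v - z, by simp at h; omega⟩
    simp only [cutBead, Nat.add_sub_cancel_left]
    cases c with
    | zero =>
      obtain rfl : d = 0 := by simpa using h
      refine ⟨?_, Nat.zero_le _⟩
      change cutBead 0 V = consBead (z + 0 - (z + 0)) V
      rw [cutBead_zero fun n hn => hV n (List.mem_cons_of_mem _ hn), Nat.sub_self]
    | succ c =>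
      simp at h
      refine ⟨?_, h⟩
      change consBead (c + 1 - d) V = consBead (z + (c + 1) - (z + d)) V
      congr 1
      omega

lemma joints_cut {U V U' V' : List ℕ} {y z : ℕ} (h : FInt.Hom U.sum V.sum)
    (hh : joints V ⊆ h.app '' joints U) (hy : y ≤ U.headD 0) (hz : z ≤ V.headD 0)
    (hyz : h.app y = z) (eU : cutBead y U = U') (eV : cutBead z V = V')
    (r : FInt.Hom U'.sum V'.sum)
    (hr : ∀ i, i ≤ U'.sum → z + r.app i = h.app (y + i)) :
    joints V' ⊆ r.app '' joints U' := by
  subst eU eV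
  intro i hi
  rcases add_mem_joints hz hi with rfl | hi'
  · exact ⟨0, zero_mem_joints _, r.app_zero⟩
  · obtain ⟨u, hu, hui⟩ := hh hi'
    by_cases hyu : y ≤ u
    · have h1 := sub_mem_joints hy hu hyu
      refine ⟨_, h1, ?_⟩
      have h2 := hr _ (joints_le_sum _ h1)
      rw [show y + (u - y) = u by omega] at h2
      omega
    · obtain rfl := eq_zero_of_mem_joints hu (by omega)
      rw [h.app_zero] at hui
      obtain rfl : i = 0 := by omega
      exact ⟨0, zero_mem_joints _, r.app_zero⟩

section Functoriality

open Functor.OplaxMonoidal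

universe v w

lemma nil_coassoc {C : Type w} [Category.{v} C] [MonoidalCategory C] {X : C} (e : X ⟶ 𝟙_ C)
    [IsIso e] (c : X ⟶ X ⊗ X) (h : c ≫ e ▷ X ≫ (λ_ X).hom = 𝟙 _) :
    ((λ_ (𝟙_ C)).inv ≫ inv e ▷ 𝟙_ C) ≫ c ▷ 𝟙_ C ≫ (α_ X X (𝟙_ C)).hom =
      ((λ_ (𝟙_ C)).inv ≫ inv e ▷ 𝟙_ C) ≫ X ◁ ((λ_ (𝟙_ C)).inv ≫ inv e ▷ 𝟙_ C) := by
  have h' : c = (λ_ X).inv ≫ inv e ▷ X := by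
    rw [← cancel_mono (e ▷ X ≫ (λ_ X).hom), h]; simp
  subst h'
  rw [Category.assoc, Category.assoc]
  congr 1
  rw [← whisker_exchange]
  monoidal

variable {C : Type w} [Category.{v} C] (F : FIntᵒᵖ ⥤ C)

lemma levelMap_comp {l m n : ℕ} (f : FInt.Hom l m) (g : FInt.Hom m n) :
    levelMap F g ≫ levelMap F f = levelMap F (f.comp g) := by
  rw [levelMap, levelMap, ← F.map_comp]; rfl

lemma levelMap_id {n : ℕ} (f : FInt.Hom n n) (h : ∀ i, i ≤ n → f.app i = i) :
    levelMap F f = 𝟙 _ := by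
  obtain rfl : f = FInt.Hom.id n := FInt.Hom.ext_app fun i hi => by
    rw [h i hi, FInt.Hom.id_app, min_eq_left hi]
  exact F.map_id _

variable [MonoidalCategory C] [F.OplaxMonoidal]

lemma comul_natural {u u' y b y' b' : ℕ} (f : FInt.Hom u u') (h : u = y + b) (h' : u' = y' + b')
    (l : FInt.Hom y y') (r : FInt.Hom b b') (hl : ∀ i, i ≤ y → l.app i = f.app i)
    (hr : ∀ i, i ≤ b → y' + r.app i = f.app (y + i)) :
    levelMap F f ≫ comul F h = comul F h' ≫ (levelMap F l ⊗ₘ levelMap F r) := by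
  simp only [comul, Category.assoc, levelMap, δ_natural]
  rw [← Functor.map_comp_assoc, ← Functor.map_comp_assoc]
  congr 2
  rw [op_tensor_op, ← op_comp, ← op_comp]
  congr 1
  refine FInt.hom_ext fun i hi => ?_
  replace hi : i ≤ y + b := hi
  rw [FInt.comp_app, FInt.comp_app, FInt.tensorHom_app]
  simp only [FInt.Hom.cast_app]
  rw [min_eq_left hi]
  split_ifs with hiy
  · have := l.app_le i
    rw [← hl i hiy]; omega
  · have h1 := hr (i - y) (by omega)
    rw [show y + (i - y) = i by omega] at h1
    have h2 := f.app_le i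
    omega

lemma levelMap_cast {n : ℕ} (h : n = n) : levelMap F (FInt.Hom.cast h) = 𝟙 _ :=
  levelMap_id F _ fun i hi => by rw [FInt.Hom.cast_app, min_eq_left hi]

lemma comul_eq (y b : ℕ) (h : y + b = y + b) : comul F h = δ F (op ⟨y⟩) (op ⟨b⟩) := by
  rw [comul, levelMap_cast, Category.id_comp]

lemma comul_assoc {u v w a b c : ℕ} (h1 : u = v + c) (h2 : v = a + b) (h3 : u = a + w)
    (h4 : w = b + c) :
    comul F h1 ≫ comul F h2 ▷ level F c ≫ (α_ _ _ _).hom =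
      comul F h3 ≫ level F a ◁ comul F h4 := by
  subst h2 h4 h1
  have := oplax_associativity F (op ⟨a⟩) (op ⟨b⟩) (op ⟨c⟩)
  rw [comul_eq, comul_eq, comul_eq, comul]
  rw [Category.assoc]
  exact this

lemma comul_counit_left {b : ℕ} (h : b = 0 + b) :
    comul F h ≫ counit F ▷ level F b ≫ (λ_ (level F b)).hom = 𝟙 _ := by
  have := left_unitality_hom F (op ⟨b⟩)
  rw [comul, Category.assoc]
  refine (congrArg (levelMap F (FInt.Hom.cast h.symm) ≫ ·) this).trans ?_
  refine (levelMap_comp F (FInt.Hom.cast h) (FInt.Hom.cast h.symm)).trans ?_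
  exact levelMap_id F _ fun i hi => by
    rw [FInt.Hom.comp_app, FInt.Hom.cast_app, FInt.Hom.cast_app]; omega

lemma comul_counit_right {b : ℕ} (h : b = b + 0) :
    comul F h ≫ level F b ◁ counit F ≫ (ρ_ (level F b)).hom = 𝟙 _ := by
  have := right_unitality_hom F (op ⟨b⟩)
  rw [comul, Category.assoc]
  refine (congrArg (levelMap F (FInt.Hom.cast h.symm) ≫ ·) this).trans ?_
  refine (levelMap_comp F (FInt.Hom.cast h) (FInt.Hom.cast h.symm)).trans ?_
  exact levelMap_id F _ fun i hi => by
    rw [FInt.Hom.comp_app, FInt.Hom.cast_app, FInt.Hom.cast_app]; omega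

/-- `comul` followed by `prependBead`. -/
def cutFirst {u y b : ℕ} (h : u = y + b) (U : List ℕ) :
    level F u ⊗ beadObj F U ⟶ level F y ⊗ beadObj F (consBead b U) :=
  comul F h ▷ beadObj F U ≫ (α_ _ _ _).hom ≫ level F y ◁ prependBead F b U

lemma cutFirst_zero {u y : ℕ} (h : u = y + 0) (U : List ℕ) :
    cutFirst F h U = comul F h ▷ beadObj F U ≫ (α_ _ _ _).hom ≫
      level F y ◁ (counit F ▷ beadObj F U ≫ (λ_ (beadObj F U)).hom) := rfl

lemma cutFirst_succ {u y b : ℕ} (h : u = y + (b + 1)) (U : List ℕ) :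
    cutFirst F h U = comul F h ▷ beadObj F U ≫ (α_ _ _ _).hom :=
  (congrArg (comul F h ▷ beadObj F U ≫ (α_ _ _ _).hom ≫ ·)
    (MonoidalCategory.whiskerLeft_id (level F y) (level F (b + 1) ⊗ beadObj F U))).trans
    (congrArg (comul F h ▷ beadObj F U ≫ ·) (Category.comp_id _))

lemma cutFirst_self' {u : ℕ} (h : u = u + 0) (U : List ℕ) : cutFirst F h U = 𝟙 _ := by
  have := comul_counit_right F h
  have h2 : (ρ_ (level F u)).hom ▷ beadObj F U =
    (α_ _ _ _).hom ≫ level F u ◁ (λ_ (beadObj F U)).hom := by simp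
  calc _ = (comul F h ≫ level F u ◁ counit F ≫ (ρ_ (level F u)).hom) ▷ beadObj F U := by
        simp only [comp_whiskerRight, h2, whisker_assoc, Category.assoc, Iso.inv_hom_id_assoc]
        rw [cutFirst_zero, MonoidalCategory.whiskerLeft_comp]
    _ = _ := by rw [this, id_whiskerRight]

lemma cutFirst_self {u b : ℕ} (h : u = u + b) (hb : b = 0) (U : List ℕ) (e : consBead b U = U) :
    cutFirst F h U ≫ level F u ◁ beadCast F e = 𝟙 _ := by
  subst hb
  rw [cutFirst_self']
  change 𝟙 _ ≫ level F u ◁ 𝟙 (beadObj F U) = 𝟙 _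
  simp

variable [IsIso (η F)]

lemma splitBead_nil (y : ℕ) (h : y ≤ 0) :
    splitBead F y [] h = (λ_ (𝟙_ C)).inv ≫
      (inv (counit F) ≫ levelMap F (FInt.Hom.cast (Nat.le_zero.1 h))) ▷ 𝟙_ C := rfl

lemma splitBead_cons (y u : ℕ) (U : List ℕ) (h : y ≤ (u :: U).headD 0) :
    splitBead F y (u :: U) h =
      cutFirst F (show u = y + (u - y) from (Nat.add_sub_of_le h).symm) U := rfl

/-- `splitBead`, with a variable target. -/
noncomputable def splitTo (y : ℕ) (U W : List ℕ) (h : y ≤ U.headD 0) (e : cutBead y U = W) :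
    beadObj F U ⟶ level F y ⊗ beadObj F W :=
  splitBead F y U h ≫ level F y ◁ beadCast F e

lemma splitTo_rfl (y : ℕ) (U : List ℕ) (h : y ≤ U.headD 0) :
    splitTo F y U _ h rfl = splitBead F y U h := by
  rw [splitTo, beadCast_rfl, MonoidalCategory.whiskerLeft_id, Category.comp_id]

lemma splitTo_nil (y : ℕ) (h : y ≤ 0) :
    splitTo F y [] [] h rfl = (λ_ (𝟙_ C)).inv ≫
      (inv (counit F) ≫ levelMap F (FInt.Hom.cast (Nat.le_zero.1 h))) ▷ 𝟙_ C :=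
  splitTo_rfl F y [] h

lemma splitTo_cons {u y b : ℕ} (hu : u = y + b) (U : List ℕ) (h : y ≤ (u :: U).headD 0)
    (e : cutBead y (u :: U) = consBead b U) :
    splitTo F y (u :: U) (consBead b U) h e = cutFirst F hu U := by
  obtain rfl : b = u - y := by omega
  exact splitTo_rfl F y (u :: U) h

/-- Splitting off a bead of length zero. -/
lemma splitTo_zero (U : List ℕ) (hU : ∀ n ∈ U, 0 < n) (h : 0 ≤ U.headD 0) (e : cutBead 0 U = U) :
    splitTo F 0 U U h e = (λ_ (beadObj F U)).inv ≫ inv (counit F) ▷ _ := by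
  cases U with
  | nil =>
    refine (splitTo_nil F 0 h).trans ?_
    rw [levelMap_cast, Category.comp_id]
  | cons u U =>
    have := hU u (by simp)
    obtain ⟨b, rfl⟩ : ∃ b, u = b + 1 := ⟨u - 1, by omega⟩
    have h0 : b + 1 = 0 + (b + 1) := by omega
    have := comul_counit_left F h0
    refine (splitTo_cons F h0 U h e).trans ?_
    rw [cutFirst_succ, ← cancel_mono (counit F ▷ _ ≫ (λ_ _).hom)]
    calc _ = (comul F h0 ≫ counit F ▷ level F (b + 1) ≫ (λ_ (level F (b + 1))).hom) ▷
            beadObj F U := by simp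
      _ = _ := by rw [this, id_whiskerRight]; simp

/-- Splitting commutes with adding a bead at the front. -/
lemma prependBead_splitTo {c x d : ℕ} {V : List ℕ} (hV : ∀ n ∈ V, 0 < n) (hc : c = x + d)
    (h : x ≤ (consBead c V).headD 0) (e : cutBead x (consBead c V) = consBead d V) :
    prependBead F c V ≫ splitTo F x (consBead c V) (consBead d V) h e = cutFirst F hc V := by
  cases c with
  | zero =>
    obtain ⟨rfl, rfl⟩ : x = 0 ∧ d = 0 := by omega
    rw [cutFirst_self' F hc V]
    change (counit F ▷ beadObj F V ≫ (λ_ (beadObj F V)).hom) ≫ splitTo F 0 V V h e = 𝟙 _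
    rw [splitTo_zero F V hV]
    simp
  | succ c =>
    change 𝟙 _ ≫ splitTo F x ((c + 1) :: V) (consBead d V) h e = _
    rw [Category.id_comp, splitTo_cons]

/-- Coassociativity for the splitting of necklaces. -/
lemma splitTo_coassoc {x z b : ℕ} {V V' W : List ℕ} (hV : ∀ n ∈ V, 0 < n) (hz : z = x + b)
    (h1 : z ≤ V.headD 0) (h2 : x ≤ V.headD 0) (h3 : b ≤ V'.headD 0)
    (e1 : cutBead z V = W) (e2 : cutBead x V = V') (e3 : cutBead b V' = W) :
    splitTo F z V W h1 e1 ≫ comul F hz ▷ _ ≫ (α_ _ _ _).hom =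
      splitTo F x V V' h2 e2 ≫ level F x ◁ splitTo F b V' W h3 e3 := by
  cases V with
  | nil =>
    obtain rfl : [] = V' := e2
    obtain rfl : [] = W := e1
    obtain rfl : z = 0 := by simpa using h1
    obtain ⟨rfl, rfl⟩ : x = 0 ∧ b = 0 := by omega
    rw [splitTo_zero F [] hV]
    exact nil_coassoc (counit F) (comul F hz) (comul_counit_left F hz)
  | cons v V =>
    obtain ⟨d, rfl⟩ : ∃ d, v = z + d := ⟨v - z, by simp at h1; omega⟩
    obtain rfl : W = consBead d V := by rw [← e1, cutBead, Nat.add_sub_cancel_left]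
    obtain rfl : V' = consBead (b + d) V := by
      rw [← e2, cutBead]; congr 1; omega
    rw [splitTo_cons F rfl, splitTo_cons F (show z + d = x + (b + d) by omega)]
    have hV' : ∀ n ∈ V, 0 < n := fun n hn => hV n (List.mem_cons_of_mem _ hn)
    have h4 := prependBead_splitTo F hV' (rfl : b + d = b + d) h3 e3
    have h5 := comul_assoc F (rfl : z + d = z + d) hz (show z + d = x + (b + d) by omega) rfl
    have h6 : z + d = x + (b + d) := by omega
    calc _ = (comul F rfl ≫ comul F hz ▷ level F d ≫ (α_ _ _ _).hom) ▷ beadObj F V ≫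
          (α_ _ _ _).hom ≫ level F x ◁ ((α_ _ _ _).hom ≫ level F b ◁ prependBead F d V) := by
          rw [cutFirst]
          simp [whisker_exchange_assoc]
      _ = comul F h6 ▷ beadObj F V ≫ (α_ _ _ _).hom ≫ level F x ◁
            (prependBead F (b + d) V ≫ splitTo F b (consBead (b + d) V) (consBead d V) h3 e3) := by
          rw [h5, h4, cutFirst]
          simp
      _ = _ := by
          rw [cutFirst]
          simp

/-- The description of `beadMap` in terms of any choice of the restrictions of `f`. -/
lemma beadMap_cons {t y : ℕ} {T U W : List ℕ} (hU : ∀ n ∈ U, 0 < n)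
    (f : FInt.Hom (t :: T).sum U.sum) (hf : joints U ⊆ f.app '' joints (t :: T))
    (hW : ∀ n ∈ W, 0 < n) (g : FInt.Hom T.sum W.sum) (hg : joints W ⊆ g.app '' joints T)
    (hy : f.app t = y) (h : y ≤ U.headD 0) (e : cutBead y U = W) (l : FInt.Hom t y)
    (hl : ∀ i, i ≤ t → l.app i = f.app i) (hgf : ∀ i, i ≤ T.sum → y + g.app i = f.app (t + i)) :
    beadMap F (t :: T) U hU f hf =
      splitTo F y U W h e ≫ (levelMap F l ⊗ₘ beadMap F T W hW g hg) := by
  subst hy e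
  rw [splitTo_rfl, beadMap]
  obtain rfl : l = f.left t rfl := FInt.Hom.ext_app fun i hi => by
    rw [FInt.Hom.left_app _ _ _ hi, hl i hi]
  obtain rfl : g = f.right t rfl List.sum_cons (cutBead_sum h) := FInt.Hom.ext_app fun i hi => by
    rw [FInt.Hom.right_app _ _ _ _ _ hi, ← hgf i hi]; omega
  rfl

lemma beadMap_nil (T U : List ℕ) (hT : T = []) (hU : U = []) (hU' : ∀ n ∈ U, 0 < n)
    (f : FInt.Hom T.sum U.sum) (hf : joints U ⊆ f.app '' joints T) :
    beadMap F T U hU' f hf = beadCast F (hU.trans hT.symm) := by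
  subst hT hU
  rfl

lemma beadMap_id (T U : List ℕ) (e : U = T) (hU : ∀ n ∈ U, 0 < n) (f : FInt.Hom T.sum U.sum)
    (hf : joints U ⊆ f.app '' joints T) (h : ∀ i, i ≤ T.sum → f.app i = i) :
    beadMap F T U hU f hf = beadCast F e := by
  induction T generalizing U with
  | nil => exact beadMap_nil F [] U rfl e hU f hf
  | cons t T ih =>
    subst e
    have hT : ∀ n ∈ T, 0 < n := fun n hn => hU n (List.mem_cons_of_mem _ hn)
    have hid : ∀ i, i ≤ T.sum → (FInt.Hom.id T.sum).app i = i := fun i hi => by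
      rw [FInt.Hom.id_app, min_eq_left hi]
    have hidt : ∀ i, i ≤ t → (FInt.Hom.id t).app i = i := fun i hi => by
      rw [FInt.Hom.id_app, min_eq_left hi]
    have hj : joints T ⊆ (FInt.Hom.id T.sum).app '' joints T := fun i hi =>
      ⟨i, hi, hid i (joints_le_sum _ hi)⟩
    have hs : (t :: T).sum = t + T.sum := List.sum_cons
    have he : cutBead t (t :: T) = T := by simp [cutBead, consBead]
    rw [beadMap_cons F hU f hf hT (FInt.Hom.id T.sum) hj (h t (by omega)) le_rfl he
      (FInt.Hom.id t) (fun i hi => by rw [hidt i hi, h i (by omega)])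
      (fun i hi => by rw [hid i hi, h _ (by omega)]), ih T rfl hT _ hj hid, levelMap_id F _ hidt]
    have := splitTo_cons F (show t = t + 0 from rfl) T le_rfl he
    rw [cutFirst_self'] at this
    simp only [beadCast_rfl]
    rw [id_tensorHom_id]
    exact (Category.comp_id _).trans this

/-- The effect of adding a bead on the source of `beadMap`. -/
lemma beadMap_consBead {b d : ℕ} {U V V' : List ℕ} (hV : ∀ n ∈ V, 0 < n)
    (r : FInt.Hom (consBead b U).sum V.sum) (hr : joints V ⊆ r.app '' joints (consBead b U))
    (hV' : ∀ n ∈ V', 0 < n) (g : FInt.Hom U.sum V'.sum) (hg : joints V' ⊆ g.app '' joints U)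
    (hd : r.app b = d) (hdV : d ≤ V.headD 0) (e : cutBead d V = V') (l : FInt.Hom b d)
    (hl : ∀ i, i ≤ b → l.app i = r.app i) (hgr : ∀ i, i ≤ U.sum → d + g.app i = r.app (b + i)) :
    splitTo F d V V' hdV e ≫ (levelMap F l ⊗ₘ beadMap F U V' hV' g hg) ≫ prependBead F b U =
      beadMap F (consBead b U) V hV r hr := by
  cases b with
  | succ b =>
    refine Eq.trans ?_ (beadMap_cons F hV r hr hV' g hg hd hdV e l hl hgr).symm
    exact congrArg (splitTo F d V V' hdV e ≫ ·) (Category.comp_id _)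
  | zero =>
    obtain rfl : d = 0 := by rw [← hd, r.app_zero]
    obtain rfl : V = V' := by rw [← e, cutBead_zero hV]
    obtain rfl : g = r := FInt.Hom.ext_app fun i hi => by
      have := hgr i hi
      rw [Nat.zero_add, Nat.zero_add] at this
      exact this
    rw [splitTo_zero F V hV, levelMap_id F l fun i hi => by have := l.app_le i; omega]
    change _ ≫ (𝟙 _ ⊗ₘ beadMap F U V hV g hg) ≫ counit F ▷ beadObj F U ≫
      (λ_ (beadObj F U)).hom = beadMap F U V hV g hg
    rw [id_tensorHom, whisker_exchange_assoc]
    simp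

/-- Naturality of the splitting of necklaces. -/
lemma beadMap_splitTo {U V U' V' : List ℕ} {y z : ℕ} (hU : ∀ n ∈ U, 0 < n) (hV : ∀ n ∈ V, 0 < n)
    (h : FInt.Hom U.sum V.sum) (hh : joints V ⊆ h.app '' joints U) (hy : y ≤ U.headD 0)
    (hz : z ≤ V.headD 0) (eU : cutBead y U = U') (eV : cutBead z V = V') (hyz : h.app y = z)
    (l : FInt.Hom y z) (hl : ∀ i, i ≤ y → l.app i = h.app i) (r : FInt.Hom U'.sum V'.sum)
    (hr : ∀ i, i ≤ U'.sum → z + r.app i = h.app (y + i)) (hV' : ∀ n ∈ V', 0 < n)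
    (hj : joints V' ⊆ r.app '' joints U') :
    beadMap F U V hV h hh ≫ splitTo F y U U' hy eU =
      splitTo F z V V' hz eV ≫ (levelMap F l ⊗ₘ beadMap F U' V' hV' r hj) := by
  cases U with
  | nil =>
    cases V with
    | cons v V => exact (false_of_nil_cons hV h).elim
    | nil =>
      obtain rfl : [] = U' := eU
      obtain rfl : [] = V' := eV
      obtain rfl : y = 0 := by simpa using hy
      obtain rfl : z = 0 := by simpa using hz
      rw [beadMap_nil F [] [] rfl rfl, beadMap_nil F [] [] rfl rfl, levelMap_id F l fun i hi => by
        have := l.app_le i; omega]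
      simp only [beadCast_rfl, id_tensorHom_id]
      exact (Category.id_comp _).trans (Category.comp_id _).symm
  | cons u U =>
    obtain ⟨b, rfl⟩ : ∃ b, u = y + b := ⟨u - y, by simp at hy; omega⟩
    obtain rfl : U' = consBead b U := by rw [← eU, cutBead, Nat.add_sub_cancel_left]
    have hu := app_le_headD hV h hh
    have hmono := h.app_mono (show y ≤ y + b by omega)
    obtain ⟨d, hd⟩ : ∃ d, h.app (y + b) = z + d := ⟨h.app (y + b) - z, by omega⟩
    have hs : ((y + b) :: U).sum = (y + b) + U.sum := List.sum_cons
    have hrb : r.app b = d := by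
      have h1 := hr b (by rw [consBead_sum]; omega)
      omega
    have hdV := app_le_headD hV h hh
    rw [hd] at hdV
    obtain ⟨eV2, hdV'⟩ := cutBead_cutBead hV hdV
    rw [eV] at eV2 hdV'
    have hsV := cutBead_sum hdV
    let g := h.right (y + b) hd hs hsV
    have hga : ∀ i, i ≤ U.sum → (z + d) + g.app i = h.app ((y + b) + i) := fun i hi => by
      rw [FInt.Hom.right_app _ _ _ _ _ hi]
      have := h.app_mono (show y + b ≤ y + b + i by omega)
      omega
    have hg : joints (cutBead (z + d) V) ⊆ g.app '' joints U :=
      joints_cut h hh (show y + b ≤ y + b from le_rfl) hdV hd (by simp [cutBead]) rfl g hga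
    let lr : FInt.Hom b d := r.left b hrb
    have hlr : ∀ i, i ≤ b → lr.app i = r.app i := fun i hi => FInt.Hom.left_app _ _ _ hi
    rw [beadMap_cons F hV h hh (cutBead_pos _ hV) g hg hd hdV rfl (h.left _ hd)
      (fun i hi => FInt.Hom.left_app _ _ _ hi) hga, splitTo_cons F rfl]
    rw [← beadMap_consBead F hV' r hj (cutBead_pos _ hV) g hg hrb hdV' eV2 lr hlr
      (fun i hi => by
        have h1 := hga i hi
        have h2 := hr (b + i) (by rw [consBead_sum]; omega)
        rw [← Nat.add_assoc y b i] at h2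
        omega)]
    have key := splitTo_coassoc F hV (rfl : z + d = z + d) hdV hz hdV' rfl eV eV2
    have nat := comul_natural F (h.left _ hd) (rfl : y + b = y + b) (rfl : z + d = z + d) l lr
      (fun i hi => by rw [FInt.Hom.left_app _ _ _ (by omega), hl i hi])
      (fun i hi => by
        rw [hlr i hi, hr i (by rw [consBead_sum]; omega), FInt.Hom.left_app _ _ _ (by omega)])
    calc _ = splitTo F (z + d) V _ hdV rfl ≫
          ((levelMap F (h.left _ hd) ≫ comul F rfl) ⊗ₘ beadMap F U _ (cutBead_pos _ hV) g hg) ≫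
          (α_ _ _ _).hom ≫ level F y ◁ prependBead F b U := by
          rw [cutFirst, Category.assoc, ← tensorHom_id, tensorHom_comp_tensorHom_assoc,
            Category.comp_id]
      _ = (splitTo F (z + d) V _ hdV rfl ≫ comul F rfl ▷ _ ≫ (α_ _ _ _).hom) ≫
          (levelMap F l ⊗ₘ levelMap F lr ⊗ₘ beadMap F U _ (cutBead_pos _ hV) g hg) ≫
          level F y ◁ prependBead F b U := by
          rw [nat, Category.assoc, Category.assoc, ← associator_naturality_assoc, ← tensorHom_id,
            tensorHom_comp_tensorHom_assoc, Category.id_comp]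
      _ = _ := by
          rw [key, Category.assoc, ← id_tensorHom, ← id_tensorHom, tensorHom_comp_tensorHom,
            tensorHom_comp_tensorHom, Category.id_comp, Category.comp_id]

lemma beadMap_comp (T U V : List ℕ) (hU : ∀ n ∈ U, 0 < n) (hV : ∀ n ∈ V, 0 < n)
    (f : FInt.Hom T.sum U.sum) (hf : joints U ⊆ f.app '' joints T)
    (h : FInt.Hom U.sum V.sum) (hh : joints V ⊆ h.app '' joints U)
    (hfh : joints V ⊆ (f.comp h).app '' joints T) :
    beadMap F U V hV h hh ≫ beadMap F T U hU f hf = beadMap F T V hV (f.comp h) hfh := by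
  induction T generalizing U V with
  | nil =>
    cases U with
    | cons u U => exact (false_of_nil_cons hU f).elim
    | nil =>
      cases V with
      | cons v V => exact (false_of_nil_cons hV h).elim
      | nil => exact Category.comp_id _
  | cons t T ih =>
    have hy := app_le_headD hU f hf
    have hz := app_le_headD hV (f.comp h) hfh
    have hs : (t :: T).sum = t + T.sum := List.sum_cons
    have hsU := cutBead_sum hy
    have hsV := cutBead_sum hz
    have hc : h.app (f.app t) = (f.comp h).app t := (f.comp_app h t).symm
    let f' := f.right t rfl hs hsU
    let h' := h.right (f.app t) hc hsU hsV
    have hf' : joints (cutBead (f.app t) U) ⊆ f'.app '' joints T := joints_right hU f hf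
    have hf'a : ∀ i, i ≤ T.sum → f.app t + f'.app i = f.app (t + i) := fun i hi => by
      rw [FInt.Hom.right_app _ _ _ _ _ hi]
      have := f.app_mono (show t ≤ t + i by omega)
      omega
    have hh'a : ∀ i, i ≤ (cutBead (f.app t) U).sum →
        (f.comp h).app t + h'.app i = h.app (f.app t + i) := fun i hi => by
      rw [FInt.Hom.right_app _ _ _ _ _ hi]
      have := h.app_mono (show f.app t ≤ f.app t + i by omega)
      omega
    have hfh' : joints (cutBead ((f.comp h).app t) V) ⊆ (f'.comp h').app '' joints T := by
      intro i hi
      obtain ⟨s, hs, rfl⟩ := joints_right hV (f.comp h) hfh hi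
      refine ⟨s, hs, ?_⟩
      have hsT := joints_le_sum _ hs
      rw [FInt.Hom.right_app _ _ _ _ _ hsT, FInt.Hom.comp_app]
      have h1 := hh'a (f'.app s) (f'.app_le s)
      rw [hf'a s hsT, ← f.comp_app] at h1
      rw [← h1, Nat.add_sub_cancel_left]
    have hh' : joints (cutBead ((f.comp h).app t) V) ⊆
        h'.app '' joints (cutBead (f.app t) U) := joints_cut h hh hy hz hc rfl rfl h' hh'a
    rw [beadMap_cons F hU f hf (cutBead_pos _ hU) f' hf' rfl hy rfl (f.left t rfl)
      (fun i hi => FInt.Hom.left_app _ _ _ hi) hf'a]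
    rw [← Category.assoc, beadMap_splitTo F hU hV h hh hy hz rfl rfl hc (h.left (f.app t) hc)
      (fun i hi => FInt.Hom.left_app _ _ _ hi) h' hh'a (cutBead_pos _ hV) hh', Category.assoc,
      tensorHom_comp_tensorHom, ih _ _ (cutBead_pos _ hU) (cutBead_pos _ hV) f' hf' h' hh' hfh',
      levelMap_comp]
    symm
    refine beadMap_cons F hV (f.comp h) hfh (cutBead_pos _ hV) (f'.comp h') hfh' rfl hz rfl _ ?_ ?_
    · intro i hi
      have := f.app_mono hi
      rw [FInt.Hom.comp_app, FInt.Hom.left_app _ _ _ hi, FInt.Hom.left_app _ _ _ this,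
        f.comp_app]
    · intro i hi
      rw [f'.comp_app, hh'a _ (f'.app_le i), hf'a i hi, f.comp_app]

/-- The functor `X_• : Necᵒᵖ ⥤ C`. -/
noncomputable def necFunctor : Necᵒᵖ ⥤ C where
  obj T := beadObj F T.unop.beads
  map {U T} f := beadMap F T.unop.beads U.unop.beads U.unop.pos f.unop.map f.unop.joints_subset
  map_id T := beadMap_id F _ _ rfl _ _ _ fun i hi => by
    exact (FInt.Hom.id_app _ i).trans (min_eq_left hi)
  map_comp {V U T} h f := (beadMap_comp F _ _ _ _ _ _ _ _ _ _).symm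

end Functoriality

section Templicial

open Functor.OplaxMonoidal

/-- A templicial `k`-module with vertex set `S`: a strongly unital, colax monoidal functor from the
opposite of the category of finite intervals to `k`-quivers with vertex set `S`. -/
structure Templicial (k : Type u) [CommRing k] (S : Type u) : Type (u + 1) where
  toFunctor : FIntᵒᵖ ⥤ ModQuiver k S
  [oplax : toFunctor.OplaxMonoidal]
  [unital : IsIso (η toFunctor)]

namespace Templicial

attribute [instance] Templicial.oplax Templicial.unital

variable {k : Type u} [CommRing k] {S : Type u}

/-- The quiver `X_n` of `n`-simplices. -/
abbrev simplices (X : Templicial k S) (n : ℕ) : ModQuiver k S := level X.toFunctor n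

/-- Monoidal natural transformations. -/
@[ext]
structure Hom (X Y : Templicial k S) : Type u where
  nat : X.toFunctor ⟶ Y.toFunctor
  counit : nat.app (𝟙_ FIntᵒᵖ) ≫ η Y.toFunctor = η X.toFunctor
  comul : ∀ m n : FIntᵒᵖ, nat.app (m ⊗ n) ≫ δ Y.toFunctor m n =
    δ X.toFunctor m n ≫ (nat.app m ⊗ₘ nat.app n)

/-- Templicial modules with fixed vertex set `S`. -/
instance : Category (Templicial k S) where
  Hom := Hom
  id X := ⟨𝟙 _, by simp, by simp⟩
  comp f g := ⟨f.nat ≫ g.nat, by simp [g.counit, f.counit], fun m n => by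
    simp [g.comul, reassoc_of% (f.comul m n)]⟩
  id_comp _ := Hom.ext (Category.id_comp _)
  comp_id _ := Hom.ext (Category.comp_id _)
  assoc _ _ _ := Hom.ext (Category.assoc _ _ _)

/-- `X` is levelwise flat if all the modules `X_n(a, b)` are flat. -/
def LevelwiseFlat (X : Templicial k S) : Prop :=
  ∀ (n : ℕ) (a b : S), Module.Flat k ((X.simplices n).hom a b)

end Templicial

/-- Evaluation of quivers at a pair of vertices. -/
def ModQuiver.eval {k : Type u} [CommRing k] {S : Type u} (a b : S) :
    ModQuiver k S ⥤ ModuleCat.{u} k where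
  obj Q := Q.hom a b
  map f := ModuleCat.ofHom (f.app a b)

/-- The necklicial module `X_•(a, b)`. -/
noncomputable def Templicial.nec {k : Type u} [CommRing k] {S : Type u} (X : Templicial k S)
    (a b : S) : Necᵒᵖ ⥤ ModuleCat.{u} k :=
  necFunctor X.toFunctor ⋙ ModQuiver.eval a b

end Templicial

/-! ### Maps over a map of vertex sets -/

namespace ModQuiver

variable {k : Type u} [CommRing k] {S S' : Type u} (φ : S → S')

/-- Morphisms of quivers over a map `φ` of vertex sets. -/
def HomOver (P : ModQuiver k S) (Q : ModQuiver k S') : Type u :=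
  ∀ a b, P.hom a b →ₗ[k] Q.hom (φ a) (φ b)

variable {φ}

/-- The tensor product of morphisms over `φ`. -/
noncomputable def HomOver.tensor {P P' : ModQuiver k S} {Q Q' : ModQuiver k S'}
    (f : HomOver φ P Q) (f' : HomOver φ P' Q') : HomOver φ (P ⊗ P') (Q ⊗ Q') := fun a b =>
  tensorLift fun c => (tmul Q Q' (φ c)).compl₁₂ (f a c) (f' c b)

@[simp] lemma HomOver.tensor_tmul {P P' : ModQuiver k S} {Q Q' : ModQuiver k S'}
    (f : HomOver φ P Q) (f' : HomOver φ P' Q') {a b : S} (c : S) (p : P.hom a c)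
    (p' : P'.hom c b) :
    f.tensor f' a b (tmul P P' c p p') = tmul Q Q' (φ c) (f a c p) (f' c b p') := by
  simp [HomOver.tensor]

variable (k φ) in
/-- The canonical morphism between the unit quivers over `φ`. -/
noncomputable def HomOver.unit : HomOver φ (𝟙_ (ModQuiver k S)) (𝟙_ (ModQuiver k S')) :=
  fun a _ => unitElim fun e => e ▸ unitElt k (φ a)

@[simp] lemma HomOver.unit_unitElt (a : S) :
    HomOver.unit k φ a a (unitElt k a) = unitElt k (φ a) := by
  simp [HomOver.unit]

/-- The compatibility of morphisms over `φ` with morphisms of quivers. -/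
def Compat {P P' : ModQuiver k S} {Q Q' : ModQuiver k S'} (f : HomOver φ P Q)
    (f' : HomOver φ P' Q') (u : P ⟶ P') (v : Q ⟶ Q') : Prop :=
  ∀ a b x, f' a b (Hom.app u a b x) = Hom.app v (φ a) (φ b) (f a b x)

namespace Compat

variable {P P' P'' : ModQuiver k S} {Q Q' Q'' : ModQuiver k S'}

lemma id (f : HomOver φ P Q) : Compat f f (𝟙 P) (𝟙 Q) := fun _ _ _ => rfl

lemma comp {f : HomOver φ P Q} {f' : HomOver φ P' Q'} {f'' : HomOver φ P'' Q''}
    {u : P ⟶ P'} {v : Q ⟶ Q'} {u' : P' ⟶ P''} {v' : Q' ⟶ Q''}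
    (h : Compat f f' u v) (h' : Compat f' f'' u' v') : Compat f f'' (u ≫ u') (v ≫ v') :=
  fun a b x => (h' a b _).trans (congrArg _ (h a b x))

lemma inv {f : HomOver φ P Q} {f' : HomOver φ P' Q'} (u : P ≅ P') (v : Q ≅ Q')
    (h : Compat f f' u.hom v.hom) : Compat f' f u.inv v.inv := fun a b x => by
  have h1 := h a b (Hom.app u.inv a b x)
  rw [← comp_app, u.inv_hom_id, id_app] at h1
  rw [h1, ← comp_app, v.hom_inv_id, id_app]

lemma tensor {P₁ P₂ : ModQuiver k S} {Q₁ Q₂ : ModQuiver k S'} {f : HomOver φ P Q}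
    {f' : HomOver φ P' Q'} {g : HomOver φ P₁ Q₁} {g' : HomOver φ P₂ Q₂} {u : P ⟶ P'}
    {v : Q ⟶ Q'} {u₁ : P₁ ⟶ P₂} {v₁ : Q₁ ⟶ Q₂} (h : Compat f f' u v) (h₁ : Compat g g' u₁ v₁) :
    Compat (f.tensor g) (f'.tensor g') (u ⊗ₘ u₁) (v ⊗ₘ v₁) := fun a b x => by
  refine LinearMap.congr_fun (f := f'.tensor g' a b ∘ₗ Hom.app (u ⊗ₘ u₁) a b)
    (g := Hom.app (v ⊗ₘ v₁) (φ a) (φ b) ∘ₗ f.tensor g a b)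
    (tensor_linearMap_ext fun c p q => ?_) x
  simp [h a c p, h₁ c b q]

lemma associator (f : HomOver φ P Q) (f' : HomOver φ P' Q') (f'' : HomOver φ P'' Q'') :
    Compat ((f.tensor f').tensor f'') (f.tensor (f'.tensor f'')) (α_ P P' P'').hom
      (α_ Q Q' Q'').hom := fun a b x => by
  refine LinearMap.congr_fun
    (f := f.tensor (f'.tensor f'') a b ∘ₗ Hom.app (α_ P P' P'').hom a b)
    (g := Hom.app (α_ Q Q' Q'').hom (φ a) (φ b) ∘ₗ (f.tensor f').tensor f'' a b)
    (tensor_linearMap_ext fun d y r => ?_) x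
  refine LinearMap.congr_fun
    (f := f.tensor (f'.tensor f'') a b ∘ₗ Hom.app (α_ P P' P'').hom a b ∘ₗ
      (tmul (P ⊗ P') P'' d).flip r)
    (g := Hom.app (α_ Q Q' Q'').hom (φ a) (φ b) ∘ₗ (f.tensor f').tensor f'' a b ∘ₗ
      (tmul (P ⊗ P') P'' d).flip r)
    (tensor_linearMap_ext fun c p q => ?_) y
  simp

lemma leftUnitor (f : HomOver φ P Q) :
    Compat ((HomOver.unit k φ).tensor f) f (λ_ P).hom (λ_ Q).hom := fun a b x => by
  refine LinearMap.congr_fun (f := f a b ∘ₗ Hom.app (λ_ P).hom a b)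
    (g := Hom.app (λ_ Q).hom (φ a) (φ b) ∘ₗ (HomOver.unit k φ).tensor f a b)
    (tensor_linearMap_ext fun c i p => ?_) x
  refine LinearMap.congr_fun (f := f a b ∘ₗ Hom.app (λ_ P).hom a b ∘ₗ (tmul _ P c).flip p)
    (g := Hom.app (λ_ Q).hom (φ a) (φ b) ∘ₗ (HomOver.unit k φ).tensor f a b ∘ₗ
      (tmul _ P c).flip p)
    (unit_linearMap_ext fun e => ?_) i
  subst e
  simp

end Compat

end ModQuiver

section

open ModQuiver

/-- Maps of templicial modules over a map `φ` of vertex sets. -/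
structure TemplicialMap {k : Type u} [CommRing k] {S S' : Type u} (φ : S → S')
    (X : Templicial k S) (Y : Templicial k S') : Type u where
  app : ∀ n : ℕ, HomOver φ (X.simplices n) (Y.simplices n)
  naturality : ∀ {m n : ℕ} (f : FInt.Hom m n),
    Compat (app n) (app m) (levelMap X.toFunctor f) (levelMap Y.toFunctor f)
  comul : ∀ m n : ℕ, Compat (app (m + n)) ((app m).tensor (app n))
    (Functor.OplaxMonoidal.δ X.toFunctor (op ⟨m⟩) (op ⟨n⟩))
    (Functor.OplaxMonoidal.δ Y.toFunctor (op ⟨m⟩) (op ⟨n⟩))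
  counit : Compat (app 0) (HomOver.unit k φ) (counit X.toFunctor) (counit Y.toFunctor)

namespace TemplicialMap

variable {k : Type u} [CommRing k] {S S' : Type u} {φ : S → S'}
  {X : Templicial k S} {Y : Templicial k S'} (f : TemplicialMap φ X Y)

/-- The induced maps `X_T → Y_T`. -/
noncomputable def bead : ∀ l : List ℕ,
    HomOver φ (beadObj X.toFunctor l) (beadObj Y.toFunctor l)
  | [] => HomOver.unit k φ
  | n :: l => (f.app n).tensor (bead l)

lemma compat_comul {x y b : ℕ} (h : x = y + b) :
    Compat (f.app x) ((f.app y).tensor (f.app b)) (_root_.comul X.toFunctor h)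
      (_root_.comul Y.toFunctor h) :=
  (f.naturality _).comp (f.comul y b)

lemma compat_counit_inv :
    Compat (HomOver.unit k φ) (f.app 0) (inv (_root_.counit X.toFunctor))
      (inv (_root_.counit Y.toFunctor)) :=
  Compat.inv (asIso (_root_.counit X.toFunctor)) (asIso (_root_.counit Y.toFunctor)) f.counit

lemma compat_whiskerLeft {P P' : ModQuiver k S} {Q Q' : ModQuiver k S'} {g : HomOver φ P Q}
    {g' : HomOver φ P' Q'} {u : P ⟶ P'} {v : Q ⟶ Q'} (h : Compat g g' u v)
    {P₁ : ModQuiver k S} {Q₁ : ModQuiver k S'} (g₁ : HomOver φ P₁ Q₁) :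
    Compat (g₁.tensor g) (g₁.tensor g') (P₁ ◁ u) (Q₁ ◁ v) := by
  rw [← id_tensorHom, ← id_tensorHom]
  exact (Compat.id g₁).tensor h

lemma compat_whiskerRight {P P' : ModQuiver k S} {Q Q' : ModQuiver k S'} {g : HomOver φ P Q}
    {g' : HomOver φ P' Q'} {u : P ⟶ P'} {v : Q ⟶ Q'} (h : Compat g g' u v)
    {P₁ : ModQuiver k S} {Q₁ : ModQuiver k S'} (g₁ : HomOver φ P₁ Q₁) :
    Compat (g.tensor g₁) (g'.tensor g₁) (u ▷ P₁) (v ▷ Q₁) := by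
  rw [← tensorHom_id, ← tensorHom_id]
  exact h.tensor (Compat.id g₁)

lemma compat_prependBead (b : ℕ) (U : List ℕ) :
    Compat ((f.app b).tensor (f.bead U)) (f.bead (consBead b U)) (prependBead X.toFunctor b U)
      (prependBead Y.toFunctor b U) := by
  cases b with
  | zero => exact (compat_whiskerRight f.counit _).comp (Compat.leftUnitor _)
  | succ b => exact Compat.id _

lemma compat_splitBead (y : ℕ) (U : List ℕ) (h : y ≤ U.headD 0) :
    Compat (f.bead U) ((f.app y).tensor (f.bead (cutBead y U))) (splitBead X.toFunctor y U h)
      (splitBead Y.toFunctor y U h) := by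
  cases U with
  | nil =>
    exact (Compat.inv _ _ (Compat.leftUnitor _)).comp
      (compat_whiskerRight (f.compat_counit_inv.comp (f.naturality _)) _)
  | cons u U =>
    exact (compat_whiskerRight (f.compat_comul _) _).comp
      ((Compat.associator _ _ _).comp (compat_whiskerLeft (f.compat_prependBead _ _) _))

lemma compat_beadMap (T U : List ℕ) (hU : ∀ n ∈ U, 0 < n) (g : FInt.Hom T.sum U.sum)
    (hg : joints U ⊆ g.app '' joints T) :
    Compat (f.bead U) (f.bead T) (beadMap X.toFunctor T U hU g hg)
      (beadMap Y.toFunctor T U hU g hg) := by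
  induction T generalizing U with
  | nil =>
    cases U with
    | nil => exact Compat.id _
    | cons u U => exact (false_of_nil_cons hU g).elim
  | cons t T ih =>
    exact (f.compat_splitBead _ _ _).comp ((f.naturality _).tensor (ih _ _ _ _))

/-- The induced morphism `X_•(a, b) → Y_•(φ a, φ b)`. -/
noncomputable def nec (a b : S) : X.nec a b ⟶ Y.nec (φ a) (φ b) where
  app T := ModuleCat.ofHom (f.bead T.unop.beads a b)
  naturality {U T} g := by
    refine ModuleCat.hom_ext (LinearMap.ext fun x => ?_)
    exact f.compat_beadMap _ _ U.unop.pos g.unop.map g.unop.joints_subset a b x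

end TemplicialMap

end

namespace FInt

/-- The inclusion of the category of finite intervals into the simplex category. -/
def toSimplex : FInt ⥤ SimplexCategory where
  obj a := SimplexCategory.mk a.len
  map f := SimplexCategory.Hom.mk (Hom.toOrderHom f)

/-- The inclusion `[m] → [m + n]` onto the first `m + 1` elements. -/
def front (a b : FInt) : toSimplex.obj a ⟶ toSimplex.obj (a ⊗ b) :=
  SimplexCategory.Hom.mk
    { toFun := fun i => ⟨i, by
        have h : (i : ℕ) < a.len + 1 := i.isLt
        change _ < a.len + b.len + 1
        omega⟩
      monotone' := fun _ _ h => h }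

/-- The inclusion `[n] → [m + n]` onto the last `n + 1` elements. -/
def back (a b : FInt) : toSimplex.obj b ⟶ toSimplex.obj (a ⊗ b) :=
  SimplexCategory.Hom.mk
    { toFun := fun i => ⟨a.len + i, by
        have h : (i : ℕ) < b.len + 1 := i.isLt
        change _ < a.len + b.len + 1
        omega⟩
      monotone' := fun _ _ h => by
        simp only [Fin.mk_le_mk]
        exact Nat.add_le_add_left h _ }

/-- The first vertex `[0] → [n]`. -/
def first (a : FInt) : SimplexCategory.mk 0 ⟶ toSimplex.obj a :=
  SimplexCategory.const _ _ 0

/-- The last vertex `[0] → [n]`. -/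
def last (a : FInt) : SimplexCategory.mk 0 ⟶ toSimplex.obj a :=
  SimplexCategory.const _ _ (Fin.last a.len)

lemma simplex_hom_ext {m : SimplexCategory} {b : FInt} {f g : m ⟶ toSimplex.obj b}
    (h : ∀ i, (f.toOrderHom i : ℕ) = g.toOrderHom i) : f = g :=
  SimplexCategory.Hom.ext _ _ (OrderHom.ext _ _ (funext fun i => Fin.ext (h i)))

lemma toSimplex_map_val {a b : FInt} (f : a ⟶ b) (i : Fin (a.len + 1)) :
    (((toSimplex.map f).toOrderHom i : Fin (b.len + 1)) : ℕ) = Hom.app f i :=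
  Hom.toOrderHom_apply f i

lemma front_val (a b : FInt) (i : Fin (a.len + 1)) :
    (((front a b).toOrderHom i : Fin ((a ⊗ b).len + 1)) : ℕ) = i := rfl

lemma back_val (a b : FInt) (i : Fin (b.len + 1)) :
    (((back a b).toOrderHom i : Fin ((a ⊗ b).len + 1)) : ℕ) = a.len + i := rfl

lemma first_map {a b : FInt} (f : a ⟶ b) : first a ≫ toSimplex.map f = first b :=
  simplex_hom_ext fun _ => (toSimplex_map_val f 0).trans (app_zero f)

lemma last_map {a b : FInt} (f : a ⟶ b) : last a ≫ toSimplex.map f = last b :=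
  simplex_hom_ext fun _ => (toSimplex_map_val f (Fin.last a.len)).trans (app_of_le f le_rfl)

lemma first_front (a b : FInt) : first a ≫ front a b = first (a ⊗ b) :=
  simplex_hom_ext fun _ => rfl

lemma last_back (a b : FInt) : last b ≫ back a b = last (a ⊗ b) :=
  simplex_hom_ext fun _ => rfl

lemma last_front (a b : FInt) : last a ≫ front a b = first b ≫ back a b :=
  simplex_hom_ext fun _ => rfl

lemma front_map {a b c d : FInt} (f : a ⟶ b) (g : c ⟶ d) :
    front a c ≫ toSimplex.map (f ⊗ₘ g) = toSimplex.map f ≫ front b d :=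
  simplex_hom_ext fun i => by
    have hi : (i : ℕ) ≤ a.len := Nat.lt_succ_iff.1 i.isLt
    refine (toSimplex_map_val (f ⊗ₘ g) ((front a c).toOrderHom i)).trans ?_
    refine (tensorHom_app f g i).trans ?_
    rw [if_pos hi]
    exact (toSimplex_map_val f i).symm

lemma back_map {a b c d : FInt} (f : a ⟶ b) (g : c ⟶ d) :
    back a c ≫ toSimplex.map (f ⊗ₘ g) = toSimplex.map g ≫ back b d :=
  simplex_hom_ext fun i => by
    refine (toSimplex_map_val (f ⊗ₘ g) ((back a c).toOrderHom i)).trans ?_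
    refine Eq.trans ?_ (congrArg (b.len + ·) (toSimplex_map_val g i).symm)
    refine (tensorHom_app f g (a.len + i)).trans ?_
    split_ifs with h
    · have h0 : (i : ℕ) = 0 := by omega
      rw [h0, app_of_le f (by omega), app_zero g]; rfl
    · rw [Nat.add_sub_cancel_left]

lemma front_assoc (a b c : FInt) :
    front a (b ⊗ c) ≫ toSimplex.map (α_ a b c).inv = front a b ≫ front (a ⊗ b) c :=
  simplex_hom_ext fun i => by
    have hi : (i : ℕ) ≤ a.len := Nat.lt_succ_iff.1 i.isLt
    refine (toSimplex_map_val (α_ a b c).inv _).trans ?_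
    rw [assoc_inv_app]
    exact min_eq_left (show (i : ℕ) ≤ _ by omega)

lemma middle_assoc (a b c : FInt) :
    front b c ≫ back a (b ⊗ c) ≫ toSimplex.map (α_ a b c).inv = back a b ≫ front (a ⊗ b) c :=
  simplex_hom_ext fun i => by
    have hi : (i : ℕ) ≤ b.len := Nat.lt_succ_iff.1 i.isLt
    refine (toSimplex_map_val (α_ a b c).inv _).trans ?_
    rw [assoc_inv_app]
    exact min_eq_left (show a.len + (i : ℕ) ≤ _ by omega)

lemma back_assoc (a b c : FInt) :
    back b c ≫ back a (b ⊗ c) ≫ toSimplex.map (α_ a b c).inv = back (a ⊗ b) c :=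
  simplex_hom_ext fun i => by
    have hi : (i : ℕ) ≤ c.len := Nat.lt_succ_iff.1 i.isLt
    refine (toSimplex_map_val (α_ a b c).inv _).trans ?_
    rw [assoc_inv_app]
    refine (min_eq_left (show a.len + (b.len + (i : ℕ)) ≤ _ by omega)).trans ?_
    exact (Nat.add_assoc _ _ _).symm

lemma back_unit (a : FInt) : back (𝟙_ FInt) a ≫ toSimplex.map (λ_ a).hom = 𝟙 _ :=
  simplex_hom_ext fun i => by
    have hi : (i : ℕ) ≤ a.len := Nat.lt_succ_iff.1 i.isLt
    refine (toSimplex_map_val (λ_ a).hom _).trans ?_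
    rw [leftUnitor_hom_app]
    refine (min_eq_left (show 0 + (i : ℕ) ≤ _ by omega)).trans ?_
    exact Nat.zero_add _

lemma front_unit (a : FInt) : front a (𝟙_ FInt) ≫ toSimplex.map (ρ_ a).hom = 𝟙 _ :=
  simplex_hom_ext fun i => by
    have hi : (i : ℕ) ≤ a.len := Nat.lt_succ_iff.1 i.isLt
    refine (toSimplex_map_val (ρ_ a).hom _).trans ?_
    rw [rightUnitor_hom_app]
    exact min_eq_left (show (i : ℕ) ≤ _ by omega)

lemma first_unit : first (𝟙_ FInt) = 𝟙 _ := simplex_hom_ext fun i => by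
  have : i = 0 := Subsingleton.elim (α := Fin 1) i 0
  subst this; rfl

lemma last_unit : last (𝟙_ FInt) = 𝟙 _ := simplex_hom_ext fun i => by
  have : i = 0 := Subsingleton.elim (α := Fin 1) i 0
  subst this; rfl

end FInt

namespace FreeTemplicial

open ModQuiver
open FInt hiding comp_app id_app

variable (k : Type u) [CommRing k] (K : SSet.{u})

/-- The set of `n`-simplices of `K` (for `a = [n]`). -/
abbrev Simp (a : FInt) : Type u := K.obj (op (toSimplex.obj a))

/-- The set of vertices of `K`. -/
abbrev Vert : Type u := K.obj (op (SimplexCategory.mk 0))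

variable {K} in
/-- The first vertex of a simplex. -/
def src {a : FInt} (x : Simp K a) : Vert K := K.map (first a).op x

variable {K} in
/-- The last vertex of a simplex. -/
def tgt {a : FInt} (x : Simp K a) : Vert K := K.map (last a).op x

/-- The quiver `F̃(K)_n`: `F̃(K)_n(s, t)` is the free module on the set of `n`-simplices of `K` with
first vertex `s` and last vertex `t`. -/
noncomputable def quiver (a : FInt) : ModQuiver k (Vert K) :=
  ⟨fun s t => ModuleCat.of k ({x : Simp K a // src x = s ∧ tgt x = t} →₀ k)⟩

variable {K}

/-- The basis element of a simplex. -/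
noncomputable def gen {a : FInt} {s t : Vert K} (x : Simp K a) (hs : src x = s) (ht : tgt x = t) :
    (quiver k K a).hom s t :=
  Finsupp.single ⟨x, hs, ht⟩ 1

variable {k} in
/-- Linear maps out of `F̃(K)_n(s, t)`. -/
noncomputable def genLift {a : FInt} {s t : Vert K} {M : Type u} [AddCommGroup M] [Module k M]
    (φ : ∀ x : Simp K a, src x = s → tgt x = t → M) : (quiver k K a).hom s t →ₗ[k] M :=
  Finsupp.lift M k {x : Simp K a // src x = s ∧ tgt x = t} fun x => φ x.1 x.2.1 x.2.2

variable {k} in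
@[simp] lemma genLift_gen {a : FInt} {s t : Vert K} {M : Type u} [AddCommGroup M] [Module k M]
    (φ : ∀ x : Simp K a, src x = s → tgt x = t → M) (x : Simp K a) (hs : src x = s)
    (ht : tgt x = t) : genLift φ (gen k x hs ht) = φ x hs ht := by
  refine (Finsupp.lift_apply _ _ _ _ _).trans ?_
  simp [gen]

variable {k} in
lemma gen_ext {a : FInt} {s t : Vert K} {M : Type u} [AddCommGroup M] [Module k M]
    {f g : (quiver k K a).hom s t →ₗ[k] M}
    (h : ∀ (x : Simp K a) (hs : src x = s) (ht : tgt x = t), f (gen k x hs ht) = g (gen k x hs ht)) :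
    f = g := by
  refine Finsupp.lhom_ext' fun ⟨x, hs, ht⟩ => LinearMap.ext_ring ?_
  exact h x hs ht

variable {k} in
lemma quiver_hom_ext {a : FInt} {Q : ModQuiver k (Vert K)} {f g : quiver k K a ⟶ Q}
    (h : ∀ s t (x : Simp K a) (hs : src x = s) (ht : tgt x = t),
      Hom.app f s t (gen k x hs ht) = Hom.app g s t (gen k x hs ht)) : f = g :=
  ModQuiver.Hom.ext (funext fun s => funext fun t => gen_ext (h s t))

lemma gen_congr {a : FInt} {s t : Vert K} {x y : Simp K a} (h : x = y) (hs : src x = s)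
    (ht : tgt x = t) : gen k x hs ht = gen k y (h ▸ hs) (h ▸ ht) := by
  subst h; rfl

/-- Faces and degeneracies (with the same endpoints). -/
def pull {a b : FInt} (f : a ⟶ b) (x : Simp K b) : Simp K a := K.map (toSimplex.map f).op x

lemma K_map_map {l m n : SimplexCategory} (f : l ⟶ m) (g : m ⟶ n) (x : K.obj (op n)) :
    K.map f.op (K.map g.op x) = K.map (f ≫ g).op x := by
  simp only [op_comp, Functor.map_comp_apply]

lemma K_map_id {l : SimplexCategory} (x : K.obj (op l)) : K.map (𝟙 l).op x = x := by
  simp only [op_id, Functor.map_id_apply]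

lemma src_pull {a b : FInt} (f : a ⟶ b) (x : Simp K b) : src (pull f x) = src x := by
  rw [src, pull, K_map_map, first_map]; rfl

lemma tgt_pull {a b : FInt} (f : a ⟶ b) (x : Simp K b) : tgt (pull f x) = tgt x := by
  rw [tgt, pull, K_map_map, last_map]; rfl

/-- The front face. -/
def frontFace {a b : FInt} (x : Simp K (a ⊗ b)) : Simp K a := K.map (front a b).op x

/-- The back face. -/
def backFace {a b : FInt} (x : Simp K (a ⊗ b)) : Simp K b := K.map (back a b).op x

lemma src_frontFace {a b : FInt} (x : Simp K (a ⊗ b)) : src (frontFace x) = src x := by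
  rw [src, frontFace, K_map_map, first_front]; rfl

lemma tgt_backFace {a b : FInt} (x : Simp K (a ⊗ b)) : tgt (backFace x) = tgt x := by
  rw [tgt, backFace, K_map_map, last_back]; rfl

lemma src_backFace {a b : FInt} (x : Simp K (a ⊗ b)) :
    src (backFace x) = tgt (frontFace x) := by
  rw [tgt, src, backFace, frontFace, K_map_map, K_map_map, last_front]

/-- The action of faces and degeneracies on `F̃(K)`. -/
noncomputable def pullHom {a b : FInt} (f : a ⟶ b) : quiver k K b ⟶ quiver k K a :=
  ⟨fun _ _ => genLift fun x hs ht =>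
    gen k (pull f x) ((src_pull _ _).trans hs) ((tgt_pull _ _).trans ht)⟩

lemma pullHom_gen {a b : FInt} (f : a ⟶ b) {s t : Vert K} (x : Simp K b)
    (hs : src x = s) (ht : tgt x = t) :
    Hom.app (pullHom k f) s t (gen k x hs ht) =
      gen k (pull f x) ((src_pull _ _).trans hs) ((tgt_pull _ _).trans ht) := by
  unfold pullHom
  rw [genLift_gen]

variable (K) in
/-- The functor underlying `F̃(K)`. -/
noncomputable def functor : FIntᵒᵖ ⥤ ModQuiver k (Vert K) where
  obj a := quiver k K a.unop
  map f := pullHom k f.unop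
  map_id a := quiver_hom_ext fun s t x hs ht => by
    rw [pullHom_gen, ModQuiver.id_app]
    exact gen_congr k (K_map_id x) _ _
  map_comp f g := quiver_hom_ext fun s t x hs ht => by
    rw [ModQuiver.comp_app, pullHom_gen, pullHom_gen, pullHom_gen]
    refine gen_congr k ?_ _ _
    exact (K_map_map (toSimplex.map g.unop) (toSimplex.map f.unop) x).symm

variable (K) in
/-- The comultiplication of `F̃(K)`: it sends a simplex `x` to the pure tensor of its front face and
its back face, in the summand of their common vertex. -/
noncomputable def comul (a b : FInt) :
    quiver k K (a ⊗ b) ⟶ quiver k K a ⊗ quiver k K b :=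
  ⟨fun _ _ => genLift fun x hs ht =>
    tmul (quiver k K a) (quiver k K b) (tgt (frontFace x))
      (gen k (frontFace x) ((src_frontFace x).trans hs) rfl)
      (gen k (backFace x) (src_backFace x) ((tgt_backFace x).trans ht))⟩

lemma comul_gen {a b : FInt} {s t c : Vert K} (x : Simp K (a ⊗ b)) (hs : src x = s)
    (ht : tgt x = t) (y : Simp K a) (z : Simp K b) (hy : frontFace x = y) (hz : backFace x = z)
    (hc : tgt y = c) :
    Hom.app (comul k K a b) s t (gen k x hs ht) =
      tmul (quiver k K a) (quiver k K b) c
        (gen k y (by rw [← hy, src_frontFace, hs]) hc)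
        (gen k z (by rw [← hz, src_backFace, hy, hc]) (by rw [← hz, tgt_backFace, ht])) := by
  subst hy hz hc
  unfold comul
  rw [genLift_gen]

variable (K) in
/-- The counit of `F̃(K)`. -/
noncomputable def counit : quiver k K (𝟙_ FInt) ⟶ 𝟙_ (ModQuiver k (Vert K)) :=
  ⟨fun s t => genLift fun x hs ht =>
    have h : s = t := by rw [← hs, ← ht, src, tgt, first_unit, last_unit]
    h ▸ unitElt k s⟩

lemma counit_gen {s : Vert K} (x : Simp K (𝟙_ FInt)) (hs : src x = s) (ht : tgt x = s) :
    Hom.app (counit k K) s s (gen k x hs ht) = unitElt k s := by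
  unfold counit
  rw [genLift_gen]

lemma src_unit (x : Simp K (𝟙_ FInt)) : src x = x := by
  rw [src, first_unit]; exact K_map_id (l := SimplexCategory.mk 0) x

lemma tgt_unit (x : Simp K (𝟙_ FInt)) : tgt x = x := by
  rw [tgt, last_unit]; exact K_map_id (l := SimplexCategory.mk 0) x

lemma comul_natural {a b c d : FInt} (f : a ⟶ b) (g : c ⟶ d) :
    comul k K b d ≫ (pullHom k f ⊗ₘ pullHom k g) = pullHom k (f ⊗ₘ g) ≫ comul k K a c :=
  quiver_hom_ext fun s t x hs ht => by
    rw [ModQuiver.comp_app, ModQuiver.comp_app, pullHom_gen, comul_gen k x hs ht _ _ rfl rfl rfl,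
      tensorHom_tmul, pullHom_gen, pullHom_gen]
    refine (comul_gen k _ _ _ _ _ ?_ ?_ ?_).symm
    · simp only [frontFace, pull, K_map_map, front_map]
    · simp only [backFace, pull, K_map_map, back_map]

lemma pullHom_id (a : FInt) : pullHom k (𝟙 a) = 𝟙 (quiver k K a) :=
  (functor k K).map_id (op a)

lemma comul_assoc (a b c : FInt) :
    comul k K (a ⊗ b) c ≫ comul k K a b ▷ quiver k K c ≫ (α_ _ _ _).hom =
      pullHom k (α_ a b c).inv ≫ comul k K a (b ⊗ c) ≫ quiver k K a ◁ comul k K b c :=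
  quiver_hom_ext fun s t x hs ht => by
    have h1 : frontFace (pull (α_ a b c).inv x) = frontFace (frontFace x) := by
      simp only [frontFace, pull, K_map_map, front_assoc]
    have h2 : frontFace (backFace (pull (α_ a b c).inv x)) = backFace (frontFace x) := by
      simp only [frontFace, backFace, pull, K_map_map, middle_assoc]
    have h3 : backFace (backFace (pull (α_ a b c).inv x)) = backFace x := by
      simp only [backFace, pull, K_map_map, back_assoc]
    simp only [ModQuiver.comp_app]
    rw [pullHom_gen, comul_gen k x hs ht _ _ rfl rfl rfl, whiskerRight_tmul,
      comul_gen k (frontFace x) _ _ _ _ rfl rfl rfl, associator_hom_tmul,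
      comul_gen k (pull (α_ a b c).inv x) _ _ _ _ h1 rfl rfl, whiskerLeft_tmul,
      comul_gen k (backFace (pull (α_ a b c).inv x)) _ _ _ _ h2 h3 (tgt_backFace _)]

lemma comul_leftUnit (a : FInt) :
    pullHom k (λ_ a).hom ≫ comul k K (𝟙_ FInt) a ≫ counit k K ▷ quiver k K a =
      (λ_ (quiver k K a)).inv :=
  quiver_hom_ext fun s t x hs ht => by
    have h : backFace (pull (λ_ a).hom x) = x := by
      simp only [backFace, pull, K_map_map, back_unit, K_map_id]
    have h' : tgt (frontFace (pull (λ_ a).hom x)) = s := by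
      rw [← src_backFace, h, hs]
    simp only [ModQuiver.comp_app]
    rw [pullHom_gen, comul_gen k _ _ _ _ _ rfl h h', whiskerRight_tmul, counit_gen,
      ModQuiver.leftUnitor_inv_apply]

lemma comul_rightUnit (a : FInt) :
    pullHom k (ρ_ a).hom ≫ comul k K a (𝟙_ FInt) ≫ quiver k K a ◁ counit k K =
      (ρ_ (quiver k K a)).inv :=
  quiver_hom_ext fun s t x hs ht => by
    have h : frontFace (pull (ρ_ a).hom x) = x := by
      simp only [frontFace, pull, K_map_map, front_unit, K_map_id]
    simp only [ModQuiver.comp_app]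
    rw [pullHom_gen, comul_gen k _ _ _ _ _ h rfl ht, whiskerLeft_tmul, counit_gen,
      ModQuiver.rightUnitor_inv_apply]

noncomputable instance : (functor k K).OplaxMonoidal where
  η := counit k K
  δ a b := comul k K a.unop b.unop
  δ_natural_left f a := by
    refine Eq.trans ?_ (comul_natural k f.unop (𝟙 a.unop))
    rw [pullHom_id, tensorHom_id]
    rfl
  δ_natural_right a f := by
    refine Eq.trans ?_ (comul_natural k (𝟙 a.unop) f.unop)
    rw [pullHom_id, id_tensorHom]
    rfl
  oplax_associativity a b c := comul_assoc k a.unop b.unop c.unop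
  oplax_left_unitality a := (comul_leftUnit k a.unop).symm
  oplax_right_unitality a := (comul_rightUnit k a.unop).symm

/-- A vertex as a `0`-simplex. -/
def ofVert (s : Vert K) : Simp K (𝟙_ FInt) := s

noncomputable def counitInv : 𝟙_ (ModQuiver k (Vert K)) ⟶ quiver k K (𝟙_ FInt) :=
  ⟨fun s _ => unitElim fun e => gen k (ofVert s) (src_unit s) ((tgt_unit s).trans e)⟩

lemma counitInv_unitElt (s : Vert K) : Hom.app (counitInv k) s s (unitElt k s) =
    gen k (ofVert s) (src_unit s) (tgt_unit s) := by
  unfold counitInv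
  rw [unitElim_unitElt]

noncomputable instance : IsIso (Functor.OplaxMonoidal.η (functor k K)) := by
  refine ⟨⟨counitInv k, ?_, ?_⟩⟩
  · refine quiver_hom_ext fun s t x hs ht => ?_
    obtain rfl : s = t := by rw [← hs, ← ht, src_unit, tgt_unit]
    refine (congrArg (Hom.app (counitInv k) s s) (counit_gen k x hs ht)).trans ?_
    rw [counitInv_unitElt]
    exact gen_congr k (by rw [← hs, src_unit]; rfl) _ _
  · refine ModQuiver.Hom.ext (funext fun s => funext fun t => unit_linearMap_ext fun e => ?_)
    subst e
    refine (congrArg (Hom.app (counit k K) s s) (counitInv_unitElt k s)).trans ?_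
    exact counit_gen k _ _ _

end FreeTemplicial

/-- The free templicial module `F̃(K)` on a simplicial set `K`. -/
noncomputable def freeTemplicial (k : Type u) [CommRing k] (K : SSet.{u}) :
    Templicial k (FreeTemplicial.Vert K) where
  toFunctor := FreeTemplicial.functor k K

namespace FreeTemplicial

open ModQuiver

variable (k : Type u) [CommRing k] {K L : SSet.{u}} (f : K ⟶ L)

/-- The image of a simplex. -/
def push {a : FInt} (x : Simp K a) : Simp L a := f.app _ x

/-- The image of a vertex. -/
def pushVert (x : Vert K) : Vert L := f.app _ x

lemma push_map {m n : SimplexCategory} (g : m ⟶ n) (x : K.obj (op n)) :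
    f.app (op m) (K.map g.op x) = L.map g.op (f.app (op n) x) :=
  NatTrans.naturality_apply f g.op x

lemma src_push {a : FInt} (x : Simp K a) : src (push f x) = pushVert f (src x) :=
  (push_map f _ x).symm

lemma tgt_push {a : FInt} (x : Simp K a) : tgt (push f x) = pushVert f (tgt x) :=
  (push_map f _ x).symm

/-- The map `F̃(K)_n → F̃(L)_n`. -/
noncomputable def pushHom (a : FInt) : HomOver (pushVert f) (quiver k K a) (quiver k L a) :=
  fun _ _ => genLift fun x hs ht => gen k (push f x) ((src_push f x).trans (congrArg _ hs))
    ((tgt_push f x).trans (congrArg _ ht))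

lemma pushHom_gen {a : FInt} {s t : Vert K} (x : Simp K a) (hs : src x = s) (ht : tgt x = t) :
    pushHom k f a s t (gen k x hs ht) = gen k (push f x) ((src_push f x).trans (congrArg _ hs))
      ((tgt_push f x).trans (congrArg _ ht)) := by
  unfold pushHom
  rw [genLift_gen]

lemma compat_of_gen {a : FInt} {P : ModQuiver k (Vert K)} {Q Q' : ModQuiver k (Vert L)}
    {p : HomOver (pushVert f) (quiver k K a) Q} {p' : HomOver (pushVert f) P Q'}
    {u : quiver k K a ⟶ P} {v : Q ⟶ Q'}
    (h : ∀ s t (x : Simp K a) (hs : src x = s) (ht : tgt x = t),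
      p' s t (Hom.app u s t (gen k x hs ht)) = Hom.app v _ _ (p s t (gen k x hs ht))) :
    Compat p p' u v := fun s t x =>
  LinearMap.congr_fun (f := p' s t ∘ₗ Hom.app u s t) (g := Hom.app v _ _ ∘ₗ p s t)
    (gen_ext (h s t)) x

lemma compat_pull {a b : FInt} (g : a ⟶ b) :
    Compat (pushHom k f b) (pushHom k f a) (pullHom k g) (pullHom k g) :=
  compat_of_gen k f fun s t x hs ht => by
    rw [pullHom_gen, pushHom_gen, pushHom_gen, pullHom_gen]
    exact gen_congr k (push_map f _ x) _ _

lemma compat_comul (a b : FInt) :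
    Compat (pushHom k f (a ⊗ b)) ((pushHom k f a).tensor (pushHom k f b)) (comul k K a b)
      (comul k L a b) :=
  compat_of_gen k f fun s t x hs ht => by
    rw [comul_gen k x hs ht _ _ rfl rfl rfl, HomOver.tensor_tmul, pushHom_gen, pushHom_gen,
      pushHom_gen]
    refine (comul_gen k _ _ _ _ _ ?_ ?_ ?_).symm
    · exact (push_map f _ x).symm
    · exact (push_map f _ x).symm

lemma compat_counit :
    Compat (pushHom k f (𝟙_ FInt)) (HomOver.unit k (pushVert f)) (counit k K) (counit k L) :=
  compat_of_gen k f fun s t x hs ht => by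
    obtain rfl : s = t := by rw [← hs, ← ht, src_unit, tgt_unit]
    rw [counit_gen, HomOver.unit_unitElt, pushHom_gen, counit_gen]

/-- The map `F̃(K) → F̃(L)` induced by a map of simplicial sets `K → L`. -/
noncomputable def map : TemplicialMap (pushVert f) (freeTemplicial k K) (freeTemplicial k L) where
  app n := pushHom k f ⟨n⟩
  naturality g := compat_pull k f (a := ⟨_⟩) (b := ⟨_⟩) g
  comul m n := compat_comul k f ⟨m⟩ ⟨n⟩
  counit := compat_counit k f

end FreeTemplicial

section WeakKan

open scoped Simplicial

/-- The vertex `i` of a horn of the standard `(n + 2)`-simplex. -/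
def hornVertex (n : ℕ) (j i : Fin (n + 3)) :
    FreeTemplicial.Vert (Λ[n + 2, j] : SSet.{u}) :=
  ⟨SSet.stdSimplex.obj₀Equiv.symm i, by rw [SSet.horn_obj_zero]; trivial⟩

/-- The map `F̃(Λ^n_j)_•(0, n) → F̃(Δ^n)_•(0, n)` induced by the inclusion of the horn, with `n + 2`
in place of `n`. -/
noncomputable def hornNec (k : Type u) [CommRing k] (n : ℕ) (j : Fin (n + 3)) :
    (freeTemplicial k (Λ[n + 2, j] : SSet.{u})).nec (hornVertex n j 0)
        (hornVertex n j (Fin.last (n + 2))) ⟶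
      (freeTemplicial k Δ[n + 2]).nec (SSet.stdSimplex.obj₀Equiv.symm 0)
        (SSet.stdSimplex.obj₀Equiv.symm (Fin.last (n + 2))) :=
  (FreeTemplicial.map k (SSet.horn (n + 2) j).ι).nec (hornVertex n j 0)
    (hornVertex n j (Fin.last (n + 2)))

end WeakKan

/-- A necklicial module `Y : Necᵒᵖ ⥤ Mod(k)` is weak Kan if it has the lifting property with
respect to the maps `F̃(Λ^n_j)_•(0, n) → F̃(Δ^n)_•(0, n)` for `0 < j < n`. -/
def WeakKan {k : Type u} [CommRing k] (Y : Necᵒᵖ ⥤ ModuleCat.{u} k) : Prop :=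
  ∀ (n : ℕ) (j : Fin (n + 3)), 0 < j → j < Fin.last (n + 2) →
    ∀ σ, ∃ τ, hornNec k n j ≫ τ = (σ : _ ⟶ Y)

/-- A quasi-category in `k`-modules. -/
def Templicial.IsQuasiCategory {k : Type u} [CommRing k] {S : Type u} (X : Templicial k S) : Prop :=
  ∀ a b : S, WeakKan (X.nec a b)

namespace BaseChange

open ModQuiver

variable {R : Type u} (k : Type u) [CommRing R] [CommRing k] [Algebra R k] {S : Type u}

section Modules

variable {k} {M N : Type u} [AddCommGroup M] [Module R M] [AddCommGroup N] [Module k N]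

/-- The `k`-linear map `k ⊗ M → N`, `x ⊗ m ↦ x • φ m`, of a semilinear map `φ`. -/
noncomputable def extend (φ : M →ₛₗ[algebraMap R k] N) : k ⊗[R] M →ₗ[k] N :=
  letI : Module R N := Module.compHom N (algebraMap R k)
  haveI : IsScalarTower R k N := ⟨fun r x n => by
    rw [Algebra.smul_def, mul_smul]; rfl⟩
  TensorProduct.AlgebraTensorModule.lift
    { toFun := fun x => x • ({ toFun := φ, map_add' := φ.map_add, map_smul' := φ.map_smulₛₗ } :
        M →ₗ[R] N)
      map_add' := fun x y => add_smul x y _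
      map_smul' := fun x y => mul_smul x y _ }

@[simp] lemma extend_tmul (φ : M →ₛₗ[algebraMap R k] N) (x : k) (m : M) :
    extend φ (x ⊗ₜ m) = x • φ m := rfl

lemma extend_ext {f g : k ⊗[R] M →ₗ[k] N} (h : ∀ m : M, f (1 ⊗ₜ m) = g (1 ⊗ₜ m)) : f = g := by
  refine LinearMap.ext fun z => ?_
  induction z with
  | zero => simp
  | add z z' hz hz' => simp [hz, hz']
  | tmul x m =>
    have : x ⊗ₜ[R] m = x • ((1 : k) ⊗ₜ[R] m) := by
      rw [TensorProduct.smul_tmul', smul_eq_mul, mul_one]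
    rw [this, map_smul, map_smul, h]

lemma one_tmul_smul (r : R) (m : M) :
    ((1 : k) ⊗ₜ[R] (r • m)) = algebraMap R k r • ((1 : k) ⊗ₜ[R] m) := by
  rw [TensorProduct.tmul_smul, algebraMap_smul]

end Modules

/-- Base change of quivers, `(k ⊗ Q)(a, b) = k ⊗ Q(a, b)`. -/
noncomputable def quiver : ModQuiver R S ⥤ ModQuiver k S where
  obj Q := ⟨fun a b => ModuleCat.of k (k ⊗[R] Q.hom a b)⟩
  map f := ⟨fun a b => (f.app a b).baseChange k⟩
  map_id _ := ModQuiver.Hom.ext (funext fun _ => funext fun _ => extend_ext fun _ => rfl)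
  map_comp _ _ := ModQuiver.Hom.ext (funext fun _ => funext fun _ => extend_ext fun _ => rfl)

/-- The element `1 ⊗ q`. -/
noncomputable def incl (Q : ModQuiver R S) (a b : S) :
    Q.hom a b →ₛₗ[algebraMap R k] ((quiver k).obj Q).hom a b where
  toFun q := (1 : k) ⊗ₜ[R] q
  map_add' := TensorProduct.tmul_add _
  map_smul' := one_tmul_smul

variable {k} in
lemma map_incl {P Q : ModQuiver R S} (f : P ⟶ Q) {a b : S} (p : P.hom a b) :
    Hom.app ((quiver k).map f) a b (incl k P a b p) = incl k Q a b (f.app a b p) := rfl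

variable {k} in
lemma incl_ext {Q : ModQuiver R S} {a b : S} {N : Type u} [AddCommGroup N] [Module k N]
    {f g : ((quiver k).obj Q).hom a b →ₗ[k] N}
    (h : ∀ q, f (incl k Q a b q) = g (incl k Q a b q)) : f = g :=
  extend_ext h

/-- The elements of `(P ⊗ Q)(a, b)` are sums of pure tensors. -/
lemma tensor_induction {P Q : ModQuiver R S} {a b : S} {p : (P ⊗ Q).hom a b → Prop}
    (zero : p 0) (add : ∀ x y, p x → p y → p (x + y))
    (tmul : ∀ c x y, p (tmul P Q c x y)) (z : (P ⊗ Q).hom a b) : p z := by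
  classical
  change ⨁ c : S, P.hom a c ⊗[R] Q.hom c b at z
  induction z using DirectSum.induction_on with
  | zero => exact zero
  | add x y hx hy => exact add _ _ hx hy
  | of c x =>
    induction x with
    | zero => rw [map_zero]; exact zero
    | add x y hx hy => rw [map_add]; exact add _ _ hx hy
    | tmul x y => exact tmul c x y

lemma unit_induction {a b : S} {p : (𝟙_ (ModQuiver R S)).hom a b → Prop}
    (zero : p 0) (add : ∀ x y, p x → p y → p (x + y))
    (smul : ∀ (e : a = b) (r : R), p (r • (e ▸ unitElt R a))) (z : (𝟙_ (ModQuiver R S)).hom a b) :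
    p z := by
  change PLift (a = b) →₀ R at z
  induction z using Finsupp.induction_linear with
  | zero => exact zero
  | add x y hx hy => exact add _ _ hx hy
  | single e r =>
    obtain ⟨rfl⟩ := e
    have h : Finsupp.single (PLift.up (rfl : a = a)) r =
        r • Finsupp.single (PLift.up (rfl : a = a)) (1 : R) := by simp
    exact (congrArg p h).mpr (smul rfl r)

/-- The semilinear map `(P ⊗ Q)(a, b) → ((k ⊗ P) ⊗ (k ⊗ Q))(a, b)`. -/
noncomputable def preComul (P Q : ModQuiver R S) (a b : S) :
    (P ⊗ Q).hom a b →ₛₗ[algebraMap R k] ((quiver k).obj P ⊗ (quiver k).obj Q).hom a b :=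
  letI : Module R (((quiver k).obj P ⊗ (quiver k).obj Q).hom a b) :=
    Module.compHom _ (algebraMap R k)
  let φ : (P ⊗ Q).hom a b →ₗ[R] ((quiver k).obj P ⊗ (quiver k).obj Q).hom a b :=
    tensorLift fun c => LinearMap.mk₂ R
      (fun p q => tmul ((quiver k).obj P) ((quiver k).obj Q) c (incl k P a c p) (incl k Q c b q))
      (fun _ _ _ => by rw [map_add, map_add, LinearMap.add_apply])
      (fun _ _ _ => by rw [map_smulₛₗ, map_smul, LinearMap.smul_apply]; rfl)
      (fun _ _ _ => by rw [map_add, map_add])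
      (fun _ _ _ => by rw [map_smulₛₗ, map_smul]; rfl)
  { toFun := φ, map_add' := φ.map_add, map_smul' := φ.map_smul }

lemma preComul_tmul (P Q : ModQuiver R S) {a b : S} (c : S) (p : P.hom a c) (q : Q.hom c b) :
    preComul k P Q a b (tmul P Q c p q) =
      tmul ((quiver k).obj P) ((quiver k).obj Q) c (incl k P a c p) (incl k Q c b q) := by
  let : Module R (((quiver k).obj P ⊗ (quiver k).obj Q).hom a b) :=
    Module.compHom _ (algebraMap R k)
  exact tensorLift_tmul _ c p q

/-- The comparison `k ⊗ (P ⊗ Q) → (k ⊗ P) ⊗ (k ⊗ Q)`, `x ⊗ (p ⊗ q) ↦ x • ((1 ⊗ p) ⊗ (1 ⊗ q))`. -/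
noncomputable def comul (P Q : ModQuiver R S) :
    (quiver k).obj (P ⊗ Q) ⟶ (quiver k).obj P ⊗ (quiver k).obj Q :=
  ⟨fun a b => extend (preComul k P Q a b)⟩

lemma comul_incl (P Q : ModQuiver R S) {a b : S} (c : S) (p : P.hom a c) (q : Q.hom c b) :
    Hom.app (comul k P Q) a b (incl k (P ⊗ Q) a b (tmul P Q c p q)) =
      tmul ((quiver k).obj P) ((quiver k).obj Q) c (incl k P a c p) (incl k Q c b q) :=
  (one_smul k _).trans (preComul_tmul k P Q c p q)

/-- The semilinear map between unit quivers. -/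
noncomputable def preCounit (a b : S) :
    (𝟙_ (ModQuiver R S)).hom a b →ₛₗ[algebraMap R k] (𝟙_ (ModQuiver k S)).hom a b :=
  letI : Module R ((𝟙_ (ModQuiver k S)).hom a b) := Module.compHom _ (algebraMap R k)
  let φ : (𝟙_ (ModQuiver R S)).hom a b →ₗ[R] (𝟙_ (ModQuiver k S)).hom a b :=
    unitElim fun e => e ▸ unitElt k a
  { toFun := φ, map_add' := φ.map_add, map_smul' := φ.map_smul }

lemma preCounit_unitElt (a : S) : preCounit k a a (unitElt R a) = unitElt k a := by
  let : Module R ((𝟙_ (ModQuiver k S)).hom a a) := Module.compHom _ (algebraMap R k)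
  exact unitElim_unitElt _

/-- The comparison `k ⊗ I → I`, `x ⊗ r ↦ x r`. -/
noncomputable def counit : (quiver k).obj (𝟙_ (ModQuiver R S)) ⟶ 𝟙_ (ModQuiver k S) :=
  ⟨fun a b => extend (preCounit k a b)⟩

lemma counit_incl (a : S) :
    Hom.app (counit (R := R) k) a a (incl k _ a a (unitElt R a)) = unitElt k a :=
  (one_smul k _).trans (preCounit_unitElt k a)

variable {k} in
lemma hom_ext_tensor {P Q : ModQuiver R S} {T : ModQuiver k S} {f g : (quiver k).obj (P ⊗ Q) ⟶ T}
    (h : ∀ a b c (p : P.hom a c) (q : Q.hom c b),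
      Hom.app f a b (incl k _ a b (tmul P Q c p q)) =
        Hom.app g a b (incl k _ a b (tmul P Q c p q))) : f = g := by
  refine ModQuiver.Hom.ext (funext fun a => funext fun b => incl_ext fun z => ?_)
  induction z using tensor_induction with
  | zero => rw [map_zero, map_zero, map_zero]
  | add x y hx hy => rw [map_add, map_add, map_add, hx, hy]
  | tmul c p q => exact h a b c p q

variable {k} in
lemma hom_ext_tensor₃ {P Q Q' : ModQuiver R S} {T : ModQuiver k S}
    {f g : (quiver k).obj ((P ⊗ Q) ⊗ Q') ⟶ T}
    (h : ∀ a b c d (p : P.hom a c) (q : Q.hom c d) (r : Q'.hom d b),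
      Hom.app f a b (incl k _ a b (tmul (P ⊗ Q) Q' d (tmul P Q c p q) r)) =
        Hom.app g a b (incl k _ a b (tmul (P ⊗ Q) Q' d (tmul P Q c p q) r))) : f = g := by
  refine hom_ext_tensor fun a b d z r => ?_
  induction z using tensor_induction with
  | zero => simp only [map_zero, LinearMap.zero_apply]
  | add x y hx hy => simp only [map_add, LinearMap.add_apply, hx, hy]
  | tmul c p q => exact h a b c d p q r

variable {k} in
lemma hom_ext_of_incl {Q : ModQuiver R S} {T : ModQuiver k S} {f g : (quiver k).obj Q ⟶ T}
    (h : ∀ a b (q : Q.hom a b), Hom.app f a b (incl k _ a b q) = Hom.app g a b (incl k _ a b q)) :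
    f = g :=
  ModQuiver.Hom.ext (funext fun a => funext fun b => incl_ext (h a b))

/-- Base change of quivers is (strong) monoidal. -/
noncomputable instance : (quiver (R := R) (S := S) k).OplaxMonoidal where
  η := counit k
  δ := comul k
  δ_natural_left f Q := hom_ext_tensor fun a b c p q => by
    simp only [ModQuiver.comp_app, comul_incl, map_incl, whiskerRight_tmul]
  δ_natural_right P f := hom_ext_tensor fun a b c p q => by
    simp only [ModQuiver.comp_app, comul_incl, map_incl, whiskerLeft_tmul]
  oplax_associativity P Q Q' := hom_ext_tensor₃ fun a b c d p q r => by
    simp only [ModQuiver.comp_app, comul_incl, map_incl, whiskerRight_tmul, whiskerLeft_tmul,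
      associator_hom_tmul]
  oplax_left_unitality Q := by
    refine ModQuiver.Hom.ext (funext fun a => funext fun b => extend_ext fun q => ?_)
    change Hom.app (λ_ ((quiver k).obj Q)).inv a b (incl k Q a b q) =
      Hom.app ((quiver k).map (λ_ Q).inv ≫ comul k _ Q ≫ counit k ▷ (quiver k).obj Q) a b
        (incl k Q a b q)
    simp only [ModQuiver.comp_app, map_incl, ModQuiver.leftUnitor_inv_apply, comul_incl, whiskerRight_tmul,
      counit_incl]
  oplax_right_unitality Q := by
    refine ModQuiver.Hom.ext (funext fun a => funext fun b => extend_ext fun q => ?_)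
    change Hom.app (ρ_ ((quiver k).obj Q)).inv a b (incl k Q a b q) =
      Hom.app ((quiver k).map (ρ_ Q).inv ≫ comul k Q _ ≫ (quiver k).obj Q ◁ counit k) a b
        (incl k Q a b q)
    simp only [ModQuiver.comp_app, map_incl, ModQuiver.rightUnitor_inv_apply, comul_incl, whiskerLeft_tmul,
      counit_incl]

/-- The inverse of the comparison `k ⊗ I → I`. -/
noncomputable def counitInv : 𝟙_ (ModQuiver k S) ⟶ (quiver k).obj (𝟙_ (ModQuiver R S)) :=
  ⟨fun a _ => unitElim fun e => e ▸ incl k _ a a (unitElt R a)⟩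

lemma counitInv_unitElt (a : S) :
    Hom.app (counitInv (R := R) k) a a (unitElt k a) = incl k _ a a (unitElt R a) :=
  unitElim_unitElt _

noncomputable instance : IsIso (Functor.OplaxMonoidal.η (quiver (R := R) (S := S) k)) := by
  refine ⟨⟨counitInv k, ?_, ?_⟩⟩
  · refine ModQuiver.Hom.ext (funext fun a => funext fun b => incl_ext fun z => ?_)
    induction z using unit_induction with
    | zero => rw [map_zero, map_zero, map_zero]
    | add x y hx hy => rw [map_add, map_add, map_add, hx, hy]
    | smul e r =>
      cases e
      rw [map_smulₛₗ, map_smul, map_smul]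
      refine congrArg _ ?_
      refine (congrArg (Hom.app (counitInv k) a a) (counit_incl k a)).trans ?_
      exact counitInv_unitElt k a
  · refine ModQuiver.Hom.ext (funext fun a => funext fun b => unit_linearMap_ext fun e => ?_)
    subst e
    refine (congrArg (Hom.app (counit k) a a) (counitInv_unitElt k a)).trans ?_
    exact counit_incl k a

end BaseChange

open BaseChange in
/-- The base change `k ⊗ X` of a templicial `R`-module. -/
noncomputable def Templicial.baseChange {R : Type u} (k : Type u) [CommRing R] [CommRing k]
    [Algebra R k] {S : Type u} (X : Templicial R S) : Templicial k S where
  toFunctor := X.toFunctor ⋙ quiver k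
  unital := by
    rw [Functor.OplaxMonoidal.comp_η]
    infer_instance

/-! Let I be the kernel of `R → k`. For every n, the functor `F̃(Δ^n)_•(0, n)` is free on the
presheaf represented by the necklace `Δ^n`. The horn spans the sieve of those maps `T → Δ^n` that
send some joint to an interior vertex or omit some interior vertex other than j; here 0 < j < n is
essential. So "weak Kan" means that every compatible family of elements on such a sieve comes from a
single element over `Δ^n` (`FreeTemplicial.fillable_of_weakKan`,
`FreeTemplicial.weakKan_of_fillable`). What remains is an extension problem for families on sieves
of necklaces.

The statement that can be proved by induction carries coefficients: for every quiver P annihilated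
by a power of I, horns in `(P ⊗ X̄_•)(a, t)` can be filled. The theorem is the case where P is the
unit quiver, which is annihilated by I^m = 0. Since all `X̄_T` are flat, a short exact sequence of
coefficient quivers gives a short exact sequence of functors
(`Templicial.LevelwiseFlat.pointwiseExact`). Fillability passes to extensions
(`PointwiseExact.fillable`), so the sequence IP → P → P/IP reduces the claim to IP = 0
(`Templicial.fillable_of_annihilated_pow`).

If IP = 0, cover P by a quiver of free k-modules with kernel K. The cover tensored with `X̄_•` is a
direct sum of copies of `k ⊗ X̄_•`, where horns can be filled by assumption; a horn sieve has
finitely many generators, so only finitely many summands matter (`Templicial.fillable_cover`). It is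
therefore enough to lift a horn from `P ⊗ X̄_•` to the cover, fill it there and project the filler.
The lift is constructed one generator of the sieve at a time
(`PointwiseExact.liftable_of_isAdjoin`), and each step asks to fill, in `K ⊗ X̄_•`, the part of the
new generator already covered. For a face `Δ^{n-1}`, this part is a sieve of horn type in dimension
n - 1. For a wedge `Δ^i ∨ Δ^m`, it is concentrated in the second bead, and the first bead can be
absorbed into the coefficients, which become `K ⊗ X̄_i`. Both K and `K ⊗ X̄_i` are again annihilated
by I, so induction on n, over all coefficients at once, closes the argument
(`Templicial.fillable_of_annihilated`). -/

section Sieves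

-- Compatible families on sieves: filling, lifting and exact sequences

universe v w

variable {C : Type w} [Category.{v} C] {V : C}

/-- A compatible family of elements of `Y` indexed by a sieve. -/
structure SieveFamily {R : Type u} [CommRing R] (Y : Cᵒᵖ ⥤ ModuleCat.{u} R) (S : Sieve V) where
  val : ∀ {T : C} (f : T ⟶ V), S f → Y.obj (op T)
  map_val : ∀ {T U : C} (g : U ⟶ T) (f : T ⟶ V) (h : S f),
    Y.map g.op (val f h) = val (g ≫ f) (S.downward_closed h g)

/-- Every compatible family on the sieve `S` comes from an element of `Y(V)`. -/
def Fillable {R : Type u} [CommRing R] (Y : Cᵒᵖ ⥤ ModuleCat.{u} R) (S : Sieve V) : Prop :=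
  ∀ σ : SieveFamily Y S, ∃ y : Y.obj (op V), ∀ {T : C} (f : T ⟶ V) (h : S f),
    Y.map f.op y = σ.val f h

/-- The sieve `S'` is generated by `S` and the morphism `g`. -/
def IsAdjoin {V' : C} (S S' : Sieve V) (g : V' ⟶ V) : Prop :=
  ∀ {T : C} (f : T ⟶ V), S' f ↔ S f ∨ ∃ h, h ≫ g = f

namespace SieveFamily

variable {R : Type u} [CommRing R] {Y Y' Y'' : Cᵒᵖ ⥤ ModuleCat.{u} R} {S S' : Sieve V}

lemma val_congr (σ : SieveFamily Y S) {T : C} {f f' : T ⟶ V} (e : f = f') (h : S f) :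
    σ.val f h = σ.val f' (e ▸ h) := by
  subst e; rfl

/-- The image of a family under a natural family of functions, over any rings. -/
def mapFun {k : Type u} [CommRing k] {Z : Cᵒᵖ ⥤ ModuleCat.{u} k} (σ : SieveFamily Y S)
    (φ : ∀ T : C, Y.obj (op T) → Z.obj (op T))
    (hφ : ∀ {T U : C} (g : U ⟶ T) (y : Y.obj (op T)),
      φ U (Y.map g.op y) = Z.map g.op (φ T y)) : SieveFamily Z S where
  val f h := φ _ (σ.val f h)
  map_val g f h := by rw [← hφ, σ.map_val]

/-- The image of a family under a natural transformation. -/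
def map (σ : SieveFamily Y S) (p : Y ⟶ Y') : SieveFamily Y' S :=
  σ.mapFun (fun T => p.app (op T)) fun g y => NatTrans.naturality_apply p g.op y

/-- The pullback of a family. -/
def pullback (σ : SieveFamily Y S) {V' : C} (g : V' ⟶ V) : SieveFamily Y (S.pullback g) where
  val f h := σ.val (f ≫ g) h
  map_val a f h := by
    exact (σ.map_val a (f ≫ g) h).trans (σ.val_congr (Category.assoc _ _ _).symm _)

/-- The restriction of a family to a smaller sieve. -/
def restrict (σ : SieveFamily Y S) (h : S' ≤ S) : SieveFamily Y S' where
  val f hf := σ.val f (h f hf)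
  map_val a f _ := σ.map_val a f _

/-- The family obtained by restricting an element. -/
def ofElement (y : Y.obj (op V)) (S : Sieve V) : SieveFamily Y S where
  val f _ := Y.map f.op y
  map_val g f _ := by rw [op_comp, Functor.map_comp_apply]

/-- The difference of two families. -/
def sub (σ τ : SieveFamily Y S) : SieveFamily Y S where
  val f h := σ.val f h - τ.val f h
  map_val g f h := by rw [map_sub, σ.map_val, τ.map_val]

open Classical in
/-- The extension of a family along the adjunction of a monomorphism. -/
noncomputable def extend {V' : C} {g : V' ⟶ V} (hS : IsAdjoin S S' g) [Mono g]
    (σ : SieveFamily Y S) (y : Y.obj (op V'))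
    (hy : ∀ {T : C} (f : T ⟶ V') (h : S (f ≫ g)), Y.map f.op y = σ.val (f ≫ g) h) :
    SieveFamily Y S' where
  -- Outside S, a morphism of S' factors through g, uniquely because g is a monomorphism, so the
  -- chosen factorization plays no role.
  val f h := if hf : S f then σ.val f hf else Y.map (((hS f).1 h).resolve_left hf).choose.op y
  map_val a f h := by
    by_cases hf : S f
    · rw [dif_pos hf, dif_pos (S.downward_closed hf a), σ.map_val]
    · rw [dif_neg hf]
      have h1 := (((hS f).1 h).resolve_left hf).choose_spec
      set b := (((hS f).1 h).resolve_left hf).choose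
      rw [← Functor.map_comp_apply, ← op_comp]
      -- Precomposition can bring a morphism back into S; there the two definitions agree by `hy`.
      by_cases haf : S (a ≫ f)
      · rw [dif_pos haf]
        have h2 : (a ≫ b) ≫ g = a ≫ f := by rw [Category.assoc, h1]
        rw [hy (a ≫ b) (h2 ▸ haf)]
        exact σ.val_congr h2 _
      · rw [dif_neg haf]
        have h3 := (((hS (a ≫ f)).1 (S'.downward_closed h a)).resolve_left haf).choose_spec
        set c := (((hS (a ≫ f)).1 (S'.downward_closed h a)).resolve_left haf).choose
        have h4 : a ≫ b = c := by
          rw [← cancel_mono g, h3, Category.assoc, h1]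
        rw [h4]

lemma extend_val {V' : C} {g : V' ⟶ V} (hS : IsAdjoin S S' g) [Mono g]
    (σ : SieveFamily Y S) (y : Y.obj (op V'))
    (hy : ∀ {T : C} (f : T ⟶ V') (h : S (f ≫ g)), Y.map f.op y = σ.val (f ≫ g) h)
    {T : C} (f : T ⟶ V) (h : S f) :
    (σ.extend hS y hy).val f ((hS f).2 (Or.inl h)) = σ.val f h :=
  dif_pos h

lemma extend_val_comp {V' : C} {g : V' ⟶ V} (hS : IsAdjoin S S' g) [Mono g]
    (σ : SieveFamily Y S) (y : Y.obj (op V'))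
    (hy : ∀ {T : C} (f : T ⟶ V') (h : S (f ≫ g)), Y.map f.op y = σ.val (f ≫ g) h)
    {T : C} (f : T ⟶ V') :
    (σ.extend hS y hy).val (f ≫ g) ((hS _).2 (Or.inr ⟨f, rfl⟩)) = Y.map f.op y := by
  by_cases h : S (f ≫ g)
  · rw [extend_val hS σ y hy _ h, hy f h]
  · refine (dif_neg h).trans ?_
    have hr : S' (f ≫ g) := (hS _).2 (Or.inr ⟨f, rfl⟩)
    have h1 := (((hS (f ≫ g)).1 hr).resolve_left h).choose_spec
    exact congrArg (fun b => Y.map b.op y) ((cancel_mono g).1 h1)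

end SieveFamily

variable {R : Type u} [CommRing R] {Y Y' Y'' : Cᵒᵖ ⥤ ModuleCat.{u} R} {S S' : Sieve V}

lemma IsAdjoin.le {V' : C} {g : V' ⟶ V} (hS : IsAdjoin S S' g) : S ≤ S' :=
  fun _ f h => (hS f).2 (Or.inl h)

lemma IsAdjoin.right {V' T : C} {g : V' ⟶ V} (hS : IsAdjoin S S' g) (f : T ⟶ V') : S' (f ≫ g) :=
  (hS _).2 (Or.inr ⟨f, rfl⟩)

lemma fillable_bot : Fillable Y (⊥ : Sieve V) := fun _ => ⟨0, fun _ h => h.elim⟩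

/-- Filling on the pullback along g provides a value at g compatible with the family; the family
thus extends to S', where it can be filled. -/
lemma Fillable.of_isAdjoin {V' : C} {g : V' ⟶ V} [Mono g] (hS : IsAdjoin S S' g)
    (h' : Fillable Y S') (h : Fillable Y (S.pullback g)) : Fillable Y S := by
  intro σ
  obtain ⟨y, hy⟩ := h (σ.pullback g)
  obtain ⟨z, hz⟩ := h' (σ.extend hS y hy)
  exact ⟨z, fun f hf => (hz f (hS.le _ hf)).trans (SieveFamily.extend_val hS σ y hy f hf)⟩

/-- Fillability is preserved by natural bijections, over any rings. -/
lemma Fillable.of_bijective {k : Type u} [CommRing k] {Z : Cᵒᵖ ⥤ ModuleCat.{u} k}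
    (φ : ∀ T : C, Y.obj (op T) → Z.obj (op T))
    (hφ : ∀ {T U : C} (g : U ⟶ T) (y : Y.obj (op T)),
      φ U (Y.map g.op y) = Z.map g.op (φ T y))
    (hb : ∀ T, Function.Bijective (φ T)) (h : Fillable Y S) : Fillable Z S := by
  intro σ
  let e (T : C) := Equiv.ofBijective (φ T) (hb T)
  have he {T U : C} (g : U ⟶ T) (z : Z.obj (op T)) :
      (e U).symm (Z.map g.op z) = Y.map g.op ((e T).symm z) := by
    rw [Equiv.symm_apply_eq]
    refine Eq.trans ?_ (hφ g _).symm
    exact congrArg _ ((e T).apply_symm_apply z).symm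
  obtain ⟨y, hy⟩ := h (σ.mapFun (fun T => (e T).symm) he)
  refine ⟨φ V y, fun f hf => ?_⟩
  rw [← hφ, hy f hf]
  exact (e _).apply_symm_apply _

/-- Pointwise short exact sequences `0 → Y' → Y → Y'' → 0`. -/
structure PointwiseExact (i : Y' ⟶ Y) (p : Y ⟶ Y'') : Prop where
  injective : ∀ T, Function.Injective (i.app T)
  exact : ∀ T, Function.Exact (i.app T) (p.app T)
  surjective : ∀ T, Function.Surjective (p.app T)

variable {i : Y' ⟶ Y} {p : Y ⟶ Y''}

/-- Families on `S` can be lifted along `p`. -/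
def Liftable (p : Y ⟶ Y'') (S : Sieve V) : Prop :=
  ∀ σ : SieveFamily Y'' S, ∃ τ : SieveFamily Y S, ∀ {T : C} (f : T ⟶ V) (h : S f),
    p.app (op T) (τ.val f h) = σ.val f h

/-- Exactness gives preimages one at a time; injectivity of i makes them unique, hence compatible.
-/
lemma PointwiseExact.exists_family (h : PointwiseExact i p) (σ : SieveFamily Y S)
    (hσ : ∀ {T : C} (f : T ⟶ V) (hf : S f), p.app (op T) (σ.val f hf) = 0) :
    ∃ τ : SieveFamily Y' S, ∀ {T : C} (f : T ⟶ V) (hf : S f),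
      i.app (op T) (τ.val f hf) = σ.val f hf := by
  choose τ hτ using fun (T : C) (f : T ⟶ V) (hf : S f) =>
    (h.exact (op T) (σ.val f hf)).1 (hσ f hf)
  refine ⟨⟨fun {T} f hf => τ T f hf, fun g f hf => h.injective _ ?_⟩, fun f hf => hτ _ f hf⟩
  rw [hτ, NatTrans.naturality_apply, hτ, σ.map_val]

/-- A filler modulo the subobject `Y'` can be corrected. -/
lemma PointwiseExact.exists_filler (h : PointwiseExact i p) (hS : Fillable Y' S)
    (σ : SieveFamily Y S) (y'' : Y''.obj (op V))
    (hy : ∀ {T : C} (f : T ⟶ V) (hf : S f), Y''.map f.op y'' = p.app (op T) (σ.val f hf)) :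
    ∃ y : Y.obj (op V), p.app (op V) y = y'' ∧
      ∀ {T : C} (f : T ⟶ V) (hf : S f), Y.map f.op y = σ.val f hf := by
  -- Any lift y₀ fails to fill σ only by a family with values in Y'. A filler of this defect
  -- corrects y₀ without changing its image in Y''.
  obtain ⟨y₀, rfl⟩ := h.surjective (op V) y''
  obtain ⟨τ, hτ⟩ := h.exists_family (σ.sub (.ofElement y₀ S)) fun f hf => by
    refine (map_sub (p.app _).hom _ _).trans (sub_eq_zero.2 ?_)
    rw [← hy f hf]
    exact (NatTrans.naturality_apply p f.op y₀).symm
  obtain ⟨z, hz⟩ := hS τ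
  refine ⟨y₀ + i.app _ z, ?_, fun f hf => ?_⟩
  · rw [map_add, (h.exact _ _).2 ⟨z, rfl⟩, add_zero]
  · rw [map_add, ← NatTrans.naturality_apply i f.op z, hz f hf, hτ f hf]
    exact add_sub_cancel _ _

/-- A filler in Y'' of the image family is lifted to Y and corrected by an element of Y'. -/
lemma PointwiseExact.fillable (h : PointwiseExact i p) (h' : Fillable Y' S)
    (h'' : Fillable Y'' S) : Fillable Y S := by
  intro σ
  obtain ⟨y'', hy⟩ := h'' (σ.map p)
  obtain ⟨y, -, hy⟩ := h.exists_filler h' σ y'' hy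
  exact ⟨y, hy⟩

/-- Lift the family, fill the lift, project the filler. This transfers fillers from a free cover to
its quotient. -/
lemma Liftable.fillable (h : Liftable p S) (hY : Fillable Y S) : Fillable Y'' S := by
  intro σ
  obtain ⟨τ, hτ⟩ := h σ
  obtain ⟨y, hy⟩ := hY τ
  refine ⟨p.app _ y, fun f hf => ?_⟩
  rw [← hτ f hf, ← hy f hf]
  exact (NatTrans.naturality_apply p f.op y).symm

lemma liftable_bot (p : Y ⟶ Y'') : Liftable p (⊥ : Sieve V) := fun _ =>
  ⟨⟨fun _ h => h.elim, fun _ _ h => h.elim⟩, fun _ h => h.elim⟩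

/-- A lift on S extends over the new generator g once some element lies over the value of σ at g and
restricts to the given lift on the overlap. This is the relative filling problem of `exists_filler`,
so only Y' on the pulled back sieve has to be fillable. -/
lemma PointwiseExact.liftable_of_isAdjoin (h : PointwiseExact i p) {V' : C} {g : V' ⟶ V} [Mono g]
    (hS : IsAdjoin S S' g) (hp : Liftable p S) (h' : Fillable Y' (S.pullback g)) :
    Liftable p S' := by
  intro σ
  obtain ⟨τ, hτ⟩ := hp (σ.restrict hS.le)
  obtain ⟨y, hpy, hy⟩ := h.exists_filler h' (τ.pullback g) (σ.val g (by simpa using hS.right (𝟙 V')))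
    fun f hf => by
      rw [σ.map_val]
      exact (hτ (f ≫ g) hf).symm
  refine ⟨τ.extend hS y hy, fun {T} f hf => ?_⟩
  rcases (hS f).1 hf with h1 | ⟨f, rfl⟩
  · rw [SieveFamily.extend_val hS τ y hy f h1, hτ f h1]
    rfl
  · rw [SieveFamily.extend_val_comp hS τ y hy f]
    refine (NatTrans.naturality_apply p f.op y).trans ?_
    rw [hpy, σ.map_val]

/-- The sieve `S` is generated by finitely many morphisms. -/
def FinitelyGenerated (S : Sieve V) : Prop :=
  ∃ L : List (Σ T : C, T ⟶ V), (∀ g ∈ L, S g.2) ∧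
    ∀ {T : C} (f : T ⟶ V), S f → ∃ g ∈ L, ∃ h, h ≫ g.2 = f

lemma finitelyGenerated_bot : FinitelyGenerated (⊥ : Sieve V) :=
  ⟨[], by simp, fun _ h => h.elim⟩

lemma FinitelyGenerated.of_isAdjoin {V' : C} {g : V' ⟶ V} (hS : IsAdjoin S S' g)
    (h : FinitelyGenerated S) : FinitelyGenerated S' := by
  obtain ⟨L, h1, h2⟩ := h
  refine ⟨⟨V', g⟩ :: L, fun a ha => ?_, fun f hf => ?_⟩
  · rcases List.mem_cons.1 ha with rfl | ha
    · simpa using hS.right (𝟙 V')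
    · exact hS.le _ (h1 a ha)
  · rcases (hS f).1 hf with hf | ⟨h, rfl⟩
    · obtain ⟨a, ha, h⟩ := h2 f hf
      exact ⟨a, List.mem_cons_of_mem _ ha, h⟩
    · exact ⟨_, List.mem_cons_self, h, rfl⟩

/-- If the elements of `Z` are finite sums of components in functors `W i` which are fillable, then
`Z` is fillable. -/
lemma Fillable.of_components {k : Type u} [CommRing k] {Z : Cᵒᵖ ⥤ ModuleCat.{u} k} {J : Type*}
    [DecidableEq J] {W : J → Cᵒᵖ ⥤ ModuleCat.{u} R} (hS : FinitelyGenerated S)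
    (hW : ∀ j, Fillable (W j) S)
    (a : ∀ j (T : C), (W j).obj (op T) →+ Z.obj (op T))
    (ha : ∀ j {T U : C} (g : U ⟶ T) (y : (W j).obj (op T)),
      a j U ((W j).map g.op y) = Z.map g.op (a j T y))
    (b : ∀ j (T : C), Z.obj (op T) →+ (W j).obj (op T))
    (hb : ∀ j {T U : C} (g : U ⟶ T) (y : Z.obj (op T)),
      b j U (Z.map g.op y) = (W j).map g.op (b j T y))
    (hab : ∀ (T : C) (z : Z.obj (op T)), ∃ J₀ : Finset J, ∀ J₁, J₀ ⊆ J₁ →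
      z = ∑ j ∈ J₁, a j T (b j T z)) : Fillable Z S := by
  classical
  intro σ
  obtain ⟨L, hL, hL'⟩ := hS
  choose y hy using fun j => hW j (σ.mapFun (fun T => b j T) (hb j))
  -- One finite set of indices that is large enough for the values of the family at all of the
  -- finitely many generators.
  obtain ⟨J₁, hJ₁⟩ : ∃ J₁ : Finset J, ∀ g (hg : g ∈ L),
      σ.val g.2 (hL g hg) = ∑ j ∈ J₁, a j g.1 (b j g.1 (σ.val g.2 (hL g hg))) := by
    choose J₀ hJ₀ using hab
    refine ⟨L.attach.toFinset.biUnion fun g => J₀ g.1.1 (σ.val g.1.2 (hL g.1 g.2)), ?_⟩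
    intro g hg
    refine hJ₀ _ _ _ ?_
    exact Finset.subset_biUnion_of_mem
      (fun g : {g // g ∈ L} => J₀ g.1.1 (σ.val g.1.2 (hL g.1 g.2)))
      (x := ⟨g, hg⟩) (List.mem_toFinset.2 (List.mem_attach _ _))
  -- The fillers of the component families outside J₁ can be discarded: at the generators, and hence
  -- on the whole sieve, the family is the sum of its components in J₁.
  refine ⟨∑ j ∈ J₁, a j V (y j), fun f hf => ?_⟩
  obtain ⟨g, hg, h, rfl⟩ := hL' f hf
  rw [← σ.map_val h g.2 (hL g hg), hJ₁ g hg, op_comp, Functor.map_comp_apply]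
  congr 1
  rw [map_sum]
  refine Finset.sum_congr rfl fun j _ => ?_
  rw [← ha, hy j g.2 (hL g hg)]
  rfl

end Sieves

/-! ### Sieves on the necklace `Δ^n` and their generators -/

namespace Nec

lemma hom_ext {T U : Nec} {f g : T ⟶ U}
    (h : ∀ i, i ≤ T.beads.sum → f.map.app i = g.map.app i) : f = g :=
  Hom.ext (FInt.Hom.ext_app h)

lemma comp_app {T U V : Nec} (f : T ⟶ U) (g : U ⟶ V) (i : ℕ) :
    (f ≫ g).map.app i = g.map.app (f.map.app i) := FInt.Hom.comp_app f.map g.map i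

lemma id_app (T : Nec) {i : ℕ} (h : i ≤ T.beads.sum) :
    (Hom.map (𝟙 T)).app i = i :=
  min_eq_left h

/-- The underlying map of vertices is injective. -/
def Inj {T U : Nec} (f : T ⟶ U) : Prop :=
  ∀ x y, x ≤ T.beads.sum → y ≤ T.beads.sum → f.map.app x = f.map.app y → x = y

lemma Inj.mono {T U : Nec} {f : T ⟶ U} (h : Inj f) : Mono f :=
  ⟨fun {Z} a b e => hom_ext fun i _ => h _ _ (a.map.app_le i) (b.map.app_le i) (by
    rw [← comp_app, e, comp_app])⟩

/-- Preimages under the injective map g assemble into a monotone map, because an injective monotone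
map reflects the order; `hj` ensures that this map is one of necklaces. -/
lemma exists_factorization {T V V' : Nec} (f : T ⟶ V) {g : V' ⟶ V} (hg : Inj g)
    (him : ∀ x, x ≤ T.beads.sum → ∃ y ≤ V'.beads.sum, g.map.app y = f.map.app x)
    (hj : ∀ v ∈ joints V'.beads, ∃ t ∈ joints T.beads, f.map.app t = g.map.app v) :
    ∃ h, h ≫ g = f := by
  -- Beyond the last vertex, `app` is constant with value the last vertex, so preimages exist for
  -- all natural numbers and can be chosen as a function on `ℕ`.
  have him' : ∀ x, ∃ y ≤ V'.beads.sum, g.map.app y = f.map.app x := fun x => by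
    by_cases hx : x ≤ T.beads.sum
    · exact him x hx
    · exact ⟨_, le_rfl, by rw [f.map.app_of_le (by omega), g.map.app_of_le le_rfl]⟩
  choose φ hφ hφ' using him'
  have h0 : φ 0 = 0 := hg _ _ (hφ 0) (Nat.zero_le _) (by
    rw [hφ', f.map.app_zero, g.map.app_zero])
  have h1 : φ T.beads.sum = V'.beads.sum := hg _ _ (hφ _) le_rfl (by
    rw [hφ', f.map.app_of_le le_rfl, g.map.app_of_le le_rfl])
  have h2 : ∀ i j, i ≤ j → φ i ≤ φ j := fun i j hij => by
    by_contra! hlt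
    have h3 := f.map.app_mono hij
    have h4 := g.map.app_mono hlt.le
    rw [← hφ' i, ← hφ' j] at h3
    have := hg _ _ (hφ i) (hφ j) (by omega)
    omega
  have h3 (i : ℕ) (hi : i ≤ T.beads.sum) :
      (FInt.Hom.mk' φ h0 h1 fun i j hij _ => h2 i j hij).app i = φ i := by
    rw [FInt.Hom.mk'_app, min_eq_left hi]
  refine ⟨⟨FInt.Hom.mk' φ h0 h1 fun i j hij _ => h2 i j hij, fun v hv => ?_⟩,
    hom_ext fun i hi => ?_⟩
  · obtain ⟨t, ht, e⟩ := hj v hv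
    refine ⟨t, ht, ?_⟩
    rw [h3 t (joints_le_sum _ ht)]
    exact hg _ _ (hφ t) (joints_le_sum _ hv) (by rw [hφ', e])
  · rw [comp_app]
    exact (congrArg g.map.app (h3 i hi)).trans (hφ' i)

/-- The sieve of maps `f` with a joint over `B`, or with an element of `A` missing from the
image. -/
def sieve (V : Nec) (B A : Set ℕ) : Sieve V where
  arrows T f := (∃ t ∈ joints T.beads, f.map.app t ∈ B) ∨
    ∃ i ∈ A, ∀ x ≤ T.beads.sum, f.map.app x ≠ i
  downward_closed {T U f} h g := by
    refine h.imp ?_ ?_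
    -- Every joint of T is the image of a joint of U, so the condition on joints survives
    -- precomposition.
    · rintro ⟨t, ht, hB⟩
      obtain ⟨s, hs, rfl⟩ := g.joints_subset ht
      exact ⟨s, hs, by rwa [comp_app]⟩
    · rintro ⟨i, hi, h⟩
      exact ⟨i, hi, fun x hx => by rw [comp_app]; exact h _ (g.map.app_le x)⟩

lemma sieve_apply {V : Nec} {B A : Set ℕ} {T : Nec} (f : T ⟶ V) :
    sieve V B A f ↔ (∃ t ∈ joints T.beads, f.map.app t ∈ B) ∨
      ∃ i ∈ A, ∀ x ≤ T.beads.sum, f.map.app x ≠ i := Iff.rfl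

lemma sieve_empty (V : Nec) : sieve V ∅ ∅ = ⊥ := by
  ext T f
  simp [sieve_apply]

/-- Since g is injective, a vertex in its image is omitted by `f ≫ g` exactly when its preimage is
omitted by f. All of A has to lie in the image of g, as otherwise the pullback would be the maximal
sieve. -/
lemma sieve_pullback {V V' : Nec} {g : V' ⟶ V} (hg : Inj g) {B A B' A' : Set ℕ}
    (hB : ∀ x ≤ V'.beads.sum, x ∈ B' ↔ g.map.app x ∈ B)
    (hA : ∀ a ∈ A, ∃ x ∈ A', g.map.app x = a)
    (hA' : ∀ x ∈ A', x ≤ V'.beads.sum ∧ g.map.app x ∈ A) :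
    (sieve V B A).pullback g = sieve V' B' A' := by
  ext T f
  rw [Sieve.pullback_apply, sieve_apply, sieve_apply]
  simp only [comp_app]
  refine or_congr (exists_congr fun t => and_congr_right fun ht => ?_) ⟨?_, ?_⟩
  · exact (hB _ (f.map.app_le t)).symm
  · rintro ⟨a, ha, h⟩
    obtain ⟨x, hx, rfl⟩ := hA a ha
    exact ⟨x, hx, fun y hy e => h y hy (congrArg _ e)⟩
  · rintro ⟨x, hx, h⟩
    exact ⟨_, (hA' x hx).2, fun y hy e => h y hy (hg _ _ (f.map.app_le y) (hA' x hx).1 e)⟩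

/-- The necklace `Δ^n`. -/
abbrev bead (n : ℕ) (hn : 0 < n) : Nec := ⟨[n], by simpa⟩

/-- Adding a bead in front. -/
abbrev cons (b : ℕ) (hb : 0 < b) (T : Nec) : Nec := ⟨b :: T.beads, by
  simpa using ⟨hb, T.pos⟩⟩

lemma bead_sum (n : ℕ) (hn : 0 < n) : (bead n hn).beads.sum = n := rfl

lemma cons_sum (b : ℕ) (hb : 0 < b) (T : Nec) :
    (cons b hb T).beads.sum = b + T.beads.sum := rfl

lemma mem_joints_cons {b : ℕ} {hb : 0 < b} {T : Nec} {i : ℕ} :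
    i ∈ joints (cons b hb T).beads ↔ i = 0 ∨ ∃ j ∈ joints T.beads, b + j = i := by
  simp [joints]

lemma mem_joints_bead {n : ℕ} {hn : 0 < n} {i : ℕ} :
    i ∈ joints (bead n hn).beads ↔ i = 0 ∨ i = n := by
  simp [joints]

lemma exists_joint_zero {T U : Nec} (f : T ⟶ U) : ∃ t ∈ joints T.beads, f.map.app t = 0 :=
  ⟨0, zero_mem_joints _, f.map.app_zero⟩

lemma exists_joint_last {T : Nec} {n : ℕ} {hn : 0 < n} (f : T ⟶ bead n hn) :
    ∃ t ∈ joints T.beads, f.map.app t = n :=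
  f.joints_subset (mem_joints_bead.2 (Or.inr rfl))

/-- The map `Δ^b ∨ T → Δ^b ∨ U` induced by `f : T → U`. -/
def consMap (b : ℕ) (hb : 0 < b) {T U : Nec} (f : T ⟶ U) : cons b hb T ⟶ cons b hb U where
  map := FInt.Hom.mk' (fun i => if i ≤ b then i else b + f.map.app (i - b)) (by simp)
    (by
      have := cons_sum b hb T
      have := cons_sum b hb U
      have h1 := f.map.app_of_le (i := (cons b hb T).beads.sum - b) (by omega)
      have h2 := f.map.app_of_le (i := 0)
      have h3 := f.map.app_zero
      split_ifs <;> omega)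
    (fun i j hij _ => by
      have := f.map.app_mono (show i - b ≤ j - b by omega)
      split_ifs <;> omega)
  joints_subset := fun i hi => by
    rcases mem_joints_cons.1 hi with rfl | ⟨j, hj, rfl⟩
    · exact ⟨0, zero_mem_joints _, FInt.Hom.app_zero _⟩
    · obtain ⟨s, hs, rfl⟩ := f.joints_subset hj
      have hs' := joints_le_sum _ hs
      refine ⟨b + s, mem_joints_cons.2 (Or.inr ⟨s, hs, rfl⟩), ?_⟩
      rw [FInt.Hom.mk'_app, cons_sum, min_eq_left (by omega)]
      have := f.map.app_zero
      split_ifs with h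
      · obtain rfl : s = 0 := by omega
        omega
      · rw [Nat.add_sub_cancel_left]

lemma consMap_app (b : ℕ) (hb : 0 < b) {T U : Nec} (f : T ⟶ U) {i : ℕ}
    (hi : i ≤ b + T.beads.sum) :
    (consMap b hb f).map.app i = if i ≤ b then i else b + f.map.app (i - b) := by
  rw [consMap, FInt.Hom.mk'_app, cons_sum, min_eq_left hi]

lemma consMap_add (b : ℕ) (hb : 0 < b) {T U : Nec} (f : T ⟶ U) {i : ℕ} (hi : i ≤ T.beads.sum) :
    (consMap b hb f).map.app (b + i) = b + f.map.app i := by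
  rw [consMap_app b hb f (by omega)]
  have := f.map.app_zero
  split_ifs
  · obtain rfl : i = 0 := by omega
    omega
  · rw [Nat.add_sub_cancel_left]

lemma consMap_of_le (b : ℕ) (hb : 0 < b) {T U : Nec} (f : T ⟶ U) {i : ℕ} (hi : i ≤ b) :
    (consMap b hb f).map.app i = i := by
  rw [consMap_app b hb f (by omega), if_pos hi]

lemma consMap_comp (b : ℕ) (hb : 0 < b) {T U V : Nec} (f : T ⟶ U) (g : U ⟶ V) :
    consMap b hb (f ≫ g) = consMap b hb f ≫ consMap b hb g := hom_ext fun i hi => by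
  rw [cons_sum] at hi
  rw [comp_app]
  by_cases h : i ≤ b
  · rw [consMap_of_le _ _ _ h, consMap_of_le _ _ _ h, consMap_of_le _ _ _ h]
  · obtain ⟨j, rfl⟩ : ∃ j, i = b + j := ⟨i - b, by omega⟩
    rw [consMap_add _ _ _ (by omega), consMap_add _ _ _ (by omega),
      consMap_add _ _ _ (f.map.app_le j), comp_app]

/-- The functor `Δ^b ∨ -`. -/
def consFunctor (b : ℕ) (hb : 0 < b) : Nec ⥤ Nec where
  obj := cons b hb
  map := consMap b hb
  map_id T := hom_ext fun i hi => by
    rw [id_app _ hi]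
    rw [cons_sum] at hi
    rw [consMap_app _ _ _ hi]
    split_ifs with h
    · rfl
    · rw [id_app _ (by omega)]; omega
  map_comp := consMap_comp b hb

/-- The inclusion `Δ^i ∨ Δ^m → Δ^n` for `n = i + m`. -/
def wedge {i m n : ℕ} (hi : 0 < i) (hm : 0 < m) (h : i + m = n) :
    cons i hi (bead m hm) ⟶ bead n (by omega) :=
  ⟨FInt.Hom.cast h, fun v hv => by
    rcases mem_joints_bead.1 hv with rfl | rfl
    · exact ⟨0, zero_mem_joints _, rfl⟩
    · refine ⟨v, mem_joints_cons.2 (Or.inr ⟨m, mem_joints_bead.2 (Or.inr rfl), h⟩), ?_⟩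
      exact (FInt.Hom.app_of_le _ h.le)⟩

lemma wedge_app {i m n : ℕ} (hi : 0 < i) (hm : 0 < m) (h : i + m = n) {x : ℕ} (hx : x ≤ n) :
    (wedge hi hm h).map.app x = x := by
  subst h
  exact min_eq_left hx

lemma wedge_inj {i m n : ℕ} (hi : 0 < i) (hm : 0 < m) (h : i + m = n) : Inj (wedge hi hm h) := by
  intro x y hx hy e
  subst h
  change x ≤ i + m at hx
  change y ≤ i + m at hy
  rwa [wedge_app hi hm _ hx, wedge_app hi hm _ hy] at e

instance {i m n : ℕ} (hi : 0 < i) (hm : 0 < m) (h : i + m = n) : Mono (wedge hi hm h) :=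
  (wedge_inj hi hm h).mono

/-- The wedge inclusion is the identity on vertices and only adds the joint i, so the factorization
imposes a condition on joints alone. -/
lemma exists_comp_wedge_iff {i m n : ℕ} (hi : 0 < i) (hm : 0 < m) (h : i + m = n) {T : Nec}
    (f : T ⟶ bead n (by omega)) :
    (∃ a, a ≫ wedge hi hm h = f) ↔ ∃ t ∈ joints T.beads, f.map.app t = i := by
  have hw {x : ℕ} (hx : x ≤ n) := wedge_app hi hm h hx
  constructor
  · rintro ⟨a, rfl⟩
    obtain ⟨t, ht, e⟩ := a.joints_subset
      (mem_joints_cons.2 (Or.inr ⟨0, zero_mem_joints _, rfl⟩) : i ∈ _)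
    refine ⟨t, ht, ?_⟩
    rw [comp_app, e, hw (by omega)]
  · rintro ⟨t, ht, e⟩
    refine exists_factorization f (wedge_inj hi hm h) (fun x _ => ?_) (fun v hv => ?_)
    · have h1 := f.map.app_le x
      change _ ≤ n at h1
      exact ⟨f.map.app x, h1.trans h.ge, hw h1⟩
    · rcases mem_joints_cons.1 hv with rfl | ⟨j, hj, rfl⟩
      · obtain ⟨s, hs, e⟩ := exists_joint_zero f
        exact ⟨s, hs, e.trans (hw (by omega)).symm⟩
      · rcases mem_joints_bead.1 hj with rfl | rfl
        · exact ⟨t, ht, e.trans (hw (by omega)).symm⟩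
        · obtain ⟨s, hs, e⟩ := exists_joint_last f
          exact ⟨s, hs, e.trans ((hw h.le).trans h).symm⟩

/-- The inner face `Δ^m → Δ^n`, for `n = m + 1`, which omits the vertex `i`. -/
def face {m n : ℕ} (hm : 0 < m) (h : m + 1 = n) {i : ℕ} (hi : 0 < i) (hin : i < n) :
    bead m hm ⟶ bead n (by omega) :=
  ⟨FInt.Hom.mk' (m := m) (n := n) (fun x => if x < i then x else x + 1) (by simp [hi])
    (by split_ifs <;> omega) (fun x y hxy _ => by split_ifs <;> omega), fun v hv => by
    rcases mem_joints_bead.1 hv with rfl | rfl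
    · exact ⟨0, zero_mem_joints _, FInt.Hom.app_zero _⟩
    · exact ⟨m, mem_joints_bead.2 (Or.inr rfl), FInt.Hom.app_of_le _ le_rfl⟩⟩

lemma face_app {m n : ℕ} (hm : 0 < m) (h : m + 1 = n) {i : ℕ} (hi : 0 < i) (hin : i < n) {x : ℕ}
    (hx : x ≤ m) : (face hm h hi hin).map.app x = if x < i then x else x + 1 := by
  refine (FInt.Hom.mk'_app _ _ _ _ x).trans ?_
  have : min x [m].sum = x := min_eq_left hx
  rw [min_eq_left hx]

lemma face_inj {m n : ℕ} (hm : 0 < m) (h : m + 1 = n) {i : ℕ} (hi : 0 < i) (hin : i < n) :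
    Inj (face hm h hi hin) := by
  intro x y hx hy e
  rw [face_app hm h hi hin hx, face_app hm h hi hin hy] at e
  split_ifs at e <;> omega

instance {m n : ℕ} (hm : 0 < m) (h : m + 1 = n) {i : ℕ} (hi : 0 < i) (hin : i < n) :
    Mono (face hm h hi hin) :=
  (face_inj hm h hi hin).mono

lemma exists_face_app {m n : ℕ} (hm : 0 < m) (h : m + 1 = n) {i : ℕ} (hi : 0 < i) (hin : i < n)
    {y : ℕ} (hy : y ≤ n) (hyi : y ≠ i) : ∃ x ≤ m, (face hm h hi hin).map.app x = y := by
  refine ⟨if y < i then y else y - 1, by split_ifs <;> omega, ?_⟩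
  rw [face_app hm h hi hin (by split_ifs <;> omega)]
  split_ifs <;> omega

/-- A single bead has only its endpoints as joints, and these are always hit by joints; only the
condition on vertices remains. -/
lemma exists_comp_face_iff {m n : ℕ} (hm : 0 < m) (h : m + 1 = n) {i : ℕ} (hi : 0 < i)
    (hin : i < n) {T : Nec} (f : T ⟶ bead n (by omega)) :
    (∃ a, a ≫ face hm h hi hin = f) ↔ ∀ x ≤ T.beads.sum, f.map.app x ≠ i := by
  constructor
  · rintro ⟨a, rfl⟩ x hx
    rw [comp_app, face_app hm h hi hin (a.map.app_le x)]
    split_ifs <;> omega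
  · intro hf
    refine exists_factorization f (face_inj hm h hi hin) (fun x hx => ?_) (fun v hv => ?_)
    · exact exists_face_app hm h hi hin (f.map.app_le x) (hf x hx)
    · rcases mem_joints_bead.1 hv with rfl | rfl
      · obtain ⟨s, hs, e⟩ := exists_joint_zero f
        exact ⟨s, hs, e.trans (FInt.Hom.app_zero _).symm⟩
      · obtain ⟨s, hs, e⟩ := exists_joint_last f
        exact ⟨s, hs, e.trans (FInt.Hom.app_of_le (face hm h hi hin).map le_rfl).symm⟩

/-- The sieve on `Δ^n` generated by the maps `Δ^i ∨ Δ^{n - i} → Δ^n` and by the faces which omit a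
vertex in `A`. -/
abbrev hornSieve (n : ℕ) (hn : 0 < n) (A : Set ℕ) : Sieve (bead n hn) :=
  sieve (bead n hn) (Set.Ioo 0 n) A

lemma isAdjoin_face {m n : ℕ} (hm : 0 < m) (h : m + 1 = n) {i : ℕ} (hi : 0 < i) (hin : i < n)
    (A : Set ℕ) : IsAdjoin (hornSieve n (by omega) A) (hornSieve n (by omega) (insert i A))
      (face hm h hi hin) := by
  intro T f
  rw [exists_comp_face_iff, sieve_apply, sieve_apply, Set.exists_mem_insert, or_assoc]
  exact or_congr_right or_comm

/-- The sieve restricts to the face as the sieve for the preimage of A. A remaining interior vertex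
j outside A and different from i lies on the face, which keeps this preimage a proper subset; `hiA`
puts all of A in the image of the face. -/
lemma hornSieve_pullback_face {m n : ℕ} (hm : 0 < m) (h : m + 1 = n) {i : ℕ} (hi : 0 < i)
    (hin : i < n) {A : Set ℕ} (hA : insert i A ⊂ Set.Ioo 0 n) (hiA : i ∉ A) :
    ∃ A' ⊂ Set.Ioo 0 m,
      (hornSieve n (by omega) A).pullback (face hm h hi hin) = hornSieve m hm A' := by
  obtain ⟨hA, j, hj, hjA⟩ := Set.ssubset_iff_exists.1 hA
  rw [Set.mem_insert_iff, not_or] at hjA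
  have key {x : ℕ} (hx : x ≤ m) :
      x ∈ Set.Ioo 0 m ↔ (face hm h hi hin).map.app x ∈ Set.Ioo 0 n := by
    rw [face_app hm h hi hin hx, Set.mem_Ioo, Set.mem_Ioo]
    split_ifs <;> omega
  refine ⟨{x ∈ Set.Ioo 0 m | (face hm h hi hin).map.app x ∈ A}, ?_, ?_⟩
  · refine Set.ssubset_iff_exists.2 ⟨fun x hx => hx.1, ?_⟩
    obtain ⟨x, hx, rfl⟩ := exists_face_app hm h hi hin hj.2.le hjA.1
    exact ⟨x, (key hx).2 hj, fun hx => hjA.2 hx.2⟩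
  · refine sieve_pullback (face_inj hm h hi hin) (fun x hx => key hx) (fun a ha => ?_)
      fun x hx => ⟨hx.1.2.le, hx.2⟩
    obtain ⟨ha0, han⟩ := hA (Set.mem_insert_of_mem _ ha)
    obtain ⟨x, hx, rfl⟩ := exists_face_app hm h hi hin han.le fun e => hiA (e ▸ ha)
    exact ⟨x, ⟨(key hx).2 ⟨ha0, han⟩, ha⟩, rfl⟩

/-- Wedges are added in order of decreasing i: the joints allowed so far lie strictly to the right
of i. -/
lemma isAdjoin_wedge {i m n : ℕ} (hi : 0 < i) (hm : 0 < m) (h : i + m = n) :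
    IsAdjoin (sieve (bead n (by omega)) (Set.Ioo i n) ∅) (sieve (bead n (by omega)) (Set.Ico i n) ∅)
      (wedge hi hm h) := by
  intro T f
  rw [exists_comp_wedge_iff, sieve_apply, sieve_apply, ← Set.Ioo_insert_left (by omega : i < n)]
  simp only [Set.mem_empty_iff_false, false_and, exists_false, or_false, ← exists_or, ← and_or_left,
    Set.mem_insert_iff]
  simp only [or_comm]

/-- Because of the order of adding the wedges, the overlap with the earlier ones only involves
joints interior to the second bead; this is what makes the reduction to `Δ^m` in `fillable_cons`
possible. -/
lemma sieve_pullback_wedge {i m n : ℕ} (hi : 0 < i) (hm : 0 < m) (h : i + m = n) :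
    (sieve (bead n (by omega)) (Set.Ioo i n) ∅).pullback (wedge hi hm h) =
      sieve (cons i hi (bead m hm)) (Set.Ioo i (i + m)) ∅ :=
  sieve_pullback (wedge_inj hi hm h) (fun x hx => by
    change x ≤ i + m at hx
    rw [wedge_app hi hm h (by omega), h]) (by simp) (by simp)

/-- The sieves `hornSieve` are built by successively adding maps `Δ^i ∨ Δ^m → Δ^n` and faces. -/
lemma hornSieve_induction {n : ℕ} (hn : 0 < n) {motive : Sieve (bead n hn) → Prop}
    (bot : motive ⊥)
    (wedge : ∀ {i m : ℕ} (hi : 0 < i) (hm : 0 < m) (h : i + m = n) {S S' : Sieve (bead n hn)},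
      IsAdjoin S S' (wedge hi hm h) → S.pullback (Nec.wedge hi hm h) =
        sieve (cons i hi (bead m hm)) (Set.Ioo i (i + m)) ∅ → motive S → motive S')
    (face : ∀ {i m : ℕ} (hm : 0 < m) (h : m + 1 = n) (hi : 0 < i) (hin : i < n)
      {S S' : Sieve (bead n hn)} {A : Set ℕ}, IsAdjoin S S' (face hm h hi hin) →
        A ⊂ Set.Ioo 0 m → S.pullback (Nec.face hm h hi hin) = hornSieve m hm A → motive S →
          motive S')
    {A : Set ℕ} (hA : A ⊂ Set.Ioo 0 n) : motive (hornSieve n hn A) := by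
  -- Descending induction on i, with m = n - i: at m = 0 no joint is allowed and the sieve is empty,
  -- and at i = 1 all interior joints are allowed.
  have hw : ∀ m i, 0 < i → i + m = n → motive (sieve (bead n hn) (Set.Ico i n) ∅) := by
    intro m
    induction m with
    | zero =>
      intro i _ h
      rw [Set.Ico_eq_empty (by omega), sieve_empty]
      exact bot
    | succ m ih =>
      intro i hi h
      have h1 := ih (i + 1) (by omega) (by omega)
      have h2 : Set.Ico (i + 1) n = Set.Ioo i n := by
        ext x; simp only [Set.mem_Ico, Set.mem_Ioo]; omega
      rw [h2] at h1
      exact wedge hi (by omega) h (isAdjoin_wedge hi _ h) (sieve_pullback_wedge hi _ h) h1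
  have h0 : motive (hornSieve n hn ∅) := by
    have h2 : Set.Ico 1 n = Set.Ioo 0 n := by
      ext x; simp only [Set.mem_Ico, Set.mem_Ioo]; omega
    have := hw (n - 1) 1 one_pos (by omega)
    rwa [h2] at this
  -- The faces come after all the wedges, one vertex of A at a time.
  have hfin : A.Finite := (Set.finite_Ioo 0 n).subset hA.subset
  induction A, hfin using Set.Finite.induction_on with
  | empty => exact h0
  | @insert i A hiA _ ih =>
    have hi := hA.subset (Set.mem_insert i A)
    obtain ⟨j, hj, hjA⟩ := Set.exists_of_ssubset hA
    have hji : j ≠ i := fun e => hjA (e ▸ Set.mem_insert _ _)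
    have hm : 0 < n - 1 := by
      have := hj.1; have := hj.2; have := hi.1; have := hi.2; omega
    have hmn : n - 1 + 1 = n := by omega
    obtain ⟨A', hA', e⟩ := hornSieve_pullback_face hm hmn hi.1 hi.2 hA hiA
    exact face hm hmn hi.1 hi.2 (isAdjoin_face hm hmn hi.1 hi.2 A) hA' e
      (ih ((Set.subset_insert i A).trans_ssubset hA))

lemma finitelyGenerated_hornSieve {n : ℕ} (hn : 0 < n) {A : Set ℕ} (hA : A ⊂ Set.Ioo 0 n) :
    FinitelyGenerated (hornSieve n hn A) :=
  hornSieve_induction hn finitelyGenerated_bot (fun _ _ _ _ _ h _ h' => h'.of_isAdjoin h)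
    (fun _ _ _ _ _ _ _ h _ _ h' => h'.of_isAdjoin h) hA

variable {R : Type u} [CommRing R] {Y : Necᵒᵖ ⥤ ModuleCat.{u} R}

/-- The fillability of inner horns in dimension at most `N` implies that of all sieves
`hornSieve`. -/
lemma fillable_hornSieve (N : ℕ)
    (h : ∀ n ≤ N, ∀ (hn : 0 < n), ∀ j ∈ Set.Ioo 0 n,
      Fillable Y (hornSieve n hn (Set.Ioo 0 n \ {j}))) :
    ∀ n ≤ N, ∀ (hn : 0 < n), ∀ A ⊂ Set.Ioo 0 n, Fillable Y (hornSieve n hn A) := by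
  intro n
  induction n with
  | zero => omega
  | succ m ih =>
    intro hN hn A hA
    -- Inner induction on the number of interior vertices outside A. If it is one, the sieve is an
    -- inner horn.
    obtain ⟨c, hc⟩ : ∃ c, (Set.Ioo 0 (m + 1) \ A).ncard = c := ⟨_, rfl⟩
    induction c using Nat.strong_induction_on generalizing A with
    | _ c ihc =>
    obtain ⟨j, hj, hjA⟩ := Set.exists_of_ssubset hA
    by_cases hA' : insert j A = Set.Ioo 0 (m + 1)
    · have : A = Set.Ioo 0 (m + 1) \ {j} := by
        rw [← hA', Set.insert_sdiff_self_of_notMem hjA]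
      rw [this]
      exact h _ hN hn j hj
    -- Otherwise the face opposite to j is added: on the face, the family is filled by induction on
    -- the dimension, and the enlarged sieve has fewer interior vertices left.
    · have hA'' : insert j A ⊂ Set.Ioo 0 (m + 1) :=
        (Set.insert_subset hj hA.subset).ssubset_of_ne hA'
      have hm : 0 < m := by
        have := hj.1; have := hj.2; omega
      obtain ⟨B, hB, e⟩ := hornSieve_pullback_face hm rfl hj.1 hj.2 hA'' hjA
      refine Fillable.of_isAdjoin (isAdjoin_face hm rfl hj.1 hj.2 A) ?_ ?_
      · refine ihc _ ?_ _ hA'' rfl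
        rw [← hc]
        refine Set.ncard_lt_ncard ?_ ((Set.finite_Ioo 0 (m + 1)).subset Set.sdiff_subset)
        refine Set.ssubset_iff_exists.2 ⟨Set.sdiff_subset_sdiff_right (Set.subset_insert _ _), j,
          ⟨hj, hjA⟩, fun hx => hx.2 (Set.mem_insert _ _)⟩
      · rw [e]
        exact ih (by omega) hm B hB

/-- A map into `Δ^i ∨ Δ^m` with a joint strictly inside the second bead factors through `Δ^i ∨ Δ^x ∨
Δ^{m-x}` for some x. The family is therefore determined by its values on maps `Δ^i ∨ f`, which form
a family for the functor `Y(Δ^i ∨ -)` on the sieve of maps f with an interior joint. -/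
lemma fillable_cons {i m : ℕ} (hi : 0 < i) (hm : 0 < m)
    (h : Fillable ((consFunctor i hi).op ⋙ Y) (hornSieve m hm ∅)) :
    Fillable Y (sieve (cons i hi (bead m hm)) (Set.Ioo i (i + m)) ∅) := by
  intro σ
  have key {T : Nec} (f : T ⟶ bead m hm) (hf : hornSieve m hm ∅ f) :
      sieve (cons i hi (bead m hm)) (Set.Ioo i (i + m)) ∅ (consMap i hi f) := by
    rw [sieve_apply] at hf
    obtain ⟨t, ht, h0, h1⟩ := hf.resolve_right (by simp)
    refine Or.inl ⟨i + t, (mem_joints_cons (hb := hi)).2 (Or.inr ⟨t, ht, rfl⟩), ?_⟩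
    rw [consMap_add _ _ _ (joints_le_sum _ ht)]
    exact ⟨by omega, by omega⟩
  obtain ⟨y, hy⟩ : ∃ y : Y.obj (op (cons i hi (bead m hm))), ∀ {T : Nec} (f : T ⟶ bead m hm)
      (hf : hornSieve m hm ∅ f), Y.map (consMap i hi f).op y = σ.val (consMap i hi f) (key f hf) := h
    { val := fun f hf => σ.val (consMap i hi f) (key f hf)
      map_val := fun g f hf => by
        refine (σ.map_val (consMap i hi g) _ _).trans ?_
        exact σ.val_congr (consMap_comp i hi g f).symm _ }
  refine ⟨y, fun {T} f hf => ?_⟩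
  obtain ⟨t, ht, h0, h1⟩ := ((sieve_apply f).1 hf).resolve_right (by simp)
  -- The joint t of T over the second bead determines where `Δ^m` is cut.
  obtain ⟨x, hx⟩ : ∃ x, f.map.app t = i + x := ⟨f.map.app t - i, by omega⟩
  have hx0 : 0 < x := by omega
  have hxm : 0 < m - x := by omega
  have hxm' : x + (m - x) = m := by omega
  let w := wedge hx0 hxm hxm'
  have hw : ∀ z ≤ i + m, (consMap i hi w).map.app z = z := fun z hz => by
    rw [consMap_app _ _ _ (by rw [cons_sum, bead_sum, hxm']; exact hz)]
    split_ifs with h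
    · rfl
    · rw [wedge_app hx0 hxm hxm' (by omega)]; omega
  obtain ⟨a, rfl⟩ : ∃ a, a ≫ consMap i hi w = f := by
    have hs : (cons i hi (cons x hx0 (bead (m - x) hxm))).beads.sum = i + m := by
      rw [cons_sum, cons_sum, bead_sum, hxm']
    refine exists_factorization f (fun p q hp hq e => ?_) (fun p _ => ?_) fun v hv => ?_
    · change p ≤ (cons i hi (cons x hx0 (bead (m - x) hxm))).beads.sum at hp
      change q ≤ (cons i hi (cons x hx0 (bead (m - x) hxm))).beads.sum at hq
      rwa [hw p (by omega), hw q (by omega)] at e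
    · exact ⟨f.map.app p, hs.ge.trans' (f.map.app_le p), hw _ (f.map.app_le p)⟩
    -- The cut introduces the single new joint i + x, which is hit by t; the others are hit because
    -- f is a map of necklaces.
    · have hv' : v ∈ joints (cons i hi (bead m hm)).beads ∨ v = i + x := by
        rcases (mem_joints_cons (hb := hi) (T := cons x hx0 (bead (m - x) hxm))).1 hv with
          rfl | ⟨j, hj, rfl⟩
        · exact Or.inl (zero_mem_joints _)
        · rcases (mem_joints_cons (hb := hx0) (T := bead (m - x) hxm)).1 hj with
            rfl | ⟨l, hl, rfl⟩
          · exact Or.inl ((mem_joints_cons (hb := hi)).2 (Or.inr ⟨0, zero_mem_joints _, rfl⟩))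
          · rcases mem_joints_bead.1 hl with rfl | rfl
            · exact Or.inr rfl
            · exact Or.inl (mem_joints_cons.2 (Or.inr ⟨m, mem_joints_bead.2 (Or.inr rfl), by
                rw [hxm']⟩))
      rcases hv' with hv' | rfl
      · rw [hw v (joints_le_sum _ hv')]
        exact f.joints_subset hv'
      · exact ⟨t, ht, by rw [hw _ (by omega), hx]⟩
  have hwS : hornSieve m hm ∅ w := Or.inl ⟨x, mem_joints_cons.2 (Or.inr ⟨0, zero_mem_joints _, rfl⟩), by
    rw [wedge_app hx0 hxm hxm' (by omega)]; exact ⟨by omega, by omega⟩⟩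
  rw [← σ.map_val a _ (key w hwS), op_comp, Functor.map_comp_apply]
  exact congrArg _ (hy w hwS)

end Nec

/-! ### The necklace functor on maps that fix a first bead -/

section Cons

universe v w

variable {C : Type w} [Category.{v} C] [MonoidalCategory C] (F : FIntᵒᵖ ⥤ C) [F.OplaxMonoidal]
  [IsIso (Functor.OplaxMonoidal.η F)]

/-- The map is the identity on the first bead, so splitting this bead off at its end is trivial by
`cutFirst_self'`, and what remains is the action of f. -/
lemma necFunctor_map_consMap (b : ℕ) (hb : 0 < b) {T U : Nec} (f : T ⟶ U) :
    (necFunctor F).map (Nec.consMap b hb f).op = level F b ◁ (necFunctor F).map f.op := by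
  have hid : ∀ i, i ≤ b → (FInt.Hom.id b).app i = i := fun i hi => by
    rw [FInt.Hom.id_app, min_eq_left hi]
  have he : cutBead b (b :: U.beads) = U.beads := by simp [cutBead, consBead]
  have h0 : (Nec.consMap b hb f).map.app b = b := Nec.consMap_of_le b hb f le_rfl
  refine (beadMap_cons F (Nec.cons b hb U).pos (Nec.consMap b hb f).map
    (Nec.consMap b hb f).joints_subset U.pos f.map f.joints_subset h0 le_rfl he (FInt.Hom.id b)
    (fun i hi => by rw [hid i hi, Nec.consMap_of_le b hb f hi])
    (fun i hi => (Nec.consMap_add b hb f hi).symm)).trans ?_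
  rw [levelMap_id F _ hid, id_tensorHom]
  have := splitTo_cons F (show b = b + 0 from rfl) U.beads le_rfl he
  rw [cutFirst_self'] at this
  exact (congrArg (· ≫ level F b ◁ (necFunctor F).map f.op) this).trans (Category.id_comp _)

end Cons

/-! ### Exactness and flatness for tensor products of quivers -/

namespace ModQuiver

variable {R : Type u} [CommRing R] {S : Type u}

/-- A map of quivers, tensored with a quiver, as a map of direct sums. -/
lemma whiskerRight_app_eq_lmap {P Q : ModQuiver R S} (f : P ⟶ Q) (B : ModQuiver R S) (a t : S) :
    Hom.app (f ▷ B) a t =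
      DirectSum.lmap fun c => LinearMap.rTensor (B.hom c t) (Hom.app f a c) := by
  classical
  refine tensor_linearMap_ext fun c p q => (whiskerRight_tmul f B c p q).trans ?_
  symm
  change DirectSum.lmap _ (DirectSum.lof R S (fun c => P.hom a c ⊗[R] B.hom c t) c (p ⊗ₜ q)) =
    DirectSum.lof R S (fun c => Q.hom a c ⊗[R] B.hom c t) c (Hom.app f a c p ⊗ₜ q)
  exact DirectSum.lmap_lof (fun c => LinearMap.rTensor (B.hom c t) (Hom.app f a c)) c
    (p ⊗ₜ[R] q : P.hom a c ⊗[R] B.hom c t)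

/-- Flatness is applied to each summand of the direct sum over the middle vertex. -/
lemma whiskerRight_injective {P Q : ModQuiver R S} {f : P ⟶ Q} (B : ModQuiver R S) (a t : S)
    (hf : ∀ c, Function.Injective (Hom.app f a c)) (hB : ∀ c, Module.Flat R (B.hom c t)) :
    Function.Injective (Hom.app (f ▷ B) a t) := by
  rw [whiskerRight_app_eq_lmap]
  exact (DirectSum.lmap_injective _).2 fun c =>
    Module.Flat.rTensor_preserves_injective_linearMap _ (hf c)

lemma whiskerRight_surjective {P Q : ModQuiver R S} {f : P ⟶ Q} (B : ModQuiver R S) (a t : S)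
    (hf : ∀ c, Function.Surjective (Hom.app f a c)) :
    Function.Surjective (Hom.app (f ▷ B) a t) := by
  rw [whiskerRight_app_eq_lmap]
  exact (DirectSum.lmap_surjective _).2 fun c => LinearMap.rTensor_surjective _ (hf c)

/-- Right exactness of the tensor product in each summand; no flatness is involved at this place. -/
lemma whiskerRight_exact {P Q T : ModQuiver R S} {f : P ⟶ Q} {g : Q ⟶ T} (B : ModQuiver R S)
    (a t : S) (hfg : ∀ c, Function.Exact (Hom.app f a c) (Hom.app g a c))
    (hg : ∀ c, Function.Surjective (Hom.app g a c)) :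
    Function.Exact (Hom.app (f ▷ B) a t) (Hom.app (g ▷ B) a t) := by
  rw [whiskerRight_app_eq_lmap, whiskerRight_app_eq_lmap]
  have h (c : S) := LinearMap.exact_iff.1 (rTensor_exact (B.hom c t) (hfg c) (hg c))
  refine (LinearMap.exact_iff (f := DirectSum.lmap fun c =>
    LinearMap.rTensor (B.hom c t) (Hom.app f a c)) (g := DirectSum.lmap fun c =>
    LinearMap.rTensor (B.hom c t) (Hom.app g a c))).2 ?_
  refine (DirectSum.ker_lmap _).trans (Eq.trans ?_ (DirectSum.range_lmap _).symm)
  simp only [h]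

lemma flat_tensor {P Q : ModQuiver R S} {a t : S} (hP : ∀ c, Module.Flat R (P.hom a c))
    (hQ : ∀ c, Module.Flat R (Q.hom c t)) : Module.Flat R ((P ⊗ Q).hom a t) := by
  change Module.Flat R (⨁ c : S, P.hom a c ⊗[R] Q.hom c t)
  infer_instance

lemma flat_unit (a t : S) : Module.Flat R ((𝟙_ (ModQuiver R S)).hom a t) := by
  change Module.Flat R (PLift (a = t) →₀ R)
  infer_instance

end ModQuiver

/-! ### The functors `P ⊗ X_•` with coefficients in a quiver -/

namespace Templicial

open ModQuiver

variable {R : Type u} [CommRing R] {S : Type u} (X : Templicial R S)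

/-- The functor `(P ⊗ X_•)(a, t)`. -/
noncomputable def twistedNec (P : ModQuiver R S) (a t : S) : Necᵒᵖ ⥤ ModuleCat.{u} R :=
  necFunctor X.toFunctor ⋙ tensorLeft P ⋙ ModQuiver.eval a t

/-- The functoriality of `twistedNec` in the quiver. -/
noncomputable def twistedNecMap {P Q : ModQuiver R S} (f : P ⟶ Q) (a t : S) :
    X.twistedNec P a t ⟶ X.twistedNec Q a t where
  app T := ModuleCat.ofHom (Hom.app (f ▷ (necFunctor X.toFunctor).obj T) a t)
  naturality T U g := by
    have h := whisker_exchange f ((necFunctor X.toFunctor).map g)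
    exact congrArg (ModQuiver.eval a t).map h

variable {X}

lemma LevelwiseFlat.flat (hX : X.LevelwiseFlat) (T : Necᵒᵖ) (a b : S) :
    Module.Flat R (((necFunctor X.toFunctor).obj T).hom a b) := by
  change Module.Flat R ((beadObj X.toFunctor T.unop.beads).hom a b)
  generalize T.unop.beads = l
  induction l generalizing a with
  | nil => exact flat_unit a b
  | cons n l ih => exact flat_tensor (fun c => hX n a c) ih

/-- All modules `X_T(c, t)` are flat, so tensoring preserves short exact sequences of coefficient
quivers. This is where levelwise flatness enters the proof. -/
lemma LevelwiseFlat.pointwiseExact (hX : X.LevelwiseFlat) {P Q T : ModQuiver R S} {f : P ⟶ Q}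
    {g : Q ⟶ T} (a t : S) (hf : ∀ c, Function.Injective (Hom.app f a c))
    (hfg : ∀ c, Function.Exact (Hom.app f a c) (Hom.app g a c))
    (hg : ∀ c, Function.Surjective (Hom.app g a c)) :
    PointwiseExact (X.twistedNecMap f a t) (X.twistedNecMap g a t) where
  injective T := whiskerRight_injective _ a t hf fun c => hX.flat T c t
  exact _ := whiskerRight_exact _ a t hfg hg
  surjective _ := whiskerRight_surjective _ a t hg

/-- Since `X_{Δ^i ∨ T} = X_i ⊗ X_T`, the associator identifies `P ⊗ X_{Δ^i ∨ T}` with `(P ⊗ X_i) ⊗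
X_T`: a first bead can be absorbed into the coefficients. -/
lemma fillable_consFunctor {P : ModQuiver R S} {a t : S} {i : ℕ} (hi : 0 < i) {V : Nec}
    {A : Sieve V} (h : Fillable (X.twistedNec (P ⊗ X.simplices i) a t) A) :
    Fillable ((Nec.consFunctor i hi).op ⋙ X.twistedNec P a t) A := by
  let e (T : Nec) := α_ P (X.simplices i) ((necFunctor X.toFunctor).obj (op T))
  refine h.of_bijective (fun T => Hom.app (e T).hom a t) (fun {T U} g y => ?_) fun T => ?_
  · have h1 : P ◁ (necFunctor X.toFunctor).map (Nec.consMap i hi g).op =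
        P ◁ (X.simplices i) ◁ (necFunctor X.toFunctor).map g.op :=
      congrArg (P ◁ ·) (necFunctor_map_consMap X.toFunctor i hi g)
    have h2 : (P ⊗ X.simplices i) ◁ (necFunctor X.toFunctor).map g.op ≫ (e U).hom =
        (e T).hom ≫ P ◁ (necFunctor X.toFunctor).map (Nec.consMap i hi g).op := by
      exact (associator_naturality_right P (X.simplices i)
        ((necFunctor X.toFunctor).map g.op)).trans (congrArg ((e T).hom ≫ ·) h1.symm)
    exact LinearMap.congr_fun (congrArg (fun f => Hom.app f a t) h2) y
  · refine Function.bijective_iff_has_inverse.2 ⟨Hom.app (e T).inv a t, fun x => ?_, fun x => ?_⟩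
    · exact LinearMap.congr_fun (congrArg (fun f => Hom.app f a t) (e T).hom_inv_id) x
    · exact LinearMap.congr_fun (congrArg (fun f => Hom.app f a t) (e T).inv_hom_id) x

lemma fillable_twistedNec_unit {a t : S} {V : Nec} {A : Sieve V}
    (h : Fillable (X.twistedNec (𝟙_ _) a t) A) : Fillable (X.nec a t) A := by
  let e (T : Nec) := λ_ ((necFunctor X.toFunctor).obj (op T))
  refine h.of_bijective (fun T => Hom.app (e T).hom a t) (fun {T U} g y => ?_) fun T => ?_
  · exact LinearMap.congr_fun (congrArg (fun f => Hom.app f a t)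
      (leftUnitor_naturality ((necFunctor X.toFunctor).map g.op))) y
  · refine Function.bijective_iff_has_inverse.2 ⟨Hom.app (e T).inv a t, fun x => ?_, fun x => ?_⟩
    · exact LinearMap.congr_fun (congrArg (fun f => Hom.app f a t) (e T).hom_inv_id) x
    · exact LinearMap.congr_fun (congrArg (fun f => Hom.app f a t) (e T).inv_hom_id) x

end Templicial

/-! ### Necklaces in K as a basis of `F̃(K)_T` -/

namespace FreeTemplicial

open ModQuiver
open FInt hiding comp_app id_app

/-- Necklaces in a simplicial set: chains of simplices of the given dimensions. -/
inductive Chain (K : SSet.{u}) : List ℕ → Vert K → Vert K → Type u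
  | nil {s t : Vert K} (e : s = t) : Chain K [] s t
  | cons {n : ℕ} {l : List ℕ} {s t : Vert K} (c : Vert K) (x : Simp K ⟨n⟩) (hs : src x = s)
      (hc : tgt x = c) (y : Chain K l c t) : Chain K (n :: l) s t

variable (k : Type u) [CommRing k] {K L : SSet.{u}}

/-- The basis element of `F̃(K)_T` given by a necklace in `K`. -/
noncomputable def elt : ∀ {l : List ℕ} {s t : Vert K}, Chain K l s t →
    (beadObj (functor k K) l).hom s t
  | _, s, _, .nil e => e ▸ unitElt k s
  | _, _, _, .cons (n := n) (l := l) c x hs hc y =>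
      tmul (quiver k K ⟨n⟩) (beadObj (functor k K) l) c (gen k x hs hc) (elt y)

lemma elt_cons {n : ℕ} {l : List ℕ} {s t : Vert K} (c : Vert K) (x : Simp K ⟨n⟩) (hs : src x = s)
    (hc : tgt x = c) (y : Chain K l c t) : elt k (.cons c x hs hc y) =
      tmul (quiver k K ⟨n⟩) (beadObj (functor k K) l) c (gen k x hs hc) (elt k y) := rfl

variable {k}

/-- Linear maps out of `F̃(K)_T(s, t)`. -/
noncomputable def chainLift {M : Type u} [AddCommGroup M] [Module k M] :
    ∀ {l : List ℕ} {s t : Vert K}, (Chain K l s t → M) →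
      (beadObj (functor k K) l).hom s t →ₗ[k] M
  | [], _, _, φ => unitElim fun e => φ (.nil e)
  | n :: l, _, _, φ => tensorLift (P := quiver k K ⟨n⟩) (Q := beadObj (functor k K) l) fun c =>
      genLift fun x hs hc => chainLift fun y => φ (.cons c x hs hc y)

lemma chainLift_elt {M : Type u} [AddCommGroup M] [Module k M] {l : List ℕ} {s t : Vert K}
    (φ : Chain K l s t → M) (x : Chain K l s t) : chainLift φ (elt k x) = φ x := by
  induction x with
  | nil e =>
    subst e
    exact unitElim_unitElt _
  | cons c x hs hc y ih =>
    rw [elt_cons, chainLift]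
    refine (tensorLift_tmul _ _ _ _).trans ?_
    rw [genLift_gen, ih]

/-- With `chainLift_elt`, this says that the chains form a basis: linear maps out of `F̃(K)_T(s, t)`
are arbitrary functions on chains. -/
lemma elt_ext {M : Type u} [AddCommGroup M] [Module k M] {l : List ℕ} {s t : Vert K}
    {f g : (beadObj (functor k K) l).hom s t →ₗ[k] M} (h : ∀ x, f (elt k x) = g (elt k x)) :
    f = g := by
  induction l generalizing s with
  | nil =>
    refine unit_linearMap_ext fun e => ?_
    have := h (.nil e)
    subst e
    exact this
  | cons n l ih =>
    refine tensor_linearMap_ext fun c p q => ?_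
    refine LinearMap.congr_fun (f := f ∘ₗ (tmul (quiver k K ⟨n⟩) (beadObj (functor k K) l) c).flip q)
      (g := g ∘ₗ (tmul (quiver k K ⟨n⟩) (beadObj (functor k K) l) c).flip q)
      (gen_ext fun x hs hc => ?_) p
    refine LinearMap.congr_fun
      (f := f ∘ₗ tmul (quiver k K ⟨n⟩) (beadObj (functor k K) l) c (gen k x hs hc))
      (g := g ∘ₗ tmul (quiver k K ⟨n⟩) (beadObj (functor k K) l) c (gen k x hs hc))
      (ih fun y => ?_) q
    exact h (.cons c x hs hc y)

/-- The image of a necklace under a map of simplicial sets. -/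
def Chain.push (f : K ⟶ L) : ∀ {l : List ℕ} {s t : Vert K}, Chain K l s t →
    Chain L l (pushVert f s) (pushVert f t)
  | _, _, _, .nil e => .nil (congrArg _ e)
  | _, _, _, .cons c x hs hc y => .cons (pushVert f c) (FreeTemplicial.push f x)
      ((src_push f x).trans (congrArg _ hs)) ((tgt_push f x).trans (congrArg _ hc)) (y.push f)

lemma bead_elt (f : K ⟶ L) {l : List ℕ} {s t : Vert K} (x : Chain K l s t) :
    (map k f).bead l s t (elt k x) = elt k (x.push f) := by
  induction x with
  | nil e =>
    subst e
    exact HomOver.unit_unitElt _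
  | cons c x hs hc y ih =>
    refine (HomOver.tensor_tmul ((map k f).app _) ((map k f).bead _) c _ _).trans ?_
    rw [ih]
    exact congrArg (fun z => tmul _ _ (pushVert f c) z (elt k (y.push f))) (pushHom_gen k f x hs hc)

/-! ### Vertex functions of simplices and chains over `Δ[N]` -/

section Values

variable {N : ℕ} (ι : K ⟶ SSet.stdSimplex.{u}.obj (.mk N))

/-- The vertices of a simplex over `Δ[N]`. -/
def val {a : FInt} (x : Simp K a) (i : ℕ) : ℕ :=
  -- Indices beyond the last vertex are clamped to it, so that the vertices form a monotone function
  -- on `ℕ`.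
  (SSet.stdSimplex.asOrderHom (ι.app _ x) ⟨min i a.len, Nat.lt_succ_of_le (min_le_right _ _)⟩ :
    Fin (N + 1))

/-- The value of a vertex. -/
def vertVal (s : Vert K) : ℕ := (SSet.stdSimplex.asOrderHom (ι.app _ s) 0 : Fin (N + 1))

variable {ι}

lemma val_map {a b : FInt} (g : toSimplex.obj a ⟶ toSimplex.obj b) (x : Simp K b) {i j : ℕ}
    (hi : i < a.len + 1) (hj : ((g.toOrderHom ⟨i, hi⟩ : Fin (b.len + 1)) : ℕ) = j) :
    val ι (a := a) (K.map g.op x) i = val ι x j := by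
  subst hj
  rw [val, push_map ι g x, val]
  refine congrArg (fun z => ((SSet.stdSimplex.asOrderHom (ι.app _ x) z : Fin (N + 1)) : ℕ))
    (Fin.ext ?_ : (g.toOrderHom ⟨min i a.len, _⟩ : Fin (b.len + 1)) = _)
  have h1 : min i a.len = i := min_eq_left (Nat.le_of_lt_succ hi)
  have h2 := (g.toOrderHom ⟨i, hi⟩ : Fin (b.len + 1)).isLt
  have h3 : (⟨min i a.len, Nat.lt_succ_of_le (min_le_right _ _)⟩ : Fin (a.len + 1)) = ⟨i, hi⟩ :=
    Fin.ext h1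
  refine Eq.trans ?_ (min_eq_left (Nat.le_of_lt_succ h2)).symm
  exact congrArg (fun z => ((g.toOrderHom z : Fin (b.len + 1)) : ℕ)) h3

lemma val_mono {a : FInt} (x : Simp K a) {i j : ℕ} (h : i ≤ j) : val ι x i ≤ val ι x j :=
  (SSet.stdSimplex.asOrderHom (ι.app _ x)).monotone (by
    rw [Fin.mk_le_mk]; exact min_le_min_right _ h)

lemma val_le {a : FInt} (x : Simp K a) (i : ℕ) : val ι x i ≤ N :=
  Nat.le_of_lt_succ (Fin.isLt _)

lemma val_pull {a b : FInt} (f : a ⟶ b) (x : Simp K b) {i : ℕ} (hi : i ≤ a.len) :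
    val ι (pull f x) i = val ι x (Hom.app f i) :=
  val_map _ x (Nat.lt_succ_of_le hi) (toSimplex_map_val f ⟨i, Nat.lt_succ_of_le hi⟩)

lemma val_frontFace {a b : FInt} (x : Simp K (a ⊗ b)) {i : ℕ} (hi : i ≤ a.len) :
    val ι (frontFace x) i = val ι x i :=
  val_map _ x (Nat.lt_succ_of_le hi) rfl

lemma val_backFace {a b : FInt} (x : Simp K (a ⊗ b)) {i : ℕ} (hi : i ≤ b.len) :
    val ι (backFace x) i = val ι x (a.len + i) :=
  val_map _ x (Nat.lt_succ_of_le hi) rfl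

lemma vertVal_src {a : FInt} (x : Simp K a) : vertVal ι (src x) = val ι x 0 :=
  val_map (a := ⟨0⟩) (first a) x one_pos rfl

lemma vertVal_tgt {a : FInt} (x : Simp K a) : vertVal ι (tgt x) = val ι x a.len :=
  val_map (a := ⟨0⟩) (last a) x one_pos rfl

/-- A simplex of `Δ[N]` is determined by its vertices, and K embeds in `Δ[N]`. -/
lemma val_ext (hι : ∀ m, Function.Injective (ι.app m)) {a : FInt} {x y : Simp K a}
    (h : ∀ i, i ≤ a.len → val ι x i = val ι y i) : x = y := by
  refine hι _ (SSet.stdSimplex.ext (d := a.len) _ _ fun i => Fin.ext ?_)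
  have h1 := h i (Nat.le_of_lt_succ i.isLt)
  have h2 : (⟨min (i : ℕ) a.len, Nat.lt_succ_of_le (min_le_right _ _)⟩ : Fin (a.len + 1)) = i :=
    Fin.ext (min_eq_left (Nat.le_of_lt_succ i.isLt))
  have h3 (z : Simp K a) : val ι z i = (SSet.stdSimplex.asOrderHom (ι.app _ z) i : Fin (N + 1)) :=
    congrArg (fun w => ((SSet.stdSimplex.asOrderHom (ι.app _ z) w : Fin (N + 1)) : ℕ)) h2
  rw [h3, h3] at h1
  exact h1

/-- The vertices of a necklace over `Δ[N]`. -/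
def Chain.fn (ι : K ⟶ SSet.stdSimplex.{u}.obj (.mk N)) {l : List ℕ} {s t : Vert K} :
    Chain K l s t → ℕ → ℕ
  | .nil _ => fun _ => vertVal ι s
  | .cons (n := n) _ x _ _ y => fun i => if i ≤ n then val ι x i else y.fn ι (i - n)

namespace Chain

variable {l : List ℕ} {s t : Vert K}

lemma fn_cons_of_le {n : ℕ} (c : Vert K) (x : Simp K ⟨n⟩) (hs : src x = s)
    (hc : tgt x = c) (y : Chain K l c t) {i : ℕ} (hi : i ≤ n) :
    (cons c x hs hc y).fn ι i = val ι x i := if_pos hi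

lemma fn_zero (x : Chain K l s t) : x.fn ι 0 = vertVal ι s := by
  cases x with
  | nil => rfl
  | @cons n _ _ _ c x hs hc y =>
    exact (fn_cons_of_le c x hs hc y (Nat.zero_le n)).trans ((vertVal_src x).symm.trans (congrArg _ hs))

lemma fn_cons_add {n : ℕ} (c : Vert K) (x : Simp K ⟨n⟩) (hs : src x = s)
    (hc : tgt x = c) (y : Chain K l c t) (i : ℕ) :
    (cons c x hs hc y).fn ι (n + i) = y.fn ι i := by
  -- The index n belongs to the first simplex by definition; there both descriptions agree, since
  -- its last vertex is the source of the rest of the chain.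
  by_cases hi : i = 0
  · subst hi
    rw [Nat.add_zero, fn_cons_of_le c x hs hc y le_rfl, fn_zero, ← hc, vertVal_tgt]
  · exact (if_neg (by omega)).trans (congrArg _ (Nat.add_sub_cancel_left _ _))

lemma fn_sum (x : Chain K l s t) : x.fn ι l.sum = vertVal ι t := by
  induction x with
  | nil e => subst e; rfl
  | cons c x hs hc y ih => rw [List.sum_cons, fn_cons_add, ih]

lemma fn_le (x : Chain K l s t) (i : ℕ) : x.fn ι i ≤ N := by
  induction x generalizing i with
  | nil => exact Nat.le_of_lt_succ (Fin.isLt _)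
  | @cons n l s t c x hs hc y ih =>
    by_cases hi : i ≤ n
    · exact (if_pos hi).trans_le (val_le x i)
    · exact (if_neg hi).trans_le (ih _)

lemma fn_mono (x : Chain K l s t) {i j : ℕ} (h : i ≤ j) : x.fn ι i ≤ x.fn ι j := by
  induction x generalizing i j with
  | nil => exact le_rfl
  | @cons n l s t c x hs hc y ih =>
    by_cases hj : j ≤ n
    · rw [fn_cons_of_le c x hs hc y hj, fn_cons_of_le c x hs hc y (h.trans hj)]
      exact val_mono x h
    · obtain ⟨j, rfl⟩ : ∃ m, j = n + m := ⟨j - n, by omega⟩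
      rw [fn_cons_add]
      by_cases hi : i ≤ n
      · rw [fn_cons_of_le c x hs hc y hi]
        refine (val_mono x hi).trans ?_
        have := fn_cons_add (ι := ι) c x hs hc y 0
        rw [Nat.add_zero, fn_cons_of_le c x hs hc y le_rfl] at this
        rw [this]
        exact ih (Nat.zero_le _)
      · obtain ⟨i, rfl⟩ : ∃ m, i = n + m := ⟨i - n, by omega⟩
        rw [fn_cons_add]
        exact ih (by omega)

/-- Bead by bead, simplices are determined by their vertices, and the intermediate vertices of the
chain are the targets of these simplices. -/
lemma ext_fn (hι : ∀ m, Function.Injective (ι.app m)) {x y : Chain K l s t}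
    (h : ∀ i, i ≤ l.sum → x.fn ι i = y.fn ι i) : x = y := by
  induction x with
  | nil e => cases y; rfl
  | @cons n l s t c x hs hc x' ih =>
    cases y with
    | cons d y hs' hd y' =>
      have hxy : x = y := val_ext hι fun i hi => by
        have := h i (by rw [List.sum_cons]; exact Nat.le_add_right_of_le hi)
        rwa [fn_cons_of_le _ _ _ _ _ hi, fn_cons_of_le _ _ _ _ _ hi] at this
      subst hxy
      obtain rfl : c = d := hc.symm.trans hd
      obtain rfl : x' = y' := ih fun i hi => by
        have := h (n + i) (by rw [List.sum_cons]; omega)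
        rwa [fn_cons_add, fn_cons_add] at this
      rfl

lemma fn_push {L : SSet.{u}} (f : K ⟶ L) (ι' : L ⟶ SSet.stdSimplex.{u}.obj (.mk N))
    (x : Chain K l s t) (i : ℕ) :
    (x.push f).fn ι' i = x.fn (f ≫ ι') i := by
  induction x generalizing i with
  | nil => rfl
  | @cons n l s t c x hs hc y ih => exact congrArg (ite (i ≤ n) (val (f ≫ ι') x i)) (ih _)

end Chain

variable (k)

/-- A bead of dimension 0 is a vertex, which the counit removes without affecting the vertex
function; a positive bead is simply added to the chain. -/
lemma prependBead_elt {b : ℕ} {U : List ℕ} {s c t : Vert K} (x : Simp K ⟨b⟩) (hs : src x = s)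
    (hc : tgt x = c) (y : Chain K U c t) :
    ∃ z : Chain K (consBead b U) s t,
      Hom.app (prependBead (functor k K) b U) s t
        (tmul (quiver k K ⟨b⟩) (beadObj (functor k K) U) c (gen k x hs hc) (elt k y)) = elt k z ∧
      ∀ i, z.fn ι i = (Chain.cons c x hs hc y).fn ι i := by
  cases b with
  | succ b => exact ⟨.cons c x hs hc y, rfl, fun _ => rfl⟩
  | zero =>
    obtain rfl : s = c := by
      rw [← hs, ← hc]; exact (src_unit x).trans (tgt_unit x).symm
    refine ⟨y, ?_, fun i => ?_⟩
    · refine (congrArg (Hom.app (λ_ (beadObj (functor k K) U)).hom s t)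
        (whiskerRight_tmul (counit k K) (beadObj (functor k K) U) s (gen k x hs hc)
          (elt k y))).trans ?_
      rw [counit_gen]
      exact leftUnitor_hom_tmul _ _
    · have := Chain.fn_cons_add (ι := ι) s x hs hc y i
      rw [Nat.zero_add] at this
      exact this.symm

lemma levelMap_gen {m n : ℕ} (f : FInt.Hom m n) {s t : Vert K} (x : Simp K ⟨n⟩) (hs : src x = s)
    (ht : tgt x = t) :
    Hom.app (levelMap (functor k K) f) s t (gen k x hs ht) =
      gen k (pull (a := ⟨m⟩) (b := ⟨n⟩) f x) ((src_pull _ _).trans hs) ((tgt_pull _ _).trans ht) :=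
  pullHom_gen k (a := ⟨m⟩) (b := ⟨n⟩) f x hs ht

/-- The two factors are the front and the back face. The statement records only their vertices,
which is all that later computations need. -/
lemma comul_elt {u y b : ℕ} (h : u = y + b) {s t : Vert K} (x : Simp K ⟨u⟩) (hs : src x = s)
    (ht : tgt x = t) :
    ∃ (c : Vert K) (x₁ : Simp K ⟨y⟩) (h₁ : src x₁ = s) (h₁' : tgt x₁ = c) (x₂ : Simp K ⟨b⟩)
      (h₂ : src x₂ = c) (h₂' : tgt x₂ = t),
      Hom.app (_root_.comul (functor k K) h) s t (gen k x hs ht) =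
        tmul (quiver k K ⟨y⟩) (quiver k K ⟨b⟩) c (gen k x₁ h₁ h₁') (gen k x₂ h₂ h₂') ∧
      (∀ i, i ≤ y → val ι x₁ i = val ι x i) ∧ ∀ i, i ≤ b → val ι x₂ i = val ι x (y + i) := by
  let x' : Simp K ((⟨y⟩ : FInt) ⊗ ⟨b⟩) := pull (FInt.Hom.cast h.symm) x
  have hs' : src x' = s := (src_pull (b := ⟨u⟩) _ _).trans hs
  have ht' : tgt x' = t := (tgt_pull (b := ⟨u⟩) _ _).trans ht
  have hv : ∀ i, i ≤ y + b → val ι x' i = val ι x i := fun i hi => by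
    refine (val_pull (a := (⟨y⟩ : FInt) ⊗ ⟨b⟩) (b := ⟨u⟩) _ x hi).trans ?_
    exact congrArg (val ι x) (min_eq_left hi)
  refine ⟨tgt (frontFace x'), frontFace x', (src_frontFace x').trans hs', rfl, backFace x',
    src_backFace x', (tgt_backFace x').trans ht', ?_, fun i hi => ?_, fun i hi => ?_⟩
  · refine (congrArg (Hom.app (comul k K ⟨y⟩ ⟨b⟩) s t)
      (levelMap_gen k (FInt.Hom.cast h.symm) x hs ht)).trans ?_
    exact comul_gen k x' hs' ht' _ _ rfl rfl rfl
  · rw [val_frontFace x' hi, hv i (Nat.le_add_right_of_le hi)]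
  · exact (val_backFace x' hi).trans (hv (y + i) (Nat.add_le_add_left hi _))

lemma inv_counit_unitElt (s : Vert K) :
    Hom.app (inv (_root_.counit (functor k K))) s s (unitElt k s) =
      gen k (ofVert s) (src_unit _) (tgt_unit _) := by
  have h : Hom.app (_root_.counit (functor k K)) s s
      (gen k (ofVert s) (src_unit _) (tgt_unit _)) = unitElt k s := counit_gen k _ _ _
  rw [← h]
  exact LinearMap.congr_fun (congrArg (fun f => Hom.app f s s)
    (IsIso.hom_inv_id (_root_.counit (functor k K)))) _

/-- The structure maps of `F̃(K)` take basis elements to basis elements, so cutting the first bead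
yields a single pure tensor; its vertices are those of the chain before and after y. -/
lemma splitBead_elt (y : ℕ) (U : List ℕ) (h : y ≤ U.headD 0) {s t : Vert K} (x : Chain K U s t) :
    ∃ (c : Vert K) (x₁ : Simp K ⟨y⟩) (hs : src x₁ = s) (hc : tgt x₁ = c)
      (z : Chain K (cutBead y U) c t),
      Hom.app (splitBead (functor k K) y U h) s t (elt k x) =
        tmul (quiver k K ⟨y⟩) (beadObj (functor k K) (cutBead y U)) c (gen k x₁ hs hc) (elt k z) ∧
      (∀ i, i ≤ y → val ι x₁ i = x.fn ι i) ∧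
      ∀ i, i ≤ (cutBead y U).sum → z.fn ι i = x.fn ι (y + i) := by
  cases x with
  | nil e =>
    subst e
    -- With no bead to cut, the inverse of the counit creates the vertex s as a 0-simplex.
    obtain rfl : y = 0 := by simpa using h
    refine ⟨s, pull (a := ⟨0⟩) (b := ⟨0⟩) (FInt.Hom.cast rfl) (ofVert s),
      (src_pull (a := ⟨0⟩) (b := ⟨0⟩) _ _).trans (src_unit _),
      (tgt_pull (a := ⟨0⟩) (b := ⟨0⟩) _ _).trans (tgt_unit _), .nil rfl, ?_, fun i hi => ?_,
      fun i hi => rfl⟩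
    · refine (congrArg (Hom.app ((inv (_root_.counit (functor k K)) ≫
        levelMap (functor k K) (FInt.Hom.cast (Nat.le_zero.1 h))) ▷ 𝟙_ _) s s)
        (ModQuiver.leftUnitor_inv_apply (𝟙_ _) (unitElt k s))).trans ?_
      rw [whiskerRight_tmul, ModQuiver.comp_app, inv_counit_unitElt]
      exact congrArg (fun z => tmul _ (𝟙_ (ModQuiver k (Vert K))) s z (unitElt k s))
        (levelMap_gen k _ _ _ _)
    · refine (val_pull (a := ⟨0⟩) (b := ⟨0⟩) _ _ hi).trans ?_
      have := vertVal_src (ι := ι) (ofVert s)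
      rw [src_unit] at this
      rw [FInt.Hom.cast_app, Nat.min_zero]
      exact this.symm
  | @cons u U _ _ c x hs hc x' =>
    have hu : u = y + (u - y) := (Nat.add_sub_of_le h).symm
    obtain ⟨d, x₁, h₁, h₁', x₂, h₂, h₂', e, hv₁, hv₂⟩ := comul_elt (ι := ι) k hu x hs hc
    obtain ⟨z, hz, hz'⟩ := prependBead_elt (ι := ι) k x₂ h₂ h₂' x'
    refine ⟨d, x₁, h₁, h₁', z, ?_, fun i hi => ?_, fun i hi => ?_⟩
    · rw [elt_cons, splitBead]
      refine (congrArg (Hom.app ((α_ _ _ _).hom ≫ level (functor k K) y ◁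
        prependBead (functor k K) (u - y) U) s t) (whiskerRight_tmul
          (_root_.comul (functor k K) hu) (beadObj (functor k K) U) c (gen k x hs hc)
          (elt k x'))).trans ?_
      rw [e, ModQuiver.comp_app]
      refine (congrArg (Hom.app (level (functor k K) y ◁
        prependBead (functor k K) (u - y) U) s t) (associator_hom_tmul _ _ _ _ _ _ _ _)).trans ?_
      refine (whiskerLeft_tmul _ _ _ _ _).trans ?_
      exact congrArg _ hz
    · rw [hv₁ i hi, Chain.fn_cons_of_le _ _ _ _ _ (by omega)]
    · rw [hz']
      by_cases hi' : i ≤ u - y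
      · rw [Chain.fn_cons_of_le _ _ _ _ _ hi', hv₂ i hi',
          Chain.fn_cons_of_le _ _ _ _ _ (by omega)]
      · obtain ⟨j, rfl⟩ : ∃ j, i = u - y + j := ⟨i - (u - y), by omega⟩
        rw [Chain.fn_cons_add, ← Nat.add_assoc, ← hu, Chain.fn_cons_add]

/-- The action of a map of necklaces on the basis elements. -/
lemma beadMap_elt (T U : List ℕ) (hU : ∀ n ∈ U, 0 < n) (f : FInt.Hom T.sum U.sum)
    (hf : joints U ⊆ f.app '' joints T) {s t : Vert K} (x : Chain K U s t) :
    ∃ z : Chain K T s t, Hom.app (beadMap (functor k K) T U hU f hf) s t (elt k x) = elt k z ∧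
      ∀ i, i ≤ T.sum → z.fn ι i = x.fn ι (f.app i) := by
  induction T generalizing U s with
  | nil =>
    cases U with
    | cons u U => exact (false_of_nil_cons hU f).elim
    | nil => cases x; exact ⟨_, rfl, fun _ _ => rfl⟩
  | cons n T ih =>
    have hy := app_le_headD hU f hf
    obtain ⟨c, x₁, hs, hc, x', e, h₁, h₂⟩ := splitBead_elt (ι := ι) k (f.app n) U hy x
    obtain ⟨z, hz, hz'⟩ := ih _ (cutBead_pos _ hU) (f.right n rfl List.sum_cons (cutBead_sum hy))
      (joints_right hU f hf) x'
    refine ⟨.cons c (pull (a := ⟨n⟩) (b := ⟨f.app n⟩) (f.left n rfl) x₁)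
      ((src_pull (a := ⟨n⟩) (b := ⟨f.app n⟩) _ _).trans hs)
      ((tgt_pull (a := ⟨n⟩) (b := ⟨f.app n⟩) _ _).trans hc) z, ?_, fun i hi => ?_⟩
    · rw [beadMap, ModQuiver.comp_app, e]
      refine (tensorHom_tmul _ _ _ _ _).trans ?_
      rw [hz, elt_cons]
      exact congrArg (fun w => tmul _ _ c w (elt k z)) (levelMap_gen k _ _ _ _)
    · by_cases hi' : i ≤ n
      · rw [Chain.fn_cons_of_le _ _ _ _ _ hi']
        refine (val_pull (a := ⟨n⟩) (b := ⟨f.app n⟩) _ _ hi').trans ?_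
        have h3 : FInt.Hom.app (f.left n rfl) i = f.app i := FInt.Hom.left_app _ _ _ hi'
        refine (congrArg _ h3).trans (h₁ _ (f.app_mono hi'))
      · obtain ⟨j, rfl⟩ : ∃ j, i = n + j := ⟨i - n, by omega⟩
        rw [List.sum_cons] at hi
        have hj : j ≤ T.sum := by omega
        have hm := f.app_mono (show n ≤ n + j by omega)
        have h3 := FInt.Hom.app_le (f.right n rfl List.sum_cons (cutBead_sum hy)) j
        rw [Chain.fn_cons_add, hz' j hj, h₂ _ h3, FInt.Hom.right_app _ _ _ _ _ hj]
        congr 1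
        omega

end Values

end FreeTemplicial

namespace FreeTemplicial

open ModQuiver
open FInt hiding comp_app id_app

/-! ### Morphisms out of `F̃(K)_•` as compatible families on a sieve -/

section Homs

variable {k : Type u} [CommRing k] {K : SSet.{u}} {N : ℕ}
  {ι : K ⟶ SSet.stdSimplex.{u}.obj (.mk N)} {s t : Vert K} (hN : 0 < N)
  (hs : vertVal ι s = 0) (ht : vertVal ι t = N)

lemma vertVal_injective (hι : ∀ m, Function.Injective (ι.app m)) :
    Function.Injective (vertVal ι) := fun s t h =>
  val_ext (a := ⟨0⟩) hι fun i hi => by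
    obtain rfl : i = 0 := Nat.le_zero.1 hi
    exact h

/-- The hypothesis asks for a simplex with the prescribed vertices over each interval between
consecutive joints. Neighbouring simplices fit together because vertices of K are determined by
their values. -/
lemma exists_chain (hι : ∀ m, Function.Injective (ι.app m)) {φ : ℕ → ℕ} {l : List ℕ} {s t : Vert K}
    (hs : vertVal ι s = φ 0) (ht : vertVal ι t = φ l.sum)
    (h : ∀ p n, p ∈ joints l → p + n ∈ joints l → (∀ q ∈ joints l, q ≤ p ∨ p + n ≤ q) →
      ∃ x : Simp K ⟨n⟩, ∀ i ≤ n, val ι x i = φ (p + i)) :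
    ∃ x : Chain K l s t, ∀ i ≤ l.sum, x.fn ι i = φ i := by
  induction l generalizing φ s with
  | nil =>
    refine ⟨.nil (vertVal_injective hι (hs.trans ht.symm)), fun i hi => ?_⟩
    obtain rfl : i = 0 := Nat.le_zero.1 hi
    exact hs
  | cons n l ih =>
    obtain ⟨x, hx⟩ := h 0 n (zero_mem_joints _)
      (Or.inr ⟨0, zero_mem_joints l, (Nat.add_comm n 0)⟩) (by
        rintro q (rfl | ⟨j, _, rfl⟩)
        · exact Or.inl le_rfl
        · exact Or.inr (by simp))
    have hxs : src x = s := vertVal_injective hι (by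
      rw [vertVal_src, hs, hx 0 (Nat.zero_le _)])
    have hxt : vertVal ι (tgt x) = φ (n + 0) := by
      refine (vertVal_tgt x).trans ((hx n le_rfl).trans ?_)
      rw [Nat.zero_add, Nat.add_zero]
    obtain ⟨y, hy⟩ := ih (φ := fun i => φ (n + i)) hxt (by rw [ht, List.sum_cons])
      fun p m hp hpm hq => by
        obtain ⟨z, hz⟩ := h (n + p) m (Or.inr ⟨p, hp, rfl⟩)
          (Or.inr ⟨p + m, hpm, (Nat.add_assoc _ _ _).symm⟩) (by
            rintro q (rfl | ⟨j, hj, rfl⟩)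
            · exact Or.inl (Nat.zero_le _)
            · have := hq j hj
              dsimp only
              omega)
        exact ⟨z, fun i hi => (hz i hi).trans (congrArg φ (Nat.add_assoc _ _ _))⟩
    refine ⟨.cons _ x hxs rfl y, fun i hi => ?_⟩
    by_cases hi' : i ≤ n
    · rw [Chain.fn_cons_of_le _ _ _ _ _ hi', hx i hi', Nat.zero_add]
    · obtain ⟨j, rfl⟩ : ∃ j, i = n + j := ⟨i - n, by omega⟩
      rw [List.sum_cons] at hi
      rw [Chain.fn_cons_add, hy j (by omega)]

/-- The map of necklaces `T → Δ^N` given by a necklace over `Δ[N]`. -/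
def homOf (T : Nec) (x : Chain K T.beads s t) : T ⟶ Nec.bead N hN where
  map := FInt.Hom.mk' (x.fn ι) (x.fn_zero.trans hs) (x.fn_sum.trans ht) fun _ _ h _ => x.fn_mono h
  joints_subset i hi := by
    rcases Nec.mem_joints_bead.1 hi with rfl | rfl
    · exact ⟨0, zero_mem_joints _, FInt.Hom.app_zero _⟩
    · have : T.beads.sum ∈ joints T.beads := by
        generalize T.beads = l
        induction l with
        | nil => exact rfl
        | cons n l ih => exact Or.inr ⟨_, ih, List.sum_cons.symm⟩
      exact ⟨_, this, FInt.Hom.app_of_le _ le_rfl⟩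

lemma homOf_app {T : Nec} (x : Chain K T.beads s t) {i : ℕ} (hi : i ≤ T.beads.sum) :
    (homOf hN hs ht T x).map.app i = x.fn ι i :=
  congrArg (x.fn ι) (min_eq_left hi)

lemma homOf_eq {T : Nec} (x : Chain K T.beads s t) {f : T ⟶ Nec.bead N hN}
    (h : ∀ i ≤ T.beads.sum, x.fn ι i = f.map.app i) : homOf hN hs ht T x = f :=
  Nec.hom_ext fun i hi => (homOf_app hN hs ht x hi).trans (h i hi)

variable (k) in
-- Necklaces act on basis elements by precomposition of the associated maps to `Δ^N`. When K embeds
-- in `Δ[N]`, this identifies `F̃(K)_•(s, t)` with the free module functor on a subpresheaf of the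
-- one represented by `Δ^N`.
lemma nec_map_elt {T U : Nec} (g : T ⟶ U) (x : Chain K U.beads s t) :
    ∃ z : Chain K T.beads s t, ((freeTemplicial k K).nec s t).map g.op (elt k x) = elt k z ∧
      homOf hN hs ht T z = g ≫ homOf hN hs ht U x := by
  obtain ⟨z, hz, hz'⟩ := beadMap_elt (ι := ι) k T.beads U.beads U.pos g.map g.joints_subset x
  refine ⟨z, hz, homOf_eq _ _ _ z fun i hi => ?_⟩
  rw [hz' i hi, Nec.comp_app, homOf_app _ _ _ _ (g.map.app_le i)]

variable {Y : Necᵒᵖ ⥤ ModuleCat.{u} k} {A : Sieve (Nec.bead N hN)}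

/-- The morphism `F̃(K)_•(s, t) → Y` of a family of elements indexed by necklaces over `Δ[N]`. -/
noncomputable def ofFamily (σ : SieveFamily Y A)
    (hA : ∀ (T : Nec) (x : Chain K T.beads s t), A (homOf hN hs ht T x)) :
    (freeTemplicial k K).nec s t ⟶ Y where
  app T := ModuleCat.ofHom (chainLift fun x : Chain K T.unop.beads s t => σ.val _ (hA T.unop x))
  naturality U T g := by
    refine ModuleCat.hom_ext (elt_ext fun x => ?_)
    obtain ⟨z, hz, hz'⟩ := nec_map_elt k hN hs ht g.unop x
    refine (congrArg (chainLift fun x : Chain K T.unop.beads s t => σ.val _ (hA T.unop x))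
      hz).trans ((chainLift_elt _ z).trans ?_)
    refine Eq.trans ?_ (congrArg (Y.map g) (chainLift_elt _ x)).symm
    exact (σ.val_congr hz' _).trans (σ.map_val g.unop _ _).symm

lemma ofFamily_elt (σ : SieveFamily Y A)
    (hA : ∀ (T : Nec) (x : Chain K T.beads s t), A (homOf hN hs ht T x)) {T : Nec}
    (x : Chain K T.beads s t) :
    (ofFamily hN hs ht σ hA).app (op T) (elt k x) = σ.val _ (hA T x) := chainLift_elt _ x

/-- The family of elements given by a morphism `F̃(K)_•(s, t) → Y`. -/
noncomputable def toFamily (hι : ∀ m, Function.Injective (ι.app m))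
    (τ : (freeTemplicial k K).nec s t ⟶ Y)
    (hA : ∀ (T : Nec) (f : T ⟶ Nec.bead N hN), A f →
      ∃ x : Chain K T.beads s t, ∀ i ≤ T.beads.sum, x.fn ι i = f.map.app i) :
    SieveFamily Y A where
  val f h := τ.app _ (elt k (hA _ f h).choose)
  map_val {T U} g f h := by
    obtain ⟨z, hz, hz'⟩ := nec_map_elt k hN hs ht g (hA T f h).choose
    refine (NatTrans.naturality_apply τ g.op _).symm.trans (congrArg (τ.app (op U)) (hz.trans ?_))
    -- The chosen chains are compatible with restriction since a chain is determined by its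
    -- vertices.
    refine congrArg (elt k) (Chain.ext_fn hι fun i hi => ?_)
    have h1 := (hA U _ (A.downward_closed h g)).choose_spec i hi
    have h2 := homOf_eq hN hs ht _ (hA T f h).choose_spec
    rw [← homOf_app hN hs ht z hi, hz', h2]
    exact h1.symm

/-- The chain over a given f is unique, so any such chain computes the value in place of the chosen
one. -/
lemma toFamily_val (hι : ∀ m, Function.Injective (ι.app m))
    (τ : (freeTemplicial k K).nec s t ⟶ Y)
    (hA : ∀ (T : Nec) (f : T ⟶ Nec.bead N hN), A f →
      ∃ x : Chain K T.beads s t, ∀ i ≤ T.beads.sum, x.fn ι i = f.map.app i) {T : Nec}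
    {f : T ⟶ Nec.bead N hN} (h : A f) (x : Chain K T.beads s t)
    (hx : ∀ i ≤ T.beads.sum, x.fn ι i = f.map.app i) :
    (toFamily hN hs ht hι τ hA).val f h = τ.app _ (elt k x) :=
  congrArg (fun z => τ.app _ (elt k z)) (Chain.ext_fn hι fun i hi =>
    ((hA _ f h).choose_spec i hi).trans (hx i hi).symm)

end Homs

/-! ### Weak Kan as fillability of the inner horn sieves -/

section Horn

open SSet

lemma vertVal_stdSimplex {N : ℕ} (i : Fin (N + 1)) :
    vertVal (𝟙 (stdSimplex.{u}.obj (.mk N))) (stdSimplex.obj₀Equiv.symm i) = i := rfl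

lemma vertVal_hornVertex {n : ℕ} {j : Fin (n + 3)} (i : Fin (n + 3)) :
    vertVal (horn.{u} (n + 2) j).ι (hornVertex n j i) = i := rfl

/-- The simplex of `Δ[N]` with given vertices. -/
def simplexMk {N n : ℕ} (φ : ℕ → ℕ) (hφ : Monotone φ) (hN : ∀ i, φ i ≤ N) :
    Simp (stdSimplex.{u}.obj (.mk N)) ⟨n⟩ :=
  stdSimplex.objMk (n := .mk N) (m := op (.mk n))
    { toFun := fun i => ⟨φ i, Nat.lt_succ_of_le (hN i)⟩
      monotone' := fun _ _ h => hφ h }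

lemma val_simplexMk {N n : ℕ} (φ : ℕ → ℕ) (hφ : Monotone φ) (hN : ∀ i, φ i ≤ N) {i : ℕ}
    (hi : i ≤ n) : val (𝟙 _) (simplexMk (n := n) φ hφ hN) i = φ i :=
  congrArg φ (min_eq_left hi)

lemma exists_simplex_horn {n m : ℕ} {j : Fin (n + 3)} (φ : ℕ → ℕ) (hφ : Monotone φ)
    (hN : ∀ i, φ i ≤ n + 2) {v : ℕ} (hv : v ≤ n + 2) (hvj : v ≠ j) (h : ∀ i ≤ m, φ i ≠ v) :
    ∃ x : Simp (horn.{u} (n + 2) j : SSet.{u}) ⟨m⟩, ∀ i ≤ m, val (horn (n + 2) j).ι x i = φ i := by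
  refine ⟨⟨simplexMk φ hφ hN, (mem_horn_iff_notMem_range _ _).2
    ⟨⟨v, Nat.lt_succ_of_le hv⟩, fun e => hvj (congrArg Fin.val e), ?_⟩⟩,
    fun i hi => val_simplexMk φ hφ hN hi⟩
  rintro ⟨i, hi⟩
  exact h i (Nat.le_of_lt_succ i.isLt) (congrArg Fin.val hi)

lemma exists_missing_vertex {n m : ℕ} {j : Fin (n + 3)}
    (x : Simp (horn.{u} (n + 2) j : SSet.{u}) ⟨m⟩) :
    ∃ v ≤ n + 2, v ≠ j ∧ ∀ i, val (horn (n + 2) j).ι x i ≠ v := by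
  obtain ⟨v, hv, h⟩ := (mem_horn_iff_notMem_range _ _).1 x.2
  refine ⟨v, Nat.le_of_lt_succ v.isLt, fun e => hv (Fin.ext e), fun i hi => h ⟨_, Fin.ext hi⟩⟩

/-- Follow the chain from its start at 0 to the first bead that leaves 0. Either this bead ends at
an interior vertex, which is then the value of a joint, or it runs from 0 to n + 2; in that case the
vertex that it omits as a simplex of the horn is interior and is omitted by the whole chain. -/
lemma exists_joint_or_missing {n : ℕ} {j : Fin (n + 3)} {l : List ℕ}
    {s t : Vert (horn.{u} (n + 2) j : SSet.{u})} (hs : vertVal (horn (n + 2) j).ι s = 0)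
    (ht : vertVal (horn (n + 2) j).ι t = n + 2) (x : Chain (horn (n + 2) j : SSet.{u}) l s t) :
    (∃ q ∈ joints l, x.fn (horn (n + 2) j).ι q ∈ Set.Ioo 0 (n + 2)) ∨
      ∃ v ∈ Set.Ioo 0 (n + 2) \ {(j : ℕ)}, ∀ i, x.fn (horn (n + 2) j).ι i ≠ v := by
  induction x with
  | nil e => subst e; omega
  | @cons m l s t c x hx hc y ih =>
    have h0 : val (horn (n + 2) j).ι x 0 = 0 := by rw [← vertVal_src, hx, hs]
    have hm : val (horn (n + 2) j).ι x m = vertVal (horn (n + 2) j).ι c := by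
      rw [← hc]; exact (vertVal_tgt x).symm
    have hcN : vertVal (horn (n + 2) j).ι c ≤ n + 2 := hm ▸ val_le x m
    rcases Nat.eq_zero_or_pos (vertVal (horn (n + 2) j).ι c) with h | h
    · refine (ih h ht).imp ?_ ?_
      · rintro ⟨q, hq, hq'⟩
        exact ⟨m + q, Or.inr ⟨q, hq, rfl⟩, by rwa [Chain.fn_cons_add]⟩
      · rintro ⟨v, hv, hv'⟩
        refine ⟨v, hv, fun i => ?_⟩
        by_cases hi : i ≤ m
        · rw [Chain.fn_cons_of_le _ _ _ _ _ hi]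
          have := val_mono (ι := (horn (n + 2) j).ι) x hi
          have := hv.1.1
          omega
        · obtain ⟨i, rfl⟩ : ∃ r, i = m + r := ⟨i - m, by omega⟩
          rw [Chain.fn_cons_add]
          exact hv' i
    · rcases hcN.lt_or_eq with h' | h'
      · refine Or.inl ⟨m, Or.inr ⟨0, zero_mem_joints _, Nat.add_zero m⟩, ?_⟩
        rw [Chain.fn_cons_of_le _ _ _ _ _ le_rfl, hm]
        exact ⟨h, h'⟩
      -- The bead contains both 0 and n + 2, so v is interior; after this bead the chain stays at n
      -- + 2 by monotonicity.
      · obtain ⟨v, hv, hvj, hx'⟩ := exists_missing_vertex x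
        have hv0 := hx' 0
        have hvm := hx' m
        refine Or.inr ⟨v, ⟨⟨by omega, by omega⟩, hvj⟩, fun i => ?_⟩
        by_cases hi : i ≤ m
        · rw [Chain.fn_cons_of_le _ _ _ _ _ hi]
          exact hx' i
        · have h1 := (Chain.cons c x hx hc y).fn_mono (ι := (horn (n + 2) j).ι)
            (show m ≤ i by omega)
          have h2 := (Chain.cons c x hx hc y).fn_le (ι := (horn (n + 2) j).ι) i
          rw [Chain.fn_cons_of_le _ _ _ _ _ le_rfl] at h1
          omega

/-- The sieve of the necklaces in a horn. -/
abbrev hornSieveAt (n : ℕ) (j : Fin (n + 3)) : Sieve (Nec.bead (n + 2) (Nat.succ_pos _)) :=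
  Nec.hornSieve (n + 2) (Nat.succ_pos _) (Set.Ioo 0 (n + 2) \ {(j : ℕ)})

lemma hornSieveAt_homOf {n : ℕ} (j : Fin (n + 3)) (T : Nec)
    (x : Chain (horn.{u} (n + 2) j : SSet.{u}) T.beads (hornVertex n j 0)
      (hornVertex n j (Fin.last (n + 2)))) :
    hornSieveAt n j (homOf (Nat.succ_pos _) (vertVal_hornVertex 0)
      (vertVal_hornVertex (Fin.last (n + 2))) T x) := by
  rw [Nec.sieve_apply]
  refine (exists_joint_or_missing (vertVal_hornVertex 0) (vertVal_hornVertex (Fin.last (n + 2)))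
    x).imp ?_ ?_
  · rintro ⟨q, hq, h⟩
    exact ⟨q, hq, (congrArg (· ∈ Set.Ioo 0 (n + 2)) (homOf_app _ _ _ _ (joints_le_sum _ hq))).mpr h⟩
  · rintro ⟨v, hv, h⟩
    exact ⟨v, hv, fun i hi e => h i ((homOf_app _ _ _ _ hi).symm.trans e)⟩

lemma app_le_of_bead {n : ℕ} {hn : 0 < n} {T : Nec} (f : T ⟶ Nec.bead n hn) (i : ℕ) :
    f.map.app i ≤ n := f.map.app_le i

/-- Every bead of T has to lie in the horn, that is, to omit a vertex other than j. If a joint has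
an interior value, a bead on its left omits n + 2 and a bead on its right omits 0; both differ from
j because the horn is inner. Otherwise all beads omit the same vertex v. -/
lemma exists_chain_horn {n : ℕ} {j : Fin (n + 3)} (h0 : 0 < j) (h1 : j < Fin.last (n + 2)) (T : Nec)
    (f : T ⟶ Nec.bead (n + 2) (Nat.succ_pos _)) (hf : hornSieveAt n j f) :
    ∃ x : Chain (horn.{u} (n + 2) j : SSet.{u}) T.beads (hornVertex n j 0)
      (hornVertex n j (Fin.last (n + 2))), ∀ i ≤ T.beads.sum,
        x.fn (horn (n + 2) j).ι i = f.map.app i := by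
  have hι : ∀ m, Function.Injective ((horn.{u} (n + 2) j).ι.app m) := fun m =>
    Subtype.val_injective
  refine exists_chain hι f.map.app_zero.symm (f.map.app_of_le le_rfl).symm fun p m hp hpm h => ?_
  have key {v : ℕ} (hv : v ≤ n + 2) (hvj : v ≠ j) (h : ∀ i ≤ m, f.map.app (p + i) ≠ v) :=
    exists_simplex_horn.{u} (fun i => f.map.app (p + i)) (fun a b hab => f.map.app_mono (by omega))
      (fun i => app_le_of_bead f _) hv hvj h
  have h0' : 0 < (j : ℕ) := h0
  have h1' : (j : ℕ) < n + 2 := h1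
  rcases (Nec.sieve_apply _).1 hf with ⟨q, hq, hq0, hq1⟩ | ⟨v, ⟨⟨_, hv⟩, hvj⟩, hf'⟩
  · rcases h q hq with hqp | hqp
    · refine key (Nat.zero_le _) h0'.ne fun i _ => ?_
      have := f.map.app_mono (show q ≤ p + i by omega)
      omega
    · refine key le_rfl h1'.ne' fun i hi => ?_
      have := f.map.app_mono (show p + i ≤ q by omega)
      omega
  · refine key hv.le hvj fun i hi => hf' _ ?_
    have := joints_le_sum _ hpm
    omega

lemma exists_chain_stdSimplex {N : ℕ} {hN : 0 < N} (T : Nec) (f : T ⟶ Nec.bead N hN) :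
    ∃ x : Chain (stdSimplex.{u}.obj (.mk N)) T.beads (stdSimplex.obj₀Equiv.symm 0)
      (stdSimplex.obj₀Equiv.symm (Fin.last N)), ∀ i ≤ T.beads.sum,
        x.fn (𝟙 _) i = f.map.app i :=
  exists_chain (fun _ => Function.injective_id) f.map.app_zero.symm (f.map.app_of_le le_rfl).symm
    fun p _ _ _ _ => ⟨simplexMk (fun i => f.map.app (p + i))
      (fun a b hab => f.map.app_mono (by omega)) (fun i => app_le_of_bead f _),
      fun _ hi => val_simplexMk _ _ _ hi⟩

variable {k : Type u} [CommRing k] {Y : Necᵒᵖ ⥤ ModuleCat.{u} k}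

lemma hornNec_elt {n : ℕ} {j : Fin (n + 3)} {T : Nec}
    (x : Chain (horn.{u} (n + 2) j : SSet.{u}) T.beads (hornVertex n j 0)
      (hornVertex n j (Fin.last (n + 2)))) :
    ∃ z : Chain (stdSimplex.{u}.obj (.mk (n + 2))) T.beads (stdSimplex.obj₀Equiv.symm 0)
      (stdSimplex.obj₀Equiv.symm (Fin.last (n + 2))),
      (hornNec k n j).app (op T) (elt k x) = elt k z ∧
        ∀ i, z.fn (𝟙 _) i = x.fn (horn (n + 2) j).ι i :=
  ⟨x.push (horn (n + 2) j).ι, bead_elt _ x, fun i => Chain.fn_push _ (𝟙 _) x i⟩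

/-- A family on the horn sieve is a morphism out of the horn functor; the filler is the value of an
extension of this morphism at the nondegenerate n-simplex, here the identity of `Δ^n` (with n + 2
written for n). -/
lemma fillable_of_weakKan (hY : WeakKan Y) {n : ℕ} {j : Fin (n + 3)} (h0 : 0 < j)
    (h1 : j < Fin.last (n + 2)) : Fillable Y (hornSieveAt n j) := by
  intro σ
  obtain ⟨τ, hτ⟩ := hY n j h0 h1 (ofFamily (Nat.succ_pos _) (vertVal_hornVertex 0)
      (vertVal_hornVertex (Fin.last (n + 2))) σ (hornSieveAt_homOf j))
  let ρ : SieveFamily Y (⊤ : Sieve (Nec.bead (n + 2) (Nat.succ_pos _))) :=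
    toFamily (Nat.succ_pos _) (vertVal_stdSimplex 0) (vertVal_stdSimplex (Fin.last (n + 2)))
      (fun _ => Function.injective_id) τ fun T f _ => exists_chain_stdSimplex T f
  -- By naturality, the restriction of the filler along f is the value of τ at the chain over f; as
  -- f lies in the sieve, this chain comes from the horn, where τ is given by σ.
  refine ⟨ρ.val (𝟙 _) trivial, fun {T} f hf => ?_⟩
  obtain ⟨x, hx⟩ := exists_chain_horn h0 h1 T f hf
  obtain ⟨z, hz, hz'⟩ := hornNec_elt (k := k) x
  refine (ρ.map_val f (𝟙 _) trivial).trans ((ρ.val_congr (Category.comp_id f) _).trans ?_)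
  refine (toFamily_val (Nat.succ_pos _) (vertVal_stdSimplex 0)
    (vertVal_stdSimplex (Fin.last (n + 2))) (fun _ => Function.injective_id) τ _ trivial z
    fun i hi => (hz' i).trans (hx i hi)).trans ?_
  rw [← hz]
  refine (congrArg (fun p => p.app (op T) (elt k x)) hτ).trans ?_
  refine (ofFamily_elt _ _ _ σ _ x).trans ?_
  exact σ.val_congr (homOf_eq _ _ _ x hx) _

/-- A filler y determines the extension by Yoneda: the chain over f is sent to the restriction of y
along f. -/
lemma weakKan_of_fillable (hY : ∀ (n : ℕ) (j : Fin (n + 3)), 0 < j → j < Fin.last (n + 2) →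
    Fillable Y (hornSieveAt n j)) : WeakKan Y := by
  intro n j h0 h1 τ
  let σ : SieveFamily Y (hornSieveAt n j) := toFamily (Nat.succ_pos _) (vertVal_hornVertex 0)
      (vertVal_hornVertex (Fin.last (n + 2))) (fun _ => Subtype.val_injective) τ
      (exists_chain_horn h0 h1)
  obtain ⟨y, hy⟩ := hY n j h0 h1 σ
  refine ⟨ofFamily (Nat.succ_pos _) (vertVal_stdSimplex 0) (vertVal_stdSimplex (Fin.last (n + 2)))
    (.ofElement y ⊤) fun _ _ => trivial, ?_⟩
  refine NatTrans.ext (funext fun T => ModuleCat.hom_ext (elt_ext fun x => ?_))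
  obtain ⟨z, hz, hz'⟩ := hornNec_elt (k := k) (T := T.unop) x
  refine (congrArg (fun e => (ofFamily (Nat.succ_pos _) (vertVal_stdSimplex 0)
    (vertVal_stdSimplex (Fin.last (n + 2))) (.ofElement y ⊤) fun _ _ => trivial).app T e)
    hz).trans ?_
  refine (ofFamily_elt (T := T.unop) _ _ _ _ _ z).trans ?_
  have he := homOf_eq (Nat.succ_pos _) (vertVal_stdSimplex 0)
    (vertVal_stdSimplex (Fin.last (n + 2))) z (f := homOf (Nat.succ_pos _) (vertVal_hornVertex 0)
      (vertVal_hornVertex (Fin.last (n + 2))) T.unop x)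
    fun i hi => (hz' i).trans (homOf_app _ _ _ x hi).symm
  refine (congrArg (fun f => Y.map f.op y) he).trans ?_
  refine (hy _ (hornSieveAt_homOf j T.unop x)).trans ?_
  exact toFamily_val _ _ _ _ _ _ _ x fun i hi => (homOf_app _ _ _ x hi).symm

end Horn

end FreeTemplicial

/-! ### Compatibility of the necklace functor with monoidal functors -/

section Comparison

open Functor.OplaxMonoidal

universe v w v' w'

variable {C : Type w} [Category.{v} C] [MonoidalCategory C] {D : Type w'} [Category.{v'} D]
  [MonoidalCategory D] (F : FIntᵒᵖ ⥤ C) (G : C ⥤ D) [F.OplaxMonoidal] [G.OplaxMonoidal]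

/-- The comparison `G(X_T) → (G ∘ X)_T`. -/
def beadComparison : ∀ l : List ℕ, G.obj (beadObj F l) ⟶ beadObj (F ⋙ G) l
  | [] => η G
  | n :: l => δ G (level F n) (beadObj F l) ≫ level (F ⋙ G) n ◁ beadComparison l

lemma beadComparison_cons (n : ℕ) (l : List ℕ) : beadComparison F G (n :: l) =
    δ G (level F n) (beadObj F l) ≫ G.obj (level F n) ◁ beadComparison F G l := rfl

lemma isIso_beadComparison [IsIso (η G)] [∀ X Y, IsIso (δ G X Y)] (l : List ℕ) :
    IsIso (beadComparison F G l) := by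
  induction l with
  | nil => exact inferInstanceAs (IsIso (η G))
  | cons n l ih => rw [beadComparison_cons]; infer_instance

lemma counit_comp : counit (F ⋙ G) = G.map (counit F) ≫ η G := Functor.OplaxMonoidal.comp_η F G

lemma comul_comp {u y b : ℕ} (h : u = y + b) :
    comul (F ⋙ G) h = G.map (comul F h) ≫ δ G _ _ := by
  rw [comul, comul, Functor.OplaxMonoidal.comp_δ, G.map_comp, Category.assoc]
  rfl

/-- For b = 0 this is left unitality of G together with naturality; for b > 0 both prepending maps
are identities. -/
lemma prependBead_comp (b : ℕ) (U : List ℕ) :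
    (δ G (level F b) (beadObj F U) ≫ G.obj (level F b) ◁ beadComparison F G U) ≫
        prependBead (F ⋙ G) b U =
      G.map (prependBead F b U) ≫ beadComparison F G (consBead b U) := by
  cases b with
  | succ b =>
    refine (Category.comp_id _).trans ?_
    exact ((congrArg (· ≫ beadComparison F G (consBead (b + 1) U)) (G.map_id _)).trans
      (Category.id_comp _)).symm
  | zero =>
    change (δ G (level F 0) (beadObj F U) ≫ G.obj (level F 0) ◁ beadComparison F G U) ≫
      counit (F ⋙ G) ▷ beadObj (F ⋙ G) U ≫ (λ_ (beadObj (F ⋙ G) U)).hom =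
      G.map (counit F ▷ beadObj F U ≫ (λ_ (beadObj F U)).hom) ≫ beadComparison F G U
    rw [counit_comp, G.map_comp, ← left_unitality_hom, comp_whiskerRight]
    simp only [Category.assoc]
    rw [← δ_natural_left_assoc, ← leftUnitor_naturality, whisker_exchange_assoc]
    congr 1
    exact congrArg (G.map (counit F) ▷ G.obj (beadObj F U) ≫ ·)
      (whisker_exchange_assoc (η G) (beadComparison F G U) _)

/-- The essential input is coassociativity of δ for G, which moves the comparison past the
associator; the rest is naturality. -/
lemma cutFirst_comp {u y b : ℕ} (h : u = y + b) (U : List ℕ) :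
    beadComparison F G (u :: U) ≫ cutFirst (F ⋙ G) h U =
      G.map (cutFirst F h U) ≫ δ G _ _ ≫ G.obj (level F y) ◁ beadComparison F G (consBead b U) := by
  have h1 : G.obj (level F u) ◁ beadComparison F G U ≫ (G.map (comul F h) ≫ δ G _ _) ▷ _ =
      (G.map (comul F h) ≫ δ G _ _) ▷ _ ≫
        (G.obj (level F y) ⊗ G.obj (level F b)) ◁ beadComparison F G U := whisker_exchange _ _
  have h2 : G.obj (level F y) ◁ ((δ G (level F b) (beadObj F U) ≫
      G.obj (level F b) ◁ beadComparison F G U) ≫ prependBead (F ⋙ G) b U) = _ :=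
    congrArg _ (prependBead_comp F G b U)
  simp only [MonoidalCategory.whiskerLeft_comp, Category.assoc] at h2
  calc _ = δ G (level F u) (beadObj F U) ≫ (G.obj (level F u) ◁ beadComparison F G U ≫
        (G.map (comul F h) ≫ δ G _ _) ▷ _) ≫ (α_ _ _ _).hom ≫
          G.obj (level F y) ◁ prependBead (F ⋙ G) b U := by
        rw [cutFirst, comul_comp, beadComparison_cons]
        simp only [Category.assoc]
        rfl
    _ = G.map (comul F h ▷ beadObj F U) ≫ (δ G _ _ ≫ δ G _ _ ▷ _ ≫ (α_ _ _ _).hom) ≫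
          G.obj (level F y) ◁ G.obj (level F b) ◁ beadComparison F G U ≫
            G.obj (level F y) ◁ prependBead (F ⋙ G) b U := by
        rw [h1, comp_whiskerRight]
        simp only [Category.assoc]
        rw [δ_natural_left_assoc, associator_naturality_right_assoc]
    _ = _ := by
        rw [associativity, cutFirst]
        simp only [Category.assoc, h2, G.map_comp]
        rw [δ_natural_right_assoc]

/-- The case of the empty necklace in `splitBead_comp`: composing with the invertible `e' ▷ 𝟙_ D`
turns the identity into left unitality of G. -/
lemma unit_split_comp {X : C} (e : X ⟶ 𝟙_ C) [IsIso e] (e' : G.obj X ⟶ 𝟙_ D) [IsIso e']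
    (h : e' = G.map e ≫ η G) : η G ≫ (λ_ (𝟙_ D)).inv ≫ inv e' ▷ 𝟙_ D =
      G.map ((λ_ (𝟙_ C)).inv ≫ inv e ▷ 𝟙_ C) ≫ δ G X (𝟙_ C) ≫ G.obj X ◁ η G := by
  rw [← cancel_mono (e' ▷ 𝟙_ D)]
  have h1 : inv e' ▷ 𝟙_ D ≫ e' ▷ 𝟙_ D = 𝟙 _ := by
    rw [← comp_whiskerRight, IsIso.inv_hom_id, id_whiskerRight]
  have h2 : G.map (inv e ▷ 𝟙_ C) ≫ G.map (e ▷ 𝟙_ C) = 𝟙 _ := by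
    rw [← G.map_comp, ← comp_whiskerRight, IsIso.inv_hom_id, id_whiskerRight, G.map_id]
  rw [G.map_comp]
  simp only [Category.assoc]
  rw [h1, Category.comp_id, whisker_exchange, h, comp_whiskerRight, Category.assoc,
    δ_natural_left_assoc, reassoc_of% h2, leftUnitor_inv_naturality, left_unitality]
  simp only [Category.assoc]

variable [IsIso (η F)]

lemma splitBead_nil_zero (h : 0 ≤ 0) :
    splitBead F 0 [] h = (λ_ (𝟙_ C)).inv ≫ inv (counit F) ▷ 𝟙_ C := by
  rw [splitBead_nil, levelMap_cast, Category.comp_id]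

variable [IsIso (η (F ⋙ G))]

lemma splitBead_comp (y : ℕ) (U : List ℕ) (h : y ≤ U.headD 0) :
    beadComparison F G U ≫ splitBead (F ⋙ G) y U h =
      G.map (splitBead F y U h) ≫ δ G _ _ ≫
        G.obj (level F y) ◁ beadComparison F G (cutBead y U) := by
  cases U with
  | cons u U => exact cutFirst_comp F G _ U
  | nil =>
    obtain rfl : y = 0 := Nat.le_zero.1 h
    refine Eq.trans ?_ ((unit_split_comp G (counit F) (counit (F ⋙ G)) (counit_comp F G)).trans ?_)
    · exact congrArg (η G ≫ ·) (splitBead_nil_zero (F ⋙ G) h)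
    · exact congrArg (fun x => G.map x ≫ δ G (level F 0) (𝟙_ C) ≫ G.obj (level F 0) ◁ η G)
        (splitBead_nil_zero F h).symm

/-- Induction along the beads of T: `splitBead_comp` handles the cut, naturality of δ the first
bead. -/
lemma beadMap_comp_functor (T U : List ℕ) (hU : ∀ n ∈ U, 0 < n) (f : FInt.Hom T.sum U.sum)
    (hf : joints U ⊆ f.app '' joints T) :
    beadComparison F G U ≫ beadMap (F ⋙ G) T U hU f hf =
      G.map (beadMap F T U hU f hf) ≫ beadComparison F G T := by
  induction T generalizing U with
  | nil =>
    cases U with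
    | cons u U => exact (false_of_nil_cons hU f).elim
    | nil =>
      refine (Category.comp_id _).trans ?_
      exact ((congrArg (· ≫ beadComparison F G []) (G.map_id _)).trans (Category.id_comp _)).symm
  | cons n T ih =>
    rw [beadMap, ← Category.assoc, splitBead_comp, beadMap, G.map_comp, beadComparison_cons]
    simp only [Category.assoc]
    congr 1
    rw [← δ_natural_assoc]
    congr 1
    rw [← id_tensorHom, ← id_tensorHom, tensorHom_comp_tensorHom, tensorHom_comp_tensorHom, ih]
    simp only [Category.id_comp, Category.comp_id]
    rfl

/-- The comparison `G(X_•) ≅ (G ∘ X)_•`. -/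
noncomputable def necFunctorComp [IsIso (η G)] [∀ X Y, IsIso (δ G X Y)] :
    necFunctor F ⋙ G ≅ necFunctor (F ⋙ G) :=
  NatIso.ofComponents (fun T => @asIso _ _ _ _ _ (isIso_beadComparison F G T.unop.beads)) fun {U T} g =>
    (beadMap_comp_functor F G T.unop.beads U.unop.beads U.unop.pos g.unop.map
      g.unop.joints_subset).symm

end Comparison

/-! ### Base change of quivers is strong monoidal -/

namespace BaseChange

open ModQuiver

variable {R : Type u} (k : Type u) [CommRing R] [CommRing k] [Algebra R k] {S : Type u}

variable {k} in
/-- Linear maps out of `k ⊗ Q(a, b)`. -/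
noncomputable def descend {Q : ModQuiver R S} {a b : S} {N : Type u} [AddCommGroup N] [Module k N]
    (φ : Q.hom a b →ₛₗ[algebraMap R k] N) : ((quiver k).obj Q).hom a b →ₗ[k] N := extend φ

variable {k} in
lemma descend_incl {Q : ModQuiver R S} {a b : S} {N : Type u} [AddCommGroup N] [Module k N]
    (φ : Q.hom a b →ₛₗ[algebraMap R k] N) (q : Q.hom a b) : descend φ (incl k Q a b q) = φ q :=
  one_smul k _

/-- The semilinear map underlying the inverse of `comul`. -/
noncomputable def preComulInv (P Q : ModQuiver R S) (a b c : S) : P.hom a c →ₛₗ[algebraMap R k]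
    (((quiver k).obj Q).hom c b →ₗ[k] ((quiver k).obj (P ⊗ Q)).hom a b) where
  toFun p := descend ((incl k (P ⊗ Q) a b).comp (tmul P Q c p))
  map_add' p p' := incl_ext fun q => by
    rw [LinearMap.add_apply, descend_incl, descend_incl, descend_incl]
    simp only [LinearMap.comp_apply, map_add, LinearMap.add_apply]
  map_smul' r p := incl_ext fun q => by
    rw [LinearMap.smul_apply, descend_incl, descend_incl]
    simp only [LinearMap.comp_apply, map_smul, LinearMap.smul_apply, map_smulₛₗ]

/-- The inverse of the comparison `k ⊗ (P ⊗ Q) → (k ⊗ P) ⊗ (k ⊗ Q)`. -/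
noncomputable def comulInv (P Q : ModQuiver R S) :
    (quiver k).obj P ⊗ (quiver k).obj Q ⟶ (quiver k).obj (P ⊗ Q) :=
  ⟨fun a b => tensorLift fun c => descend (preComulInv k P Q a b c)⟩

lemma comulInv_tmul (P Q : ModQuiver R S) {a b : S} (c : S) (p : P.hom a c) (q : Q.hom c b) :
    Hom.app (comulInv k P Q) a b
        (tmul ((quiver k).obj P) ((quiver k).obj Q) c (incl k P a c p) (incl k Q c b q)) =
      incl k (P ⊗ Q) a b (tmul P Q c p q) := by
  refine (tensorLift_tmul _ _ _ _).trans ?_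
  rw [descend_incl]
  exact descend_incl _ _

/-- Both composites are compared on generators `1 ⊗ p` and `1 ⊗ q`, which suffices by linearity over
k. -/
instance isIso_comul (P Q : ModQuiver R S) :
    IsIso (Functor.OplaxMonoidal.δ (quiver (R := R) (S := S) k) P Q) := by
  refine ⟨comulInv k P Q, hom_ext_tensor fun a b c p q => ?_,
    ModQuiver.Hom.ext (funext fun a => funext fun b => tensor_linearMap_ext fun c p q => ?_)⟩
  · exact (congrArg (Hom.app (comulInv k P Q) a b) (comul_incl k P Q c p q)).trans
      (comulInv_tmul k P Q c p q)
  · refine LinearMap.congr_fun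
      (f := (Hom.app (comulInv k P Q ≫ comul k P Q) a b ∘ₗ
        (tmul ((quiver k).obj P) ((quiver k).obj Q) c).flip q))
      (g := (tmul ((quiver k).obj P) ((quiver k).obj Q) c).flip q) (incl_ext fun p => ?_) p
    refine LinearMap.congr_fun
      (f := (Hom.app (comulInv k P Q ≫ comul k P Q) a b ∘ₗ
        (tmul ((quiver k).obj P) ((quiver k).obj Q) c) (incl k P a c p)))
      (g := (tmul ((quiver k).obj P) ((quiver k).obj Q) c) (incl k P a c p))
      (incl_ext fun q => ?_) q
    exact (congrArg (Hom.app (comul k P Q) a b) (comulInv_tmul k P Q c p q)).trans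
      (comul_incl k P Q c p q)

end BaseChange

/-! ### Invariance of filling under isomorphism and base change -/

namespace Templicial

open ModQuiver

variable {k : Type u} [CommRing k] {S : Type u} {X Y : Templicial k S}

/-- Together with `unit_id_eq`, this lets morphisms with fixed vertex set use the constructions
available for maps over a map of vertex sets. -/
lemma tensor_id_eq {P P' Q Q' : ModQuiver k S} (f : P ⟶ P') (g : Q ⟶ Q') (a b : S)
    (x : (P ⊗ Q).hom a b) :
    HomOver.tensor (φ := (id : S → S)) (Q := P') (Q' := Q') (Hom.app f) (Hom.app g) a b x =
      Hom.app (f ⊗ₘ g) a b x :=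
  LinearMap.congr_fun (f := HomOver.tensor (φ := (id : S → S)) (Q := P') (Q' := Q')
    (Hom.app f) (Hom.app g) a b) (g := Hom.app (f ⊗ₘ g) a b) (tensor_linearMap_ext fun c p q =>
      (HomOver.tensor_tmul (φ := (id : S → S)) _ _ c p q).trans (tensorHom_tmul f g c p q).symm) x

lemma unit_id_eq (a b : S) (x : (𝟙_ (ModQuiver k S)).hom a b) :
    HomOver.unit k (id : S → S) a b x = x :=
  LinearMap.congr_fun (f := HomOver.unit k (id : S → S) a b) (g := LinearMap.id)
    (unit_linearMap_ext fun e => by subst e; exact HomOver.unit_unitElt a) x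

/-- Morphisms of templicial modules as maps over the identity. -/
def Hom.toMap (f : X ⟶ Y) : TemplicialMap (id : S → S) X Y where
  app n := Hom.app (f.nat.app (op ⟨n⟩))
  naturality {m n} g a b x := by
    have := f.nat.naturality (Quiver.Hom.op (X := (⟨m⟩ : FInt)) (Y := ⟨n⟩) g)
    exact LinearMap.congr_fun (congrArg (fun h => Hom.app h a b) this) x
  comul m n a b x := by
    refine (tensor_id_eq (f.nat.app (op ⟨m⟩)) (f.nat.app (op ⟨n⟩)) a b _).trans ?_
    exact (LinearMap.congr_fun (congrArg (fun h => ModQuiver.Hom.app h a b)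
      (f.comul (op ⟨m⟩) (op ⟨n⟩))) x).symm
  counit a b x :=
    (unit_id_eq a b _).trans (LinearMap.congr_fun (congrArg (fun h => ModQuiver.Hom.app h a b)
      f.counit) x).symm

lemma bead_leftInverse (f : TemplicialMap (id : S → S) X Y) (g : TemplicialMap (id : S → S) Y X)
    (h : ∀ n a b x, g.app n a b (f.app n a b x) = x) (l : List ℕ) (a b : S)
    (x : (beadObj X.toFunctor l).hom a b) : g.bead l a b (f.bead l a b x) = x := by
  induction l generalizing a with
  | nil => exact (unit_id_eq a b _).trans (unit_id_eq a b x)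
  | cons n l ih =>
    refine LinearMap.congr_fun (f := g.bead (n :: l) a b ∘ₗ f.bead (n :: l) a b)
      (g := LinearMap.id) (tensor_linearMap_ext fun c p q => ?_) x
    refine (congrArg (g.bead (n :: l) a b) (HomOver.tensor_tmul (f.app n) (f.bead l) c p q)).trans ?_
    refine (HomOver.tensor_tmul (g.app n) (g.bead l) c _ _).trans ?_
    rw [h n a c p]
    exact congrArg (tmul _ _ c p) (ih c q)

/-- Isomorphic templicial modules have the same fillable families. -/
lemma fillable_of_iso (e : X ≅ Y) {a b : S} {V : Nec} {A : Sieve V} (h : Fillable (Y.nec a b) A) :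
    Fillable (X.nec a b) A := by
  refine h.of_bijective (fun T => (Hom.toMap e.inv).bead T.beads a b)
    (fun g y => NatTrans.naturality_apply ((Hom.toMap e.inv).nec a b) g.op y) fun T =>
      Function.bijective_iff_has_inverse.2 ⟨(Hom.toMap e.hom).bead T.beads a b, ?_, ?_⟩
  · exact fun x => bead_leftInverse _ _ (fun n a b x => LinearMap.congr_fun
      (congrArg (fun h : Y ⟶ Y => ModQuiver.Hom.app (Hom.nat h |>.app (op ⟨n⟩)) a b)
        e.inv_hom_id) x) _ _ _ x
  · exact fun x => bead_leftInverse _ _ (fun n a b x => LinearMap.congr_fun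
      (congrArg (fun h : X ⟶ X => ModQuiver.Hom.app (Hom.nat h |>.app (op ⟨n⟩)) a b)
        e.hom_inv_id) x) _ _ _ x

/-- The necklicial module `k ⊗ X_•(a, b)`. -/
noncomputable def baseChangeNec {R : Type u} [CommRing R] (X : Templicial R S) (k : Type u)
    [CommRing k] [Algebra R k] (a b : S) : Necᵒᵖ ⥤ ModuleCat.{u} k :=
  necFunctor X.toFunctor ⋙ BaseChange.quiver k ⋙ ModQuiver.eval a b

/-- Base change is strong monoidal, so `k ⊗ X_T` and `(k ⊗ X)_T` are naturally isomorphic. The first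
form is the one that appears as a summand of a free cover tensored with `X_•`. -/
lemma fillable_baseChangeNec {R : Type u} [CommRing R] [Algebra R k] {X : Templicial R S} {a b : S}
    {V : Nec} {A : Sieve V} (h : Fillable ((X.baseChange k).nec a b) A) :
    Fillable (X.baseChangeNec k a b) A := by
  have : IsIso (Functor.OplaxMonoidal.η (X.toFunctor ⋙ BaseChange.quiver k)) :=
    (X.baseChange k).unital
  let e := Functor.isoWhiskerRight (necFunctorComp X.toFunctor (BaseChange.quiver k)) (eval a b)
  refine h.of_bijective (fun T => e.inv.app (op T))
    (fun g y => NatTrans.naturality_apply e.inv g.op y) fun T => ?_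
  exact ConcreteCategory.bijective_of_isIso (e.inv.app (op T))

end Templicial

/-! ### Quivers annihilated by an ideal, and their free covers -/

namespace ModQuiver

variable {R S : Type u} [CommRing R]

/-- The quiver `P` is annihilated by the ideal `I`. -/
def Annihilated (I : Ideal R) (P : ModQuiver R S) : Prop :=
  ∀ a b, ∀ r ∈ I, ∀ p : P.hom a b, r • p = 0

/-- Scalars can be moved to the first factor. This keeps the class of coefficients stable when a
bead is absorbed. -/
lemma Annihilated.tensor {I : Ideal R} {P : ModQuiver R S} (hP : P.Annihilated I)
    (Q : ModQuiver R S) : (P ⊗ Q).Annihilated I := fun a b r hr z => by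
  induction z using BaseChange.tensor_induction with
  | zero => exact smul_zero r
  | add x y hx hy => rw [smul_add, hx, hy, add_zero]
  | tmul c x y => rw [← LinearMap.smul_apply, ← map_smul, hP a c r hr, map_zero, LinearMap.zero_apply]

/-- The submodules `I P(a, b)`. -/
def idealSMul (I : Ideal R) (P : ModQuiver R S) : ModQuiver R S :=
  ⟨fun a b => ModuleCat.of R (I • ⊤ : Submodule R (P.hom a b))⟩

/-- The quotients `P(a, b) / I P(a, b)`. -/
def idealQuotient (I : Ideal R) (P : ModQuiver R S) : ModQuiver R S :=
  ⟨fun a b => ModuleCat.of R (P.hom a b ⧸ (I • ⊤ : Submodule R (P.hom a b)))⟩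

/-- The inclusion of `I P` in `P`. -/
def idealIncl (I : Ideal R) (P : ModQuiver R S) : P.idealSMul I ⟶ P :=
  ⟨fun a b => (I • ⊤ : Submodule R (P.hom a b)).subtype⟩

/-- The projection from `P` to `P / I P`. -/
def idealProj (I : Ideal R) (P : ModQuiver R S) : P ⟶ P.idealQuotient I :=
  ⟨fun a b => (I • ⊤ : Submodule R (P.hom a b)).mkQ⟩

/-- Since I^n · I = I^(n+1), passing to the subquiver lowers the exponent by one. -/
lemma annihilated_idealSMul {I : Ideal R} {n : ℕ} {P : ModQuiver R S}
    (hP : P.Annihilated (I ^ (n + 1))) : (P.idealSMul I).Annihilated (I ^ n) := by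
  rintro a b r hr ⟨p, hp⟩
  refine Subtype.ext ?_
  change r • p = 0
  induction hp using Submodule.smul_induction_on' with
  | smul s hs p _ =>
    rw [← mul_smul]
    exact hP a b _ (by rw [pow_succ]; exact Ideal.mul_mem_mul hr hs) p
  | add p _ q _ hp hq => rw [smul_add, hp, hq, add_zero]

lemma annihilated_idealQuotient (I : Ideal R) (P : ModQuiver R S) :
    (P.idealQuotient I).Annihilated I := by
  intro a b r hr p
  obtain ⟨p, rfl⟩ := Submodule.mkQ_surjective (I • ⊤ : Submodule R (P.hom a b)) p
  refine (map_smul (I • ⊤ : Submodule R (P.hom a b)).mkQ r p).symm.trans ?_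
  exact (Submodule.Quotient.mk_eq_zero _).2 (Submodule.smul_mem_smul hr trivial)

section Cover

variable (k : Type u) [CommRing k] [Algebra R k]

/-- A quiver of free `k`-modules which covers `P`. -/
noncomputable def cover (P : ModQuiver R S) : ModQuiver R S :=
  ⟨fun a b => ModuleCat.of R (P.hom a b →₀ k)⟩

lemma annihilated_cover (P : ModQuiver R S) :
    (P.cover k).Annihilated (RingHom.ker (algebraMap R k)) := fun a b r hr p => by
  have (p : P.hom a b →₀ k) : r • p = 0 := Finsupp.ext fun x => by
    rw [Finsupp.smul_apply, Algebra.smul_def, RingHom.mem_ker.1 hr, zero_mul, Finsupp.zero_apply]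
  exact this p

variable {k} (hk : Function.Surjective (algebraMap R k))

/-- The linear map `k → M`, `x ↦ x • m`, where `M` is a module over `R` which is annihilated by the
kernel of the surjection `R → k`. -/
noncomputable def smulElt {M : Type u} [AddCommGroup M] [Module R M]
    (hM : ∀ r ∈ RingHom.ker (algebraMap R k), ∀ m : M, r • m = 0) (m : M) : k →ₗ[R] M :=
  -- The product with m depends only on the image of the scalar in k, so the arbitrary preimages
  -- `surjInv` define a linear map.
  have key (r r' : R) (h : algebraMap R k r = algebraMap R k r') : r • m = r' • m := by
    rw [← sub_eq_zero, ← sub_smul]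
    exact hM _ (by rw [RingHom.mem_ker, map_sub, h, sub_self]) m
  { toFun x := Function.surjInv hk x • m
    map_add' x y := by
      rw [← add_smul]
      refine key _ _ ?_
      rw [map_add]
      simp only [Function.surjInv_eq hk]
    map_smul' r x := by
      rw [RingHom.id_apply, ← mul_smul]
      refine key _ _ ?_
      rw [map_mul]
      simp only [Function.surjInv_eq hk, Algebra.smul_def] }

lemma smulElt_one {M : Type u} [AddCommGroup M] [Module R M]
    (hM : ∀ r ∈ RingHom.ker (algebraMap R k), ∀ m : M, r • m = 0) (m : M) :
    smulElt hk hM m 1 = m := by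
  have := hM (Function.surjInv hk 1 - 1)
    (by rw [RingHom.mem_ker, map_sub, Function.surjInv_eq hk, map_one, sub_self]) m
  rwa [sub_smul, one_smul, sub_eq_zero] at this

variable {P : ModQuiver R S} (hP : P.Annihilated (RingHom.ker (algebraMap R k)))

/-- The map from the cover. -/
noncomputable def coverMap : P.cover k ⟶ P :=
  ⟨fun a b => Finsupp.lsum R fun p : P.hom a b => smulElt hk (hP a b) p⟩

lemma coverMap_surjective (a b : S) : Function.Surjective (Hom.app (coverMap hk hP) a b) :=
  fun p => ⟨Finsupp.single p (1 : k), by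
    refine (Finsupp.lsum_single _ _ _ _).trans ?_
    exact smulElt_one hk (hP a b) p⟩

/-- The kernel of a map of quivers. -/
def ker {P Q : ModQuiver R S} (f : P ⟶ Q) : ModQuiver R S :=
  ⟨fun a b => ModuleCat.of R (LinearMap.ker (Hom.app f a b))⟩

/-- The inclusion of the kernel. -/
def kerIncl {P Q : ModQuiver R S} (f : P ⟶ Q) : ker f ⟶ P :=
  ⟨fun a b => (LinearMap.ker (Hom.app f a b)).subtype⟩

lemma Annihilated.of_injective {I : Ideal R} {P Q : ModQuiver R S} (hQ : Q.Annihilated I)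
    (f : P ⟶ Q) (hf : ∀ a b, Function.Injective (Hom.app f a b)) : P.Annihilated I :=
  fun a b r hr p => hf a b (by rw [map_smul, map_zero, hQ a b r hr])

variable (k) in
/-- The inclusion of a summand in the tensor product with a cover. -/
noncomputable def coverInj (P B : ModQuiver R S) {a c : S} (p : P.hom a c) (t : S) :
    k ⊗[R] B.hom c t →ₗ[R] (P.cover k ⊗ B).hom a t :=
  TensorProduct.lift (tmul (P.cover k) B c ∘ₗ (Finsupp.lsingle p : k →ₗ[R] P.hom a c →₀ k))

variable (k) in
lemma coverInj_tmul (P B : ModQuiver R S) {a c t : S} (p : P.hom a c) (x : k) (y : B.hom c t) :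
    coverInj k P B p t (x ⊗ₜ y) = tmul (P.cover k) B c (Finsupp.single p x) y := rfl

variable (k) in
/-- The projection to a summand of the tensor product with a cover. -/
noncomputable def coverProj (P B : ModQuiver R S) {a c : S} (p : P.hom a c) (t : S) :
    (P.cover k ⊗ B).hom a t →ₗ[R] k ⊗[R] B.hom c t :=
  (LinearMap.rTensor (B.hom c t) (Finsupp.lapply p : (P.hom a c →₀ k) →ₗ[R] k)) ∘ₗ
    (DirectSum.component R S (fun c => (P.hom a c →₀ k) ⊗[R] B.hom c t) c)

variable (k) in
lemma coverProj_tmul (P B : ModQuiver R S) {a c t : S} (p : P.hom a c) (x : P.hom a c →₀ k)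
    (y : B.hom c t) :
    coverProj k P B p t (tmul (P.cover k) B c x y) = x p ⊗ₜ y := by
  classical
  have h : DirectSum.component R S (fun c => (P.hom a c →₀ k) ⊗[R] B.hom c t) c
      (DirectSum.lof R S (fun c => (P.hom a c →₀ k) ⊗[R] B.hom c t) c (x ⊗ₜ[R] y)) = x ⊗ₜ[R] y :=
    DirectSum.component.lof_self R c _
  exact congrArg (LinearMap.rTensor (B.hom c t) (Finsupp.lapply p : (P.hom a c →₀ k) →ₗ[R] k)) h

variable (k) in
lemma coverProj_tmul_of_ne (P B : ModQuiver R S) {a c c' t : S} (h : c' ≠ c) (p : P.hom a c)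
    (x : P.hom a c' →₀ k) (y : B.hom c' t) :
    coverProj k P B p t (tmul (P.cover k) B c' x y) = 0 := by
  classical
  have h : DirectSum.component R S (fun c => (P.hom a c →₀ k) ⊗[R] B.hom c t) c
      (DirectSum.lof R S (fun c => (P.hom a c →₀ k) ⊗[R] B.hom c t) c' (x ⊗ₜ[R] y)) = 0 := by
    rw [DirectSum.component.of, dif_neg h]
  exact (congrArg (LinearMap.rTensor (B.hom c t) (Finsupp.lapply p : (P.hom a c →₀ k) →ₗ[R] k))
    h).trans (map_zero _)

variable (k) in
-- An element of a direct sum has finite support. The decomposition is stated for all larger index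
-- sets so that a common one can serve finitely many elements.
lemma exists_sum_coverInj_coverProj (P B : ModQuiver R S) {a t : S} (z : (P.cover k ⊗ B).hom a t) :
    ∃ J₀ : Finset (Σ c, P.hom a c), ∀ J₁, J₀ ⊆ J₁ →
      z = ∑ j ∈ J₁, coverInj k P B j.2 t (coverProj k P B j.2 t z) := by
  classical
  induction z using BaseChange.tensor_induction with
  | zero => exact ⟨∅, fun J₁ _ => by simp only [map_zero, Finset.sum_const_zero]⟩
  | add x y hx hy =>
    obtain ⟨J, hJ⟩ := hx
    obtain ⟨J', hJ'⟩ := hy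
    refine ⟨J ∪ J', fun J₁ h => ?_⟩
    simp only [map_add, Finset.sum_add_distrib]
    rw [← hJ _ (Finset.union_subset_left h), ← hJ' _ (Finset.union_subset_right h)]
  | tmul c x y =>
    change P.hom a c →₀ k at x
    induction x using Finsupp.induction_linear with
    | zero =>
      refine ⟨∅, fun J₁ _ => ?_⟩
      have : tmul (P.cover k) B c (0 : P.hom a c →₀ k) y = 0 :=
        LinearMap.congr_fun (map_zero (tmul (P.cover k) B c)) y
      rw [this]
      simp only [map_zero, Finset.sum_const_zero]
    | add x x' hx hx' =>
      obtain ⟨J, hJ⟩ := hx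
      obtain ⟨J', hJ'⟩ := hx'
      refine ⟨J ∪ J', fun J₁ h => ?_⟩
      have : tmul (P.cover k) B c (x + x') y = tmul (P.cover k) B c x y + tmul (P.cover k) B c x' y :=
        LinearMap.congr_fun (map_add (tmul (P.cover k) B c) x x') y
      rw [this]
      simp only [map_add, Finset.sum_add_distrib]
      rw [← hJ _ (Finset.union_subset_left h), ← hJ' _ (Finset.union_subset_right h)]
    | single p x =>
      refine ⟨{⟨c, p⟩}, fun J₁ h => ?_⟩
      rw [Finset.sum_eq_single_of_mem (⟨c, p⟩ : Σ c, P.hom a c) (h (Finset.mem_singleton_self _))]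
      · rw [coverProj_tmul, coverInj_tmul, Finsupp.single_eq_same]
      · rintro ⟨c', p'⟩ - hj
        by_cases hc : c' = c
        · subst hc
          rw [coverProj_tmul, Finsupp.single_eq_of_ne, TensorProduct.zero_tmul, map_zero]
          rintro rfl
          exact hj rfl
        · rw [coverProj_tmul_of_ne k P B (Ne.symm hc), map_zero]

end Cover

end ModQuiver

/-! ### The induction on dimension and on the nilpotency exponent -/

namespace Templicial

open ModQuiver

variable {R k S : Type u} [CommRing R] [CommRing k] [Algebra R k] {X : Templicial R S}

/-- The functor is the direct sum, over all c and all elements p of `P(a, c)`, of copies of `k ⊗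
X_•(c, t)`. Finite generation of the sieve lets the fillers of the components be added up. -/
lemma fillable_cover {P : ModQuiver R S} {a t : S} {V : Nec} {A : Sieve V}
    (hA : FinitelyGenerated A) (h : ∀ c, Fillable (X.baseChangeNec k c t) A) :
    Fillable (X.twistedNec (P.cover k) a t) A := by
  classical
  let B (T : Nec) : ModQuiver R S := (necFunctor X.toFunctor).obj (op T)
  refine Fillable.of_components (J := Σ c, P.hom a c) (W := fun j => X.baseChangeNec k j.1 t) hA
    (fun j => h j.1) (fun j T => (coverInj k P (B T) j.2 t).toAddMonoidHom) (fun j T U g y => ?_)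
    (fun j T => (coverProj k P (B T) j.2 t).toAddMonoidHom) (fun j T U g y => ?_)
    fun T z => exists_sum_coverInj_coverProj k P (B T) z
  · refine LinearMap.congr_fun (f := coverInj k P (B U) j.2 t ∘ₗ
      (Hom.app ((necFunctor X.toFunctor).map g.op) j.1 t).lTensor k)
      (g := Hom.app (P.cover k ◁ (necFunctor X.toFunctor).map g.op) a t ∘ₗ
        coverInj k P (B T) j.2 t) (TensorProduct.ext' fun x y => ?_) y
    exact (whiskerLeft_tmul _ _ _ _ _).symm
  · refine LinearMap.congr_fun (f := coverProj k P (B U) j.2 t ∘ₗ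
      Hom.app (P.cover k ◁ (necFunctor X.toFunctor).map g.op) a t)
      (g := (Hom.app ((necFunctor X.toFunctor).map g.op) j.1 t).lTensor k ∘ₗ
        coverProj k P (B T) j.2 t) (tensor_linearMap_ext fun c x y => ?_) y
    obtain ⟨c', p⟩ := j
    refine (congrArg (coverProj k P (B U) p t) (whiskerLeft_tmul (P.cover k)
      ((necFunctor X.toFunctor).map g.op) c x y)).trans ?_
    by_cases hc : c = c'
    · subst hc
      refine (coverProj_tmul k P (B U) p _ _).trans ?_
      exact (congrArg ((Hom.app ((necFunctor X.toFunctor).map g.op) c t).lTensor k)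
        (coverProj_tmul k P (B T) p x y)).symm
    · refine (coverProj_tmul_of_ne k P (B U) hc _ _ _).trans ?_
      exact ((congrArg ((Hom.app ((necFunctor X.toFunctor).map g.op) c' t).lTensor k)
        (coverProj_tmul_of_ne k P (B T) hc p x y)).trans (map_zero _)).symm

/-- Horns in `P ⊗ X_•` can be filled if `P` is annihilated by the kernel of `R → k`. -/
lemma fillable_of_annihilated (hsurj : Function.Surjective (algebraMap R k))
    (hX : X.LevelwiseFlat)
    (hk : ∀ n (hn : 0 < n), ∀ j ∈ Set.Ioo 0 n, ∀ c t,
      Fillable (X.baseChangeNec k c t) (Nec.hornSieve n hn (Set.Ioo 0 n \ {j})))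
    (n : ℕ) (hn : 0 < n) {j : ℕ} (hj : j ∈ Set.Ioo 0 n) {P : ModQuiver R S}
    (hP : P.Annihilated (RingHom.ker (algebraMap R k))) (a t : S) :
    Fillable (X.twistedNec P a t) (Nec.hornSieve n hn (Set.Ioo 0 n \ {j})) := by
  -- The coefficients P must vary in the induction: below, K and `K ⊗ X_i` take the place of P in
  -- lower dimensions.
  induction n using Nat.strong_induction_on generalizing j P a t with
  | _ n ih =>
  have hA : Set.Ioo 0 n \ {j} ⊂ Set.Ioo 0 n :=
    Set.ssubset_iff_exists.2 ⟨Set.sdiff_subset, j, hj, fun h => h.2 rfl⟩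
  -- In lower dimensions, all sieves of horn type with a proper set of omitted vertices are
  -- available, since `Nec.fillable_hornSieve` reduces them to inner horns.
  have hlt (m : ℕ) (hmn : m < n) (hm : 0 < m) {A : Set ℕ} (hA : A ⊂ Set.Ioo 0 m)
      {Q : ModQuiver R S} (hQ : Q.Annihilated (RingHom.ker (algebraMap R k))) :
      Fillable (X.twistedNec Q a t) (Nec.hornSieve m hm A) :=
    Nec.fillable_hornSieve (n - 1) (fun m _ hm j hj => ih m (by omega) hm hj hQ a t) m
      (by omega) hm A hA
  have hlt' (m : ℕ) (hmn : m < n) (hm : 0 < m) {Q : ModQuiver R S}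
      (hQ : Q.Annihilated (RingHom.ker (algebraMap R k))) :
      Fillable (X.twistedNec Q a t) (Nec.hornSieve m hm ∅) := by
    -- In dimension 1 there are no interior vertices, so ∅ is not a proper subset and `hlt` does not
    -- apply; but then the sieve is empty.
    by_cases h : m = 1
    · subst h
      have h0 : Set.Ioo 0 1 = (∅ : Set ℕ) := Set.eq_empty_of_forall_notMem fun i hi => by
        have := hi.1
        have := hi.2
        omega
      rw [Nec.hornSieve, h0, Nec.sieve_empty]
      exact fillable_bot
    · exact hlt m hmn hm (Set.ssubset_iff_exists.2 ⟨Set.empty_subset _, 1, ⟨one_pos, by omega⟩,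
        Set.notMem_empty _⟩) hQ
  -- The kernel K of the free cover is a quiver of submodules of k-modules, so it is again
  -- annihilated by the kernel of `R → k`.
  let π := coverMap hsurj hP
  have hK : (ModQuiver.ker π).Annihilated (RingHom.ker (algebraMap R k)) :=
    (annihilated_cover k P).of_injective (kerIncl π) fun _ _ => Subtype.val_injective
  have hex : PointwiseExact (X.twistedNecMap (kerIncl π) a t) (X.twistedNecMap π a t) :=
    hX.pointwiseExact a t (fun _ => Subtype.val_injective)
      (fun c => LinearMap.exact_subtype_ker_map (Hom.app π a c))
      fun c => coverMap_surjective hsurj hP a c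
  -- Fillers exist in dimension n for the free cover by hypothesis, so only the lifting problem
  -- along π remains; it involves K in lower dimensions only.
  refine Liftable.fillable (p := X.twistedNecMap π a t) ?_ (fillable_cover
    (Nec.finitelyGenerated_hornSieve hn hA) fun c => hk n hn j hj c t)
  refine Nec.hornSieve_induction hn (motive := Liftable (X.twistedNecMap π a t)) (liftable_bot _)
    (fun {i m} hi hm h S S' hS hS' hL => ?_) (fun {i m} hm h hi hin S S' A hS hA hS' hL => ?_) hA
  · refine hex.liftable_of_isAdjoin hS hL ?_
    rw [hS']
    -- The first bead `Δ^i` is moved into the coefficients, leaving a sieve on `Δ^m` with m < n.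
    exact Nec.fillable_cons hi hm (fillable_consFunctor hi (hlt' m (by omega) hm (hK.tensor _)))
  · refine hex.liftable_of_isAdjoin hS hL ?_
    rw [hS']
    exact hlt m (by omega) hm hA hK

/-- Horns in `P ⊗ X_•` can be filled if `P` is annihilated by a power of the kernel of `R → k`. -/
lemma fillable_of_annihilated_pow (hsurj : Function.Surjective (algebraMap R k))
    (hX : X.LevelwiseFlat)
    (hk : ∀ n (hn : 0 < n), ∀ j ∈ Set.Ioo 0 n, ∀ c t,
      Fillable (X.baseChangeNec k c t) (Nec.hornSieve n hn (Set.Ioo 0 n \ {j})))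
    {n : ℕ} (hn : 0 < n) {j : ℕ} (hj : j ∈ Set.Ioo 0 n) (m : ℕ) {P : ModQuiver R S}
    (hP : P.Annihilated (RingHom.ker (algebraMap R k) ^ m)) (a t : S) :
    Fillable (X.twistedNec P a t) (Nec.hornSieve n hn (Set.Ioo 0 n \ {j})) := by
  induction m generalizing P with
  | zero =>
    -- I^0 is the unit ideal, so P vanishes and in particular is annihilated by I.
    refine fillable_of_annihilated hsurj hX hk n hn hj (fun a b r _ p => hP a b r ?_ p) a t
    rw [pow_zero, Ideal.one_eq_top]
    trivial
  | succ m ih =>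
    let I := RingHom.ker (algebraMap R k)
    have hex : PointwiseExact (X.twistedNecMap (P.idealIncl I) a t)
        (X.twistedNecMap (P.idealProj I) a t) :=
      hX.pointwiseExact a t (fun _ => Subtype.val_injective)
        (fun c => LinearMap.exact_subtype_mkQ (I • ⊤ : Submodule R (P.hom a c)))
        fun c => Submodule.mkQ_surjective (I • ⊤ : Submodule R (P.hom a c))
    -- IP is annihilated by I^m and P/IP by I, so both ends of the exact sequence are known.
    exact hex.fillable (ih (annihilated_idealSMul hP)) (fillable_of_annihilated hsurj hX hk n hn hj
      (annihilated_idealQuotient I P) a t)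

end Templicial

theorem mainTheorem1 {R k S : Type u} [CommRing R] [CommRing k] [Algebra R k]
    (hsurj : Function.Surjective (algebraMap R k))
    (hnil : IsNilpotent (RingHom.ker (algebraMap R k)))
    (Xbar : Templicial R S) (hflat : Xbar.LevelwiseFlat)
    (X : Templicial k S) (e : Xbar.baseChange k ≅ X) (hX : X.IsQuasiCategory) :
    Xbar.IsQuasiCategory := by
  intro a b
  obtain ⟨m, hm⟩ := hnil
  have hk : ∀ n (hn : 0 < n), ∀ j ∈ Set.Ioo 0 n, ∀ c t,
      Fillable (Xbar.baseChangeNec k c t) (Nec.hornSieve n hn (Set.Ioo 0 n \ {j})) := by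
    rintro n hn j ⟨h0, h1⟩ c t
    -- An inner vertex exists only for n ≥ 2, which matches the shift by 2 in the definition of
    -- `WeakKan`.
    obtain ⟨n, rfl⟩ : ∃ r, n = r + 2 := ⟨n - 2, by omega⟩
    exact Templicial.fillable_baseChangeNec (Templicial.fillable_of_iso e
      (FreeTemplicial.fillable_of_weakKan (hX c t) (j := ⟨j, by omega⟩) h0 h1))
  refine FreeTemplicial.weakKan_of_fillable fun n j h0 h1 => ?_
  -- The coefficients are the unit quiver; any quiver is annihilated by the m-th power of the
  -- kernel, as that power is zero.
  refine Templicial.fillable_twistedNec_unit (Templicial.fillable_of_annihilated_pow hsurj hflat hk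
    (Nat.succ_pos _) ⟨h0, h1⟩ m (fun a b r hr p => ?_) a b)
  rw [hm] at hr
  rw [Ideal.mem_bot.1 hr, zero_smul]
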